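/- Let $\mathbb T=\mathbb R/\mathbb Z$ with $d\mu=dx$, let $d\nu=(2\pi)^{-1/2}e^{-v^2/2}\,dv$ on $\mathbb R$, and let $\|\cdot\|$ be the norm of the real space $L^2=L^2(\mathbb T\times\mathbb R,d\mu\,d\nu)$. Let $P=v\partial_x+(-\partial_v+v)\partial_v$ be the Fokker–Planck operator in $L^2$, with domain the set of all $f\in L^2$ such that $Pf\in L^2$ in the sense of distributions. Then $-P$ generates a strongly continuous semigroup $(e^{-tP})_{t\ge0}$ on $L^2$, and for every $t>0$ the operator $e^{-tP}(-\partial_v+v)$, defined on $C_c^\infty(\mathbb T\times\mathbb R)$, extends to a bounded operator on $L^2$. Moreover, the following holds. For every $M$ there are constants $\varepsilon_0,C_0,\kappa_0>0$ (depending only on $M$) such that the following holds for every smooth $K:\mathbb T\to\mathbb R$ with $\|K\|_{L^\infty}\le M$, for both choices of the sign $\pm$, and for every $f_0\in L^2$ with $\iint f_0\,d\mu\,d\nu=0$ and $\|f_0\|\le\varepsilon_0$. Consider the mollified Vlasov–Poisson–Fokker–Planck system $$\partial_tF+v\partial_xF+E\,\partial_v(F-\nu)=\partial_v(\partial_v+v)F,\qquad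 \pm E=K*\Big(\int F\,dv-1\Big),$$ with $F=\nu+\nu f$ and $f|_{t=0}=f_0$, where $\nu(v)=(2\pi)^{-1/2}e^{-v^2/2}$. Call $(f,E)\in C^0(\mathbb R_+,L^2)\times C^0(\mathbb R_+,L^\infty(\mathbb T))$ a mild solution if for all $t\ge0$ $$f(t)=e^{-tP}f_0+\int_0^te^{-(t-s)P}(-\partial_v+v)\big(E(s)f(s)\big)\,ds,\qquad \pm E(t)=K*\int f(t)\,d\nu,$$ where the integral is a Bochner integral in $L^2$. 1. There exists a unique mild solution $(f,E)\in C^0(\mathbb R_+,L^2)\times C^0(\mathbb R_+,L^\infty(\mathbb T))$. 2. It satisfies, for all $t\ge0$, $\|f(t)\|\le C_0e^{-\kappa_0t}$ and $\|E(t)\|_{L^\infty}\le C_0e^{-\kappa_0t}$. With the same constants, 1 and 2 also hold when the integrand in the definition of a mild solution is replaced by $E(s)\,e^{-(t-s)P}(-\partial_v+v)f(s)$, with the field written in front of the semigroup. -/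

import Mathlib

open MeasureTheory ProbabilityTheory Filter Topology
open scoped NNReal ENNReal ContDiff Convolution

noncomputable section

namespace VPFP

/-- The one-dimensional torus `ℝ / ℤ`, of total length `1`; Lebesgue measure on it is the
probability measure `dμ = dx` (no external potential). -/
abbrev Torus : Type := UnitAddCircle

/-- The standard Gaussian `dν = (2π)^{-1/2} exp (-v²/2) dv` in velocity. -/
abbrev gaussV : Measure ℝ := gaussianReal 0 1

/-- The probability measure `dμ dν` on phase space `𝕋 × ℝ`. -/
abbrev phaseMeasure : Measure (Torus × ℝ) := (volume : Measure Torus).prod gaussV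

/-- The real Hilbert space `L²(dμ dν)`. -/
abbrev L2 : Type := Lp ℝ 2 phaseMeasure

/-- The space `L^∞(dx)` on the torus. -/
abbrev LInf : Type := Lp ℝ ∞ (volume : Measure Torus)

/-! ### Differential operators on smooth functions on phase space -/

/-- `∂_x φ` at a point of `𝕋 × ℝ`. -/
def dx (φ : Torus × ℝ → ℝ) (p : Torus × ℝ) : ℝ :=
  deriv (fun y : ℝ => φ (p.1 + (y : Torus), p.2)) 0

/-- `∂_v φ`. -/
def dv (φ : Torus × ℝ → ℝ) (p : Torus × ℝ) : ℝ :=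
  deriv (fun w : ℝ => φ (p.1, w)) p.2

/-- `(-∂_v + v) φ`. -/
def dvStar (φ : Torus × ℝ → ℝ) (p : Torus × ℝ) : ℝ :=
  -dv φ p + p.2 * φ p

/-- The formal adjoint in `L²(dμ dν)` of `P = v ∂_x + (-∂_v + v) ∂_v`, that is
`-v ∂_x φ + (-∂_v + v) ∂_v φ`. -/
def fpAdjoint (φ : Torus × ℝ → ℝ) (p : Torus × ℝ) : ℝ :=
  -(p.2 * dx φ p) + dvStar (dv φ) p

/-- `C_c^∞(𝕋 × ℝ)`: the lift to `ℝ × ℝ` is smooth, and the support is compact. -/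
def IsTestFunction (φ : Torus × ℝ → ℝ) : Prop :=
  ContDiff ℝ ∞ (fun q : ℝ × ℝ => φ ((q.1 : Torus), q.2)) ∧ HasCompactSupport φ

/-! ### The Fokker-Planck operator and its semigroup -/

/-- `f` lies in the domain of `P = v ∂_x + (-∂_v + v) ∂_v` in `L²(dμ dν)` and `P f = h`:
the domain consists of all `f` in `L²` such that `P f`, taken in the sense of distributions,
is in `L²`. -/
def HasFP (f h : L2) : Prop :=
  ∀ φ : Torus × ℝ → ℝ, IsTestFunction φ →
    ∫ p, h p * φ p ∂phaseMeasure = ∫ p, f p * fpAdjoint φ p ∂phaseMeasure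

/-- Strongly continuous one-parameter semigroups of bounded operators on `L²(dμ dν)`. -/
structure IsC0Semigroup (S : ℝ≥0 → L2 →L[ℝ] L2) : Prop where
  zero : S 0 = ContinuousLinearMap.id ℝ L2
  add : ∀ s t : ℝ≥0, S (s + t) = (S s).comp (S t)
  cont : ∀ f : L2, Continuous (fun t : ℝ≥0 => S t f)

/-- `f` lies in the domain of the infinitesimal generator of `S`, with value `g`. -/
def HasGenerator (S : ℝ≥0 → L2 →L[ℝ] L2) (f g : L2) : Prop :=
  Tendsto (fun t : ℝ≥0 => (t : ℝ)⁻¹ • (S t f - f)) (𝓝[>] 0) (𝓝 g)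

/-- `S t = e^{-tP}`: `S` is the strongly continuous semigroup whose infinitesimal generator is
exactly `-P` (same domain, same values). -/
structure IsFPSemigroup (S : ℝ≥0 → L2 →L[ℝ] L2) : Prop where
  semigroup : IsC0Semigroup S
  generator : ∀ f h : L2, HasGenerator S f (-h) ↔ HasFP f h

/-- `B τ`, for `τ > 0`, is the bounded operator `e^{-τP} (-∂_v + v)` on `L²(dμ dν)`, i.e. the
continuous extension to `L²` of `φ ↦ e^{-τP} ((-∂_v + v) φ)` from the dense subspace of test
functions. (The value of `B` at `0` plays no role.) -/
def IsFPDvStar (S B : ℝ≥0 → L2 →L[ℝ] L2) : Prop :=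
  ∀ τ : ℝ≥0, 0 < τ → ∀ φ : Torus × ℝ → ℝ, IsTestFunction φ →
    ∀ g h : L2, g =ᵐ[phaseMeasure] φ → h =ᵐ[phaseMeasure] dvStar φ → B τ g = S τ h

/-! ### The field and the Duhamel formula -/

/-- The pointwise product `E(x) f(x, v)` of `E ∈ L^∞(dx)` and `f ∈ L²(dμ dν)`. -/
def fieldMul (E : LInf) (f : L2) : L2 :=
  (Lp.compMeasurePreserving (Prod.fst : Torus × ℝ → Torus)
    (measurePreserving_fst (μ := (volume : Measure Torus)) (ν := gaussV)) E :
      Lp ℝ ∞ phaseMeasure) • f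

/-- The macroscopic density `r(x) = ∫ f(x, v) dν(v)`. -/
def density (f : L2) (x : Torus) : ℝ := ∫ v, f (x, v) ∂gaussV

/-- The Duhamel integrand with the field inside the semigroup:
`e^{-τP} E (-∂_v + v) f = e^{-τP} (-∂_v + v) (E f)`, where `E = E(x)` commutes with `∂_v`. -/
def fieldInside (B : ℝ≥0 → L2 →L[ℝ] L2) (τ : ℝ≥0) (E : LInf) (f : L2) : L2 :=
  B τ (fieldMul E f)

/-- The Duhamel integrand with the field written in front of the semigroup:
`E e^{-τP} (-∂_v + v) f`. -/
def fieldOutside (B : ℝ≥0 → L2 →L[ℝ] L2) (τ : ℝ≥0) (E : LInf) (f : L2) : L2 :=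
  fieldMul E (B τ f)

/-- `(f, E)` is a mild solution with initial datum `f₀`, kernel `K` and sign `σ = ±1`:
`f(t) = e^{-tP} f₀ + ∫₀ᵗ N(t - s, E(s), f(s)) ds` for all `t ≥ 0` (a Bochner integral in `L²`)
and `±E(t) = K * r(t)`. Here `N` is one of the two integrands above. -/
structure IsMildSolution (S : ℝ≥0 → L2 →L[ℝ] L2) (N : ℝ≥0 → LInf → L2 → L2)
    (K : Torus → ℝ) (σ : ℝ) (f₀ : L2) (f : C(ℝ≥0, L2)) (E : C(ℝ≥0, LInf)) : Prop where
  integrable : ∀ t : ℝ≥0, IntervalIntegrable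
    (fun s : ℝ => N (t - s.toNNReal) (E s.toNNReal) (f s.toNNReal)) volume 0 t
  duhamel : ∀ t : ℝ≥0, f t = S t f₀ +
    ∫ s in (0 : ℝ)..t, N (t - s.toNNReal) (E s.toNNReal) (f s.toNNReal)
  field : ∀ t : ℝ≥0, ∀ᵐ x ∂(volume : Measure Torus),
    σ * E t x = (K ⋆[ContinuousLinearMap.lsmul ℝ ℝ, (volume : Measure Torus)] density (f t)) x

end VPFP

end

/-!
The proof rests on an exact splitting of the Fokker–Planck semigroup. On the Fourier mode
`e^{iξx}`, the operator `P` becomes `a^* a + iξ (a + a^*)` with `a = ∂_v`, `a^* = -∂_v + v`, and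
`e^{-tP}` is a Gaussian operator on Fock space; writing it as a product of Weyl operators and of
`e^{-t a^* a}` gives
`e^{-tP} = T_τ ∘ e^{(t - 2τ) ∂_x²} ∘ e^{-t a^* a} ∘ T_τ`, `τ = tanh (t / 2)`,
where `T_τ f(x, v) = f(x - τv, v)`. This formula (with `-τ` in place of `τ` for the adjoint) is
taken as the definition `semi`. The Ornstein–Uhlenbeck and heat factors are averages over one
auxiliary Gaussian variable of a measure-preserving involution (`avg`), so that they are symmetric
contractions. All operators act explicitly on the real characters `cos (2πkx + ηv + θ)`, which
span a dense subspace (`dense_trigSpan`); identities such as the semigroup law are checked there.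

* Generator (`isFPSemigroup_semi`). If `Pf = h` weakly against all characters, then
  `S_t f - f = -∫₀ᵗ S_s h ds`, since the orbit of a character under the adjoint semigroup stays in
  the characters and solves the evolution equation pointwise (`semi_sub_eq_integral`). A cutoff in
  `v` passes from test functions to characters (`HasFP.inner_chL`). Conversely, test functions are
  in the domain of the adjoint generator by the same argument for the adjoint semigroup, and
  duality concludes (`hasFP_of_hasGenerator`).
* Decay (`norm_semi_le_of_mean_zero`). For the symmetric semigroup `G_t` of the product of the
  heat and Ornstein–Uhlenbeck flows, `‖G_t g‖ ≤ C_g e^{-t}` for mean-zero trigonometric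
  polynomials `g`. By log-convexity of `t ↦ ‖G_t g‖` the constant improves to `‖g‖`, hence the bound
  holds on all mean-zero functions. As `e^{-tP}` contains `G_{t - 2τ}` and `τ ≤ 1`, its norm on
  mean-zero functions is at most `e^{2 - t}`.
* Smoothing (`norm_semiDvStar_le_exp`). Gaussian integration by parts in the auxiliary variables
  bounds `∂_v e^{-tP^*}`, hence its adjoint `e^{-tP} (-∂_v + v)`, by
  `(e^{2t} - 1)^{-1/2} + τ (2 (t - 2τ))^{-1/2}`. Since `t - 2τ ≥ t³/48` for `t ≤ 1`, this is
  `O(t^{-1/2})`; its range consists of mean-zero functions, which gives exponential decay.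
* Nonlinear problem. The field is a bounded linear function of `f`, so the mild formulation is a
  quadratic Duhamel equation with kernel `O(τ^{-1/2} e^{-τ/2})`. A contraction argument among
  functions `O(e^{-t/4})` yields a decaying solution (`QuadraticKernel.exists_solution`), and a
  Gronwall argument in the norm `sup e^{-λt} ‖·‖` shows that it is the only continuous one
  (`QuadraticKernel.unique`). Neither step uses the position of the field, nor the conservation of
  the mean along the nonlinear flow.
-/

open MeasureTheory ProbabilityTheory Filter Topology
open scoped NNReal ENNReal ContDiff Convolution

noncomputable section

namespace VPFP

/-! ### Real characters of phase space and their density -/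

/-- The angular frequency `2πk` of the `k`-th Fourier mode of the torus. -/
def freq (k : ℤ) : ℝ := 2 * Real.pi * k

/-- The real character `(x, v) ↦ cos (2πkx + ηv + θ)` of phase space. The phase `θ` is kept as a
parameter so that the family is stable under differentiation, which shifts it by `π / 2`. It is
written through `fourier` because `x` lives on the torus; see `ch_coe`. -/
def ch (k : ℤ) (η θ : ℝ) (p : Torus × ℝ) : ℝ :=
  ((fourier k p.1 : ℂ) * Complex.exp (((η * p.2 + θ : ℝ) : ℂ) * Complex.I)).re

lemma ch_coe (k : ℤ) (η θ y v : ℝ) :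
    ch k η θ ((y : Torus), v) = Real.cos (freq k * y + η * v + θ) := by
  unfold ch freq
  rw [fourier_coe_apply, ← Complex.exp_add, ← Complex.exp_ofReal_mul_I_re]
  congr 2
  push_cast
  ring

lemma exists_coe (x : Torus) : ∃ y : ℝ, (y : Torus) = x := QuotientAddGroup.mk_surjective x

lemma continuous_ch (k : ℤ) (η θ : ℝ) : Continuous (ch k η θ) := by
  unfold ch
  fun_prop

lemma abs_ch_le (k : ℤ) (η θ : ℝ) (p : Torus × ℝ) : |ch k η θ p| ≤ 1 := by
  obtain ⟨x, v⟩ := p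
  obtain ⟨y, rfl⟩ := exists_coe x
  rw [ch_coe]
  exact Real.abs_cos_le_one _

lemma memLp_of_continuous_of_bounded {g : Torus × ℝ → ℝ} (hg : Continuous g) (C : ℝ)
    (hC : ∀ p, |g p| ≤ C) : MemLp g 2 phaseMeasure :=
  MemLp.of_bound hg.aestronglyMeasurable C (ae_of_all _ hC)

lemma memLp_ch (k : ℤ) (η θ : ℝ) : MemLp (ch k η θ) 2 phaseMeasure :=
  memLp_of_continuous_of_bounded (continuous_ch k η θ) 1 (abs_ch_le k η θ)

/-- The real character as an element of `L²(dμ dν)`. -/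
def chL (k : ℤ) (η θ : ℝ) : L2 := (memLp_ch k η θ).toLp _

lemma coeFn_chL (k : ℤ) (η θ : ℝ) : chL k η θ =ᵐ[phaseMeasure] ch k η θ := MemLp.coeFn_toLp _

lemma inner_eq_integral {α : Type*} [MeasurableSpace α] {μ : Measure α} (f g : Lp ℝ 2 μ) :
    inner ℝ f g = ∫ p, f p * g p ∂μ := by
  simp [L2.inner_def, mul_comm]

lemma inner_chL (f : L2) (k : ℤ) (η θ : ℝ) :
    inner ℝ f (chL k η θ) = ∫ p, f p * ch k η θ p ∂phaseMeasure := by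
  rw [inner_eq_integral]
  refine integral_congr_ae ?_
  filter_upwards [coeFn_chL k η θ] with p hp
  rw [hp]

lemma ch_mul_ch (k l : ℤ) (η θ η' θ' : ℝ) (p : Torus × ℝ) :
    ch k η θ p * ch l η' θ' p =
      (1 / 2 : ℝ) * ch (k + l) (η + η') (θ + θ') p
        + (1 / 2 : ℝ) * ch (k - l) (η - η') (θ - θ') p := by
  obtain ⟨x, v⟩ := p
  obtain ⟨y, rfl⟩ := exists_coe x
  simp only [ch_coe]
  have h1 : freq (k + l) * y + (η + η') * v + (θ + θ') =
      (freq k * y + η * v + θ) + (freq l * y + η' * v + θ') := by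
    unfold freq; push_cast; ring
  have h2 : freq (k - l) * y + (η - η') * v + (θ - θ') =
      (freq k * y + η * v + θ) - (freq l * y + η' * v + θ') := by
    unfold freq; push_cast; ring
  rw [h1, h2]
  generalize freq k * y + η * v + θ = a
  generalize freq l * y + η' * v + θ' = b
  rw [Real.cos_add, Real.cos_sub]
  ring

/-- The real character as a bounded continuous function. -/
def chB (i : ℤ × ℝ × ℝ) : BoundedContinuousFunction (Torus × ℝ) ℝ :=
  BoundedContinuousFunction.ofNormedAddCommGroup (ch i.1 i.2.1 i.2.2) (continuous_ch _ _ _) 1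
    (abs_ch_le _ _ _)

lemma chB_apply (i : ℤ × ℝ × ℝ) (p : Torus × ℝ) : chB i p = ch i.1 i.2.1 i.2.2 p := rfl

lemma ch_zero (η θ : ℝ) (p : Torus × ℝ) : ch 0 η θ p = Real.cos (η * p.2 + θ) := by
  obtain ⟨x, v⟩ := p
  obtain ⟨y, rfl⟩ := exists_coe x
  simp [ch_coe, freq]

lemma one_mem_span_chB :
    (1 : BoundedContinuousFunction (Torus × ℝ) ℝ) ∈ Submodule.span ℝ (Set.range chB) := by
  refine Submodule.subset_span ⟨(0, 0, 0), ?_⟩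
  ext p
  simp [chB_apply, ch_zero]

lemma mul_mem_span_chB (f g : BoundedContinuousFunction (Torus × ℝ) ℝ)
    (hf : f ∈ Submodule.span ℝ (Set.range chB)) (hg : g ∈ Submodule.span ℝ (Set.range chB)) :
    f * g ∈ Submodule.span ℝ (Set.range chB) := by
  have h : Submodule.span ℝ (Set.range chB) * Submodule.span ℝ (Set.range chB) ≤
      Submodule.span ℝ (Set.range chB) := by
    rw [Submodule.span_mul_span, Submodule.span_le]
    rintro _ ⟨_, ⟨i, rfl⟩, _, ⟨j, rfl⟩, rfl⟩
    have : chB i * chB j = (1 / 2 : ℝ) • chB (i.1 + j.1, i.2.1 + j.2.1, i.2.2 + j.2.2)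
        + (1 / 2 : ℝ) • chB (i.1 - j.1, i.2.1 - j.2.1, i.2.2 - j.2.2) := by
      ext p
      simpa [chB_apply] using ch_mul_ch i.1 j.1 i.2.1 i.2.2 j.2.1 j.2.2 p
    simp only [this, SetLike.mem_coe]
    exact Submodule.add_mem _ (Submodule.smul_mem _ _ (Submodule.subset_span ⟨_, rfl⟩))
      (Submodule.smul_mem _ _ (Submodule.subset_span ⟨_, rfl⟩))
  exact h (Submodule.mul_mem_mul hf hg)

/-- The algebra of real trigonometric polynomials on phase space (arbitrary frequencies in `v`). -/
def trigAlgebra : StarSubalgebra ℝ (BoundedContinuousFunction (Torus × ℝ) ℝ) where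
  toSubalgebra := (Submodule.span ℝ (Set.range chB)).toSubalgebra one_mem_span_chB
    mul_mem_span_chB
  star_mem' := by
    intro f hf
    have : star f = f := by ext p; simp
    rwa [this]

lemma mem_trigAlgebra {f : BoundedContinuousFunction (Torus × ℝ) ℝ} :
    f ∈ trigAlgebra ↔ f ∈ Submodule.span ℝ (Set.range chB) := Iff.rfl

lemma ch_separates {p p' : Torus × ℝ} (h : p ≠ p') :
    ∃ k η θ, ch k η θ p ≠ ch k η θ p' := by
  by_contra! hcon
  obtain ⟨x, v⟩ := p
  obtain ⟨x', v'⟩ := p'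
  -- a frequency in `v` for which the phases at `v` and `v'` differ by `π / 2`
  have hv : v = v' := by
    by_contra hv
    have hv' : v - v' ≠ 0 := sub_ne_zero.2 hv
    have := hcon 0 (Real.pi / (v - v') / 2) (-(Real.pi / (v - v') / 2 * v'))
    simp only [ch_zero] at this
    have e : Real.pi / (v - v') / 2 * v + -(Real.pi / (v - v') / 2 * v') = Real.pi / 2 := by
      field_simp
      ring
    rw [e] at this
    simp at this
  subst hv
  obtain ⟨y, rfl⟩ := exists_coe x
  obtain ⟨y', rfl⟩ := exists_coe x'
  have h1 := hcon 1 0 0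
  have h2 := hcon 1 0 (-(Real.pi / 2))
  simp only [ch_coe, freq, Int.cast_one, mul_one, zero_mul, add_zero] at h1 h2
  rw [← sub_eq_add_neg, ← sub_eq_add_neg, Real.cos_sub_pi_div_two, Real.cos_sub_pi_div_two] at h2
  apply h
  have : (fourier 1 (y : Torus) : ℂ) = fourier 1 (y' : Torus) := by
    rw [fourier_coe_apply, fourier_coe_apply]
    have e : ∀ z : ℝ, (2 * Real.pi * Complex.I * ((1 : ℤ) : ℂ) * z / ((1 : ℝ) : ℂ)) =
        ((2 * Real.pi * z : ℝ) : ℂ) * Complex.I := by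
      intro z; push_cast; ring
    rw [e, e, Complex.exp_mul_I, Complex.exp_mul_I, ← Complex.ofReal_cos, ← Complex.ofReal_cos,
      ← Complex.ofReal_sin, ← Complex.ofReal_sin, h1, h2]
  rw [fourier_one, fourier_one] at this
  have := AddCircle.injective_toCircle one_ne_zero (Subtype.ext this)
  rw [this]

/-- Real characters separate elements of `L²`: the positive and negative parts of a function
orthogonal to all of them are densities of the same finite measure. -/
lemma eq_zero_of_inner_chL (f : L2) (hf : ∀ k η θ, inner ℝ f (chL k η θ) = 0) : f = 0 := by
  have hint : Integrable f phaseMeasure := (Lp.memLp f).integrable (by norm_num)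
  have hpos : ∫⁻ p, ENNReal.ofReal (f p) ∂phaseMeasure ≠ ⊤ := by
    have := hint.lintegral_lt_top
    exact this.ne
  have hneg : ∫⁻ p, ENNReal.ofReal (-f p) ∂phaseMeasure ≠ ⊤ := by
    have := hint.neg.lintegral_lt_top
    exact this.ne
  have m1 : AEMeasurable (fun p => ENNReal.ofReal (f p)) phaseMeasure :=
    hint.aestronglyMeasurable.aemeasurable.ennreal_ofReal
  have m2 : AEMeasurable (fun p => ENNReal.ofReal (-f p)) phaseMeasure :=
    hint.neg.aestronglyMeasurable.aemeasurable.ennreal_ofReal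
  have : IsFiniteMeasure (phaseMeasure.withDensity fun p => ENNReal.ofReal (f p)) :=
    isFiniteMeasure_withDensity hpos
  have : IsFiniteMeasure (phaseMeasure.withDensity fun p => ENNReal.ofReal (-f p)) :=
    isFiniteMeasure_withDensity hneg
  have hA : (trigAlgebra.map
      (BoundedContinuousFunction.toContinuousMapStarₐ ℝ)).SeparatesPoints := by
    intro p p' hpp
    obtain ⟨k, η, θ, h⟩ := ch_separates hpp
    exact ⟨_, ⟨_, ⟨chB (k, η, θ), mem_trigAlgebra.2 (Submodule.subset_span ⟨_, rfl⟩), rfl⟩, rfl⟩, h⟩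
  have key : ∀ g ∈ trigAlgebra, ∫ p, f p * g p ∂phaseMeasure = 0 := by
    intro g hg
    have hi : ∀ g : BoundedContinuousFunction (Torus × ℝ) ℝ,
        Integrable (fun p => f p * g p) phaseMeasure := fun g =>
      hint.mul_bdd g.continuous.aestronglyMeasurable (ae_of_all _ g.norm_coe_le_norm)
    refine Submodule.span_induction (p := fun g _ => ∫ p, f p * g p ∂phaseMeasure = 0)
      ?_ ?_ ?_ ?_ (mem_trigAlgebra.1 hg)
    · rintro _ ⟨i, rfl⟩
      rw [← hf i.1 i.2.1 i.2.2, inner_chL]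
      rfl
    · simp
    · intro g₁ g₂ _ _ h₁ h₂
      simp only [BoundedContinuousFunction.coe_add, Pi.add_apply, mul_add]
      rw [integral_add (hi g₁) (hi g₂), h₁, h₂, add_zero]
    · intro c g _ h
      have : ∀ p, f p * (c • g) p = c * (f p * g p) := fun p => by
        simp only [BoundedContinuousFunction.coe_smul, smul_eq_mul]; ring
      simp only [this]
      rw [integral_const_mul, h, mul_zero]
  have hmeas : (phaseMeasure.withDensity fun p => ENNReal.ofReal (f p)) =
      phaseMeasure.withDensity fun p => ENNReal.ofReal (-f p) := by
    refine ext_of_forall_mem_subalgebra_integral_eq_of_polish hA ?_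
    intro g hg
    rw [integral_withDensity_eq_integral_toReal_smul₀ m1
        (ae_of_all _ fun _ => ENNReal.ofReal_lt_top),
      integral_withDensity_eq_integral_toReal_smul₀ m2 (ae_of_all _ fun _ => ENNReal.ofReal_lt_top),
      ← sub_eq_zero, ← integral_sub, ← key g hg]
    · refine integral_congr_ae (ae_of_all _ fun p => ?_)
      simp only [ENNReal.toReal_ofReal', smul_eq_mul, ← sub_mul]
      congr 1
      rcases le_total 0 (f p) with h | h
      · rw [max_eq_left h, max_eq_right (by linarith)]; ring
      · rw [max_eq_right h, max_eq_left (by linarith)]; ring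
    · simp only [ENNReal.toReal_ofReal', smul_eq_mul]
      exact hint.pos_part.mul_bdd g.continuous.aestronglyMeasurable
        (ae_of_all _ g.norm_coe_le_norm)
    · simp only [ENNReal.toReal_ofReal', smul_eq_mul]
      exact hint.neg.pos_part.mul_bdd g.continuous.aestronglyMeasurable
        (ae_of_all _ g.norm_coe_le_norm)
  rw [withDensity_eq_iff m1 m2 hpos] at hmeas
  refine (Lp.eq_zero_iff_ae_eq_zero).2 ?_
  filter_upwards [hmeas] with p hp
  have hp' := congrArg ENNReal.toReal hp
  simp only [ENNReal.toReal_ofReal'] at hp'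
  simp only [Pi.zero_apply]
  rcases le_total 0 (f p) with h | h
  · rw [max_eq_left h, max_eq_right (by linarith)] at hp'; exact hp'
  · rw [max_eq_right h, max_eq_left (by linarith)] at hp'; linarith

/-- The space of real trigonometric polynomials inside `L²(dμ dν)`. -/
def trigSpan : Submodule ℝ L2 :=
  Submodule.span ℝ (Set.range fun i : ℤ × ℝ × ℝ => chL i.1 i.2.1 i.2.2)

lemma chL_mem_trigSpan (k : ℤ) (η θ : ℝ) : chL k η θ ∈ trigSpan :=
  Submodule.subset_span ⟨(k, η, θ), rfl⟩

lemma dense_trigSpan : Dense (trigSpan : Set L2) := by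
  rw [Submodule.dense_iff_topologicalClosure_eq_top, Submodule.topologicalClosure_eq_top_iff,
    Submodule.eq_bot_iff]
  intro f hf
  refine eq_zero_of_inner_chL f fun k η θ => ?_
  rw [Submodule.mem_orthogonal'] at hf
  exact hf _ (chL_mem_trigSpan k η θ)

lemma eq_of_inner_chL {f g : L2} (h : ∀ k η θ, inner ℝ f (chL k η θ) = inner ℝ g (chL k η θ)) :
    f = g := by
  rw [← sub_eq_zero]
  refine eq_zero_of_inner_chL _ fun k η θ => ?_
  rw [inner_sub_left, h, sub_self]

/-- A bounded operator on `L²` is determined by its values on characters. -/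
lemma clm_ext_chL {F : Type*} [NormedAddCommGroup F] [NormedSpace ℝ F] {A B : L2 →L[ℝ] F}
    (h : ∀ k η θ, A (chL k η θ) = B (chL k η θ)) : A = B :=
  ContinuousLinearMap.ext_on (s := Set.range fun i : ℤ × ℝ × ℝ => chL i.1 i.2.1 i.2.2)
    dense_trigSpan (by rintro _ ⟨i, rfl⟩; exact h _ _ _)

/-! ### Gaussian integrals and averaging operators -/

/-- Gaussian integration by parts. -/
lemma gaussian_integration_by_parts {F F' : ℝ → ℝ} (hF : ∀ v, HasDerivAt F (F' v) v)
    (h0 : Integrable F gaussV) (h1 : Integrable F' gaussV)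
    (h2 : Integrable (fun v => v * F v) gaussV) :
    ∫ v, F' v ∂gaussV = ∫ v, v * F v ∂gaussV := by
  have conv : ∀ {g : ℝ → ℝ}, Integrable g gaussV →
      Integrable (fun v => gaussianPDFReal 0 1 v * g v) volume := by
    intro g hg
    rw [gaussV, gaussianReal_of_var_ne_zero 0 one_ne_zero,
      integrable_withDensity_iff_integrable_smul' (measurable_gaussianPDF 0 1)
        (ae_of_all _ fun _ => gaussianPDF_lt_top)] at hg
    simpa [toReal_gaussianPDF] using hg
  have hd : ∀ v, HasDerivAt (fun v => gaussianPDFReal 0 1 v * F v)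
      (gaussianPDFReal 0 1 v * F' v - gaussianPDFReal 0 1 v * (v * F v)) v := by
    intro v
    have hp : HasDerivAt (gaussianPDFReal 0 1) (gaussianPDFReal 0 1 v * (-v)) v := by
      have e : gaussianPDFReal 0 1 = fun x : ℝ =>
          (Real.sqrt (2 * Real.pi * (1 : ℝ≥0)))⁻¹ * Real.exp (-(x - 0) ^ 2 / (2 * (1 : ℝ≥0))) := by
        ext x; rfl
      rw [e]
      have h : HasDerivAt (fun x : ℝ => -(x - 0) ^ 2 / (2 * ((1 : ℝ≥0) : ℝ))) (-v) v := by
        have := ((((hasDerivAt_id v).sub_const 0).pow 2).neg).div_const (2 * ((1 : ℝ≥0) : ℝ))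
        convert! this using 1
        simp only [NNReal.coe_one, id, sub_zero]
        push_cast
        ring
      convert! (h.exp.const_mul _) using 1
      ring
    convert! hp.mul (hF v) using 1
    ring
  have := integral_eq_zero_of_hasDerivAt_of_integrable hd ((conv h1).sub (conv h2)) (conv h0)
  rw [integral_sub (conv h1) (conv h2), sub_eq_zero] at this
  rw [gaussV, integral_gaussianReal_eq_integral_smul one_ne_zero,
    integral_gaussianReal_eq_integral_smul one_ne_zero]
  simpa using this

lemma memLp_id_gaussV : MemLp (fun w : ℝ => w) 2 gaussV := memLp_id_gaussianReal' 2 (by norm_num)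

lemma integral_sq_gaussV : ∫ w : ℝ, w ^ 2 ∂gaussV = 1 := by
  have h := variance_fun_id_gaussianReal (μ := 0) (v := 1)
  rw [variance_eq_integral measurable_id'.aemeasurable] at h
  simpa using h

lemma integral_cos_gaussV (a b : ℝ) :
    ∫ w, Real.cos (a + b * w) ∂gaussV = Real.exp (-b ^ 2 / 2) * Real.cos a := by
  have h := charFun_gaussianReal (μ := 0) (v := 1) b
  rw [charFun_apply_real] at h
  have hi : Integrable (fun w : ℝ => Complex.exp (b * w * Complex.I)) gaussV := by
    refine Integrable.of_bound (by fun_prop) 1 (ae_of_all _ fun w => ?_)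
    rw [← Complex.ofReal_mul, Complex.norm_exp_ofReal_mul_I]
  have e : ∀ w : ℝ, Real.cos (a + b * w) =
      (Complex.exp (a * Complex.I) * Complex.exp (b * w * Complex.I)).re := by
    intro w
    rw [← Complex.exp_add, ← Complex.exp_ofReal_mul_I_re]
    congr 2; push_cast; ring
  have e2 := integral_re (hi.const_mul (Complex.exp (a * Complex.I)))
  simp only [RCLike.re_to_complex] at e2
  simp_rw [e]
  rw [e2, integral_const_mul, h]
  have : (b * (0 : ℝ) * Complex.I - (1 : ℝ≥0) * (b : ℂ) ^ 2 / 2 : ℂ) = ((-b ^ 2 / 2 : ℝ) : ℂ) := by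
    push_cast; simp; ring
  rw [this, ← Complex.ofReal_exp, Complex.re_mul_ofReal, Complex.exp_ofReal_mul_I_re, mul_comm]

lemma integral_mul_cos_gaussV (a b : ℝ) :
    ∫ w, w * Real.cos (a + b * w) ∂gaussV =
      b * Real.exp (-b ^ 2 / 2) * Real.cos (a + Real.pi / 2) := by
  have hF : ∀ w, HasDerivAt (fun w : ℝ => Real.cos (a + b * w))
      (b * Real.cos (a + Real.pi / 2 + b * w)) w := by
    intro w
    have h := (((hasDerivAt_id w).const_mul b).const_add a).cos
    convert! h using 1
    rw [add_right_comm, Real.cos_add_pi_div_two]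
    simp only [id, mul_one]
    ring
  have hb : ∀ a' : ℝ, Integrable (fun w : ℝ => Real.cos (a' + b * w)) gaussV := fun a' =>
    Integrable.of_bound (by fun_prop) 1 (ae_of_all _ fun w => Real.abs_cos_le_one _)
  have h2 : Integrable (fun w : ℝ => w * Real.cos (a + b * w)) gaussV := by
    have h := memLp_id_gaussV.integrable (by norm_num : (1 : ℝ≥0∞) ≤ 2)
    exact h.mul_bdd (by fun_prop) (ae_of_all _ fun w => Real.abs_cos_le_one _)
  rw [← gaussian_integration_by_parts hF (hb a) ((hb _).const_mul b) h2, integral_const_mul,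
    integral_cos_gaussV]
  ring

lemma integral_ch_phase (k : ℤ) (η θ b : ℝ) (p : Torus × ℝ) :
    ∫ w, ch k η (θ + b * w) p ∂gaussV = Real.exp (-b ^ 2 / 2) * ch k η θ p := by
  obtain ⟨x, v⟩ := p
  obtain ⟨y, rfl⟩ := exists_coe x
  simp only [ch_coe, ← add_assoc]
  exact integral_cos_gaussV _ _

lemma integral_mul_ch_phase (k : ℤ) (η θ b : ℝ) (p : Torus × ℝ) :
    ∫ w, w * ch k η (θ + b * w) p ∂gaussV =
      b * Real.exp (-b ^ 2 / 2) * ch k η (θ + Real.pi / 2) p := by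
  obtain ⟨x, v⟩ := p
  obtain ⟨y, rfl⟩ := exists_coe x
  simp only [ch_coe, ← add_assoc]
  exact integral_mul_cos_gaussV _ _

/-- Phase space with an auxiliary Gaussian variable. -/
abbrev extMeasure : Measure ((Torus × ℝ) × ℝ) := phaseMeasure.prod gaussV

lemma memLp_tensor {f : Torus × ℝ → ℝ} {h : ℝ → ℝ} (hf : MemLp f 2 phaseMeasure)
    (hh : MemLp h 2 gaussV) : MemLp (fun y : (Torus × ℝ) × ℝ => f y.1 * h y.2) 2 extMeasure := by
  have hm : AEStronglyMeasurable (fun y : (Torus × ℝ) × ℝ => f y.1 * h y.2) extMeasure :=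
    hf.1.comp_fst.mul hh.1.comp_snd
  rw [memLp_two_iff_integrable_sq hm]
  have := hf.integrable_sq.mul_prod hh.integrable_sq
  refine this.congr (ae_of_all _ fun y => ?_)
  simp only
  ring

/-- The operator `f ↦ f ⊗ h` from `L²(dμ dν)` to `L²(dμ dν dν)`. -/
def tensorₗ (h : ℝ → ℝ) (hh : MemLp h 2 gaussV) : L2 →ₗ[ℝ] Lp ℝ 2 extMeasure where
  toFun f := (memLp_tensor (Lp.memLp f) hh).toLp _
  map_add' f g := by
    rw [← MemLp.toLp_add]
    refine MemLp.toLp_congr _ _ ?_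
    filter_upwards [Measure.quasiMeasurePreserving_fst.ae_eq_comp (Lp.coeFn_add f g)] with y hy
    simp only [Function.comp, Pi.add_apply] at hy
    simp only [Pi.add_apply, hy, add_mul]
  map_smul' c f := by
    rw [RingHom.id_apply, ← MemLp.toLp_const_smul]
    refine MemLp.toLp_congr _ _ ?_
    filter_upwards [Measure.quasiMeasurePreserving_fst.ae_eq_comp (Lp.coeFn_smul c f)] with y hy
    simp only [Function.comp, Pi.smul_apply, smul_eq_mul] at hy
    simp only [Pi.smul_apply, hy, smul_eq_mul, mul_assoc]

lemma coeFn_tensorₗ (h : ℝ → ℝ) (hh : MemLp h 2 gaussV) (f : L2) :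
    tensorₗ h hh f =ᵐ[extMeasure] fun y => f y.1 * h y.2 :=
  MemLp.coeFn_toLp (memLp_tensor (Lp.memLp f) hh)

lemma norm_tensorₗ (h : ℝ → ℝ) (hh : MemLp h 2 gaussV) (h1 : ∫ w, h w ^ 2 ∂gaussV = 1) (f : L2) :
    ‖tensorₗ h hh f‖ = ‖f‖ := by
  have : ‖tensorₗ h hh f‖ ^ 2 = ‖f‖ ^ 2 := by
    rw [← real_inner_self_eq_norm_sq, ← real_inner_self_eq_norm_sq, inner_eq_integral,
      inner_eq_integral]
    have e : ∫ y, tensorₗ h hh f y * tensorₗ h hh f y ∂extMeasure =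
        ∫ y, (fun p => f p * f p) y.1 * (fun w => h w ^ 2) y.2 ∂extMeasure := by
      refine integral_congr_ae ?_
      filter_upwards [coeFn_tensorₗ h hh f] with y hy
      rw [hy]; ring
    rw [e, integral_prod_mul (fun p => f p * f p) (fun w => h w ^ 2), h1, mul_one]
  exact (sq_eq_sq₀ (norm_nonneg _) (norm_nonneg _)).1 this

/-- `f ↦ f ⊗ h` as an isometry, for `h` of norm one. -/
def tensor (h : ℝ → ℝ) (hh : MemLp h 2 gaussV) (h1 : ∫ w, h w ^ 2 ∂gaussV = 1) :
    L2 →ₗᵢ[ℝ] Lp ℝ 2 extMeasure where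
  toLinearMap := tensorₗ h hh
  norm_map' := norm_tensorₗ h hh h1

/-- `f ↦ f ⊗ 1`. -/
def tensorOne : L2 →ₗᵢ[ℝ] Lp ℝ 2 extMeasure :=
  tensor (fun _ => 1) (memLp_const 1) (by simp)

/-- `f ↦ f ⊗ w`, with `w` the first Hermite function. -/
def tensorId : L2 →ₗᵢ[ℝ] Lp ℝ 2 extMeasure :=
  tensor (fun w => w) memLp_id_gaussV integral_sq_gaussV

/-- For a measure-preserving `R` of `(Torus × ℝ) × ℝ` and an isometry `J = · ⊗ h`, the operator
`f ↦ ∫ h(w) f(R(·, w)) dν(w)`, with `R(p, w)` projected to phase space. It is defined by duality,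
as `J^* (f ⊗ 1 ∘ R)`. -/
def avg (R : (Torus × ℝ) × ℝ → (Torus × ℝ) × ℝ) (hR : MeasurePreserving R extMeasure extMeasure)
    (J : L2 →ₗᵢ[ℝ] Lp ℝ 2 extMeasure) : L2 →L[ℝ] L2 :=
  (ContinuousLinearMap.adjoint J.toContinuousLinearMap).comp
    ((Lp.compMeasurePreservingₗᵢ ℝ R hR).toContinuousLinearMap.comp tensorOne.toContinuousLinearMap)

section avg

variable {R : (Torus × ℝ) × ℝ → (Torus × ℝ) × ℝ} (hR : MeasurePreserving R extMeasure extMeasure)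

lemma inner_avg (J : L2 →ₗᵢ[ℝ] Lp ℝ 2 extMeasure) (f g : L2) :
    inner ℝ (avg R hR J f) g =
      inner ℝ (Lp.compMeasurePreservingₗᵢ ℝ R hR (tensorOne f)) (J g) := by
  simp only [avg, ContinuousLinearMap.comp_apply, ContinuousLinearMap.adjoint_inner_left]
  rfl

lemma norm_avg_le (J : L2 →ₗᵢ[ℝ] Lp ℝ 2 extMeasure) : ‖avg R hR J‖ ≤ 1 := by
  unfold avg
  refine (ContinuousLinearMap.opNorm_comp_le _ _).trans ?_
  rw [LinearIsometryEquiv.norm_map]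
  refine mul_le_one₀ J.norm_toContinuousLinearMap_le (norm_nonneg _) ?_
  refine (ContinuousLinearMap.opNorm_comp_le _ _).trans ?_
  exact mul_le_one₀ (LinearIsometry.norm_toContinuousLinearMap_le _) (norm_nonneg _)
    (LinearIsometry.norm_toContinuousLinearMap_le _)

lemma avg_symm (hRR : ∀ y, R (R y) = y) (f g : L2) :
    inner ℝ (avg R hR tensorOne f) g = inner ℝ f (avg R hR tensorOne g) := by
  have hinv : ∀ u : Lp ℝ 2 extMeasure,
      Lp.compMeasurePreservingₗᵢ ℝ R hR (Lp.compMeasurePreservingₗᵢ ℝ R hR u) = u := by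
    intro u
    refine Lp.ext ?_
    have h1 := Lp.coeFn_compMeasurePreserving (Lp.compMeasurePreserving R hR u) hR
    have h2 := hR.quasiMeasurePreserving.ae_eq_comp (Lp.coeFn_compMeasurePreserving u hR)
    refine h1.trans (h2.trans (ae_of_all _ fun y => ?_))
    simp [Function.comp, hRR]
  rw [inner_avg, real_inner_comm (avg R hR tensorOne g), inner_avg]
  rw [← LinearIsometry.inner_map_map (Lp.compMeasurePreservingₗᵢ ℝ R hR), hinv]
  exact real_inner_comm _ _

lemma inner_avg_chL {h : ℝ → ℝ} (hh : MemLp h 2 gaussV) (h1 : ∫ w, h w ^ 2 ∂gaussV = 1)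
    (k : ℤ) (η θ : ℝ) (g : L2) :
    inner ℝ (avg R hR (tensor h hh h1) (chL k η θ)) g =
      ∫ p, g p * ∫ w, h w * ch k η θ (R (p, w)).1 ∂gaussV ∂phaseMeasure := by
  rw [inner_avg, inner_eq_integral]
  have e : ∀ᵐ y ∂extMeasure, Lp.compMeasurePreservingₗᵢ ℝ R hR (tensorOne (chL k η θ)) y *
      tensor h hh h1 g y = (g y.1 * h y.2) * ch k η θ (R y).1 := by
    have a1 := Lp.coeFn_compMeasurePreserving (tensorOne (chL k η θ)) hR
    have a2 := hR.quasiMeasurePreserving.ae_eq_comp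
      (coeFn_tensorₗ (fun _ => 1) (memLp_const 1) (chL k η θ))
    have a3 := hR.quasiMeasurePreserving.ae_eq_comp
      (Measure.quasiMeasurePreserving_fst.ae_eq_comp (coeFn_chL k η θ))
    filter_upwards [a1, a2, a3, coeFn_tensorₗ h hh g] with y b1 b2 b3 b4
    have c1 : Lp.compMeasurePreservingₗᵢ ℝ R hR (tensorOne (chL k η θ)) y =
      tensorOne (chL k η θ) (R y) := b1
    have c2 : tensorOne (chL k η θ) (R y) = chL k η θ (R y).1 * 1 := b2
    have c3 : chL k η θ (R y).1 = ch k η θ (R y).1 := b3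
    have c4 : tensor h hh h1 g y = g y.1 * h y.2 := b4
    rw [c1, c2, c3, c4, mul_one, mul_comm]
  rw [integral_congr_ae e]
  have hi : Integrable (fun y : (Torus × ℝ) × ℝ => (g y.1 * h y.2) * ch k η θ (R y).1)
      extMeasure := by
    have := (memLp_tensor (Lp.memLp g) hh).integrable (by norm_num : (1 : ℝ≥0∞) ≤ 2)
    refine this.mul_bdd (c := 1) ?_ (ae_of_all _ fun y => abs_ch_le _ _ _ _)
    exact ((continuous_ch k η θ).measurable.comp
      (measurable_fst.comp hR.measurable)).aestronglyMeasurable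
  rw [integral_prod _ hi]
  refine integral_congr_ae (ae_of_all _ fun p => ?_)
  simp only [mul_assoc]
  rw [integral_const_mul]

lemma avg_chL {h : ℝ → ℝ} (hh : MemLp h 2 gaussV) (h1 : ∫ w, h w ^ 2 ∂gaussV = 1)
    {k : ℤ} {η θ η' θ' c : ℝ}
    (hc : ∀ p, ∫ w, h w * ch k η θ (R (p, w)).1 ∂gaussV = c * ch k η' θ' p) :
    avg R hR (tensor h hh h1) (chL k η θ) = c • chL k η' θ' := by
  refine ext_inner_right ℝ fun g => ?_
  rw [inner_avg_chL, inner_smul_left, real_inner_comm, inner_chL, RCLike.conj_to_real,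
    ← integral_const_mul]
  refine integral_congr_ae (ae_of_all _ fun p => ?_)
  simp only [hc]
  ring

lemma avg_one_chL {k : ℤ} {η θ η' b : ℝ}
    (hc : ∀ p w, ch k η θ (R (p, w)).1 = ch k η' (θ + b * w) p) :
    avg R hR tensorOne (chL k η θ) = Real.exp (-b ^ 2 / 2) • chL k η' θ :=
  avg_chL hR _ _ fun p => by simp only [one_mul, hc, integral_ch_phase]

lemma avg_id_chL {k : ℤ} {η θ η' b : ℝ}
    (hc : ∀ p w, ch k η θ (R (p, w)).1 = ch k η' (θ + b * w) p) :
    avg R hR tensorId (chL k η θ) =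
      (b * Real.exp (-b ^ 2 / 2)) • chL k η' (θ + Real.pi / 2) :=
  avg_chL hR _ _ fun p => by simp only [hc, integral_mul_ch_phase]

end avg

/-! ### The Ornstein–Uhlenbeck flow, the heat flow and the shear -/

/-- The decay factor `e^{-t}` of the velocity mean of the Ornstein–Uhlenbeck process. -/
def dec (t : ℝ≥0) : ℝ := Real.exp (-t)

/-- The standard deviation `√(1 - e^{-2t})` of the Ornstein–Uhlenbeck process at time `t`. -/
def spr (t : ℝ≥0) : ℝ := Real.sqrt (1 - dec t ^ 2)

lemma dec_pos (t : ℝ≥0) : 0 < dec t := Real.exp_pos _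

lemma dec_le_one (t : ℝ≥0) : dec t ≤ 1 := Real.exp_le_one_iff.2 (by simp)

lemma dec_zero : dec 0 = 1 := by simp [dec]

lemma dec_add (s t : ℝ≥0) : dec (s + t) = dec s * dec t := by
  simp [dec, ← Real.exp_add, add_comm]

lemma spr_sq (t : ℝ≥0) : spr t ^ 2 = 1 - dec t ^ 2 :=
  Real.sq_sqrt (by nlinarith [dec_pos t, dec_le_one t])

/-- The Gaussian measure on the plane is invariant under reflections. -/
lemma gaussV_reflection (t : ℝ≥0) :
    MeasurePreserving (fun z : ℝ × ℝ => (dec t * z.1 + spr t * z.2, spr t * z.1 - dec t * z.2))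
      (gaussV.prod gaussV) (gaussV.prod gaussV) := by
  have hsin : Real.sin (Real.arcsin (spr t)) = spr t := by
    refine Real.sin_arcsin ?_ ?_
    · linarith [Real.sqrt_nonneg (1 - dec t ^ 2), show spr t = Real.sqrt (1 - dec t ^ 2) from rfl]
    · rw [spr]
      exact Real.sqrt_le_one.2 (by nlinarith [dec_pos t])
  have hcos : Real.cos (Real.arcsin (spr t)) = dec t := by
    rw [Real.cos_arcsin, spr_sq, sub_sub_cancel, Real.sqrt_sq (dec_pos t).le]
  have h1 : MeasurePreserving (ContinuousLinearMap.rotation (E := ℝ) (Real.arcsin (spr t)))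
      (gaussV.prod gaussV) (gaussV.prod gaussV) :=
    ⟨(ContinuousLinearMap.continuous _).measurable,
      IsGaussian.map_rotation_eq_self (by simp) _⟩
  have h2 : MeasurePreserving (fun w : ℝ => -w) gaussV gaussV :=
    ⟨measurable_neg, by simp [gaussV, gaussianReal_map_neg]⟩
  have h3 := ((MeasurePreserving.id gaussV).prod h2).comp h1
  convert h3 using 1
  ext z
  · simp [ContinuousLinearMap.rotation_apply, hsin, hcos]
  · simp [ContinuousLinearMap.rotation_apply, hsin, hcos]
    ring

/-- The reflection in the plane of velocity and auxiliary Gaussian variable whose average is the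
Ornstein–Uhlenbeck semigroup. -/
def ouRefl (t : ℝ≥0) (y : (Torus × ℝ) × ℝ) : (Torus × ℝ) × ℝ :=
  ((y.1.1, dec t * y.1.2 + spr t * y.2), spr t * y.1.2 - dec t * y.2)

lemma ouRefl_measurePreserving (t : ℝ≥0) : MeasurePreserving (ouRefl t) extMeasure extMeasure := by
  have h1 := measurePreserving_prodAssoc (volume : Measure Torus) gaussV gaussV
  have h2 := (MeasurePreserving.id (volume : Measure Torus)).prod (gaussV_reflection t)
  exact (h1.symm _).comp (h2.comp h1)

lemma ouRefl_invol (t : ℝ≥0) (y : (Torus × ℝ) × ℝ) : ouRefl t (ouRefl t y) = y := by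
  have h := spr_sq t
  obtain ⟨⟨x, v⟩, w⟩ := y
  simp only [ouRefl, Prod.mk.injEq, true_and]
  constructor
  · linear_combination v * h
  · linear_combination w * h

/-- Translation in `x` by a multiple of the auxiliary Gaussian variable, combined with the
reflection of that variable. -/
def heatRefl (c : ℝ) (y : (Torus × ℝ) × ℝ) : (Torus × ℝ) × ℝ :=
  ((y.1.1 + ((c * y.2 : ℝ) : Torus), y.1.2), -y.2)

lemma measurable_torus_coe : Measurable (fun y : ℝ => (y : Torus)) :=
  (AddCircle.continuous_mk' 1).measurable

lemma heatRefl_measurePreserving (c : ℝ) :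
    MeasurePreserving (heatRefl c) extMeasure extMeasure := by
  have h2 : MeasurePreserving (fun w : ℝ => -w) gaussV gaussV :=
    ⟨measurable_neg, by simp [gaussV, gaussianReal_map_neg]⟩
  have hm : Measurable (Function.uncurry fun (w : ℝ) (p : Torus × ℝ) =>
      (p.1 + ((c * w : ℝ) : Torus), p.2)) := by
    refine Measurable.prodMk ?_ (by fun_prop)
    exact (measurable_fst.comp measurable_snd).add
      (measurable_torus_coe.comp (measurable_fst.const_mul c))
  have h3 := h2.skew_product (μc := phaseMeasure) (μd := phaseMeasure) hm (ae_of_all _ fun w =>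
    ((measurePreserving_add_right (volume : Measure Torus) ((c * w : ℝ) : Torus)).prod
      (MeasurePreserving.id gaussV)).map_eq)
  exact (Measure.measurePreserving_swap.comp h3).comp Measure.measurePreserving_swap

lemma heatRefl_invol (c : ℝ) (y : (Torus × ℝ) × ℝ) : heatRefl c (heatRefl c y) = y := by
  obtain ⟨⟨x, v⟩, w⟩ := y
  simp [heatRefl, add_assoc]

lemma shear_measurePreserving (σ : ℝ) :
    MeasurePreserving (fun p : Torus × ℝ => (p.1 - ((σ * p.2 : ℝ) : Torus), p.2))
      phaseMeasure phaseMeasure := by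
  have hm : Measurable (Function.uncurry fun (v : ℝ) (x : Torus) =>
      x - ((σ * v : ℝ) : Torus)) :=
    measurable_snd.sub (measurable_torus_coe.comp (measurable_fst.const_mul σ))
  have h3 := (MeasurePreserving.id gaussV).skew_product (μc := (volume : Measure Torus))
    (μd := (volume : Measure Torus)) hm (ae_of_all _ fun v =>
    (measurePreserving_sub_right (volume : Measure Torus) ((σ * v : ℝ) : Torus)).map_eq)
  exact (Measure.measurePreserving_swap.comp h3).comp Measure.measurePreserving_swap

/-- The Ornstein–Uhlenbeck semigroup in `v`. -/
def ou (t : ℝ≥0) : L2 →L[ℝ] L2 := avg (ouRefl t) (ouRefl_measurePreserving t) tensorOne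

/-- `(√(1 - e^{-2t}) / e^{-t}) ∂_v` composed with the Ornstein–Uhlenbeck semigroup. -/
def ouD (t : ℝ≥0) : L2 →L[ℝ] L2 := avg (ouRefl t) (ouRefl_measurePreserving t) tensorId

/-- The heat semigroup in `x`, `e^{(c²/2) ∂_x²}`. -/
def heat (c : ℝ) : L2 →L[ℝ] L2 := avg (heatRefl c) (heatRefl_measurePreserving c) tensorOne

/-- `c ∂_x` composed with the heat semigroup `heat c`. -/
def heatD (c : ℝ) : L2 →L[ℝ] L2 := avg (heatRefl c) (heatRefl_measurePreserving c) tensorId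

/-- The shear `f(x, v) ↦ f(x - σv, v)`. -/
def shear (σ : ℝ) : L2 →ₗᵢ[ℝ] L2 := Lp.compMeasurePreservingₗᵢ ℝ _ (shear_measurePreserving σ)

lemma ch_ouRefl (t : ℝ≥0) (k : ℤ) (η θ : ℝ) (p : Torus × ℝ) (w : ℝ) :
    ch k η θ (ouRefl t (p, w)).1 = ch k (dec t * η) (θ + (spr t * η) * w) p := by
  obtain ⟨x, v⟩ := p
  obtain ⟨y, rfl⟩ := exists_coe x
  simp only [ouRefl, ch_coe]
  congr 1; ring

lemma ch_heatRefl (c : ℝ) (k : ℤ) (η θ : ℝ) (p : Torus × ℝ) (w : ℝ) :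
    ch k η θ (heatRefl c (p, w)).1 = ch k η (θ + (c * freq k) * w) p := by
  obtain ⟨x, v⟩ := p
  obtain ⟨y, rfl⟩ := exists_coe x
  simp only [heatRefl, ← AddCircle.coe_add, ch_coe]
  congr 1; ring

lemma ou_chL (t : ℝ≥0) (k : ℤ) (η θ : ℝ) :
    ou t (chL k η θ) = Real.exp (-(spr t * η) ^ 2 / 2) • chL k (dec t * η) θ :=
  avg_one_chL _ (ch_ouRefl t k η θ)

lemma ouD_chL (t : ℝ≥0) (k : ℤ) (η θ : ℝ) :
    ouD t (chL k η θ) = (spr t * η * Real.exp (-(spr t * η) ^ 2 / 2)) •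
      chL k (dec t * η) (θ + Real.pi / 2) :=
  avg_id_chL _ (ch_ouRefl t k η θ)

lemma heat_chL (c : ℝ) (k : ℤ) (η θ : ℝ) :
    heat c (chL k η θ) = Real.exp (-(c * freq k) ^ 2 / 2) • chL k η θ :=
  avg_one_chL _ (ch_heatRefl c k η θ)

lemma heatD_chL (c : ℝ) (k : ℤ) (η θ : ℝ) :
    heatD c (chL k η θ) = (c * freq k * Real.exp (-(c * freq k) ^ 2 / 2)) •
      chL k η (θ + Real.pi / 2) :=
  avg_id_chL _ (ch_heatRefl c k η θ)

lemma shear_chL (σ : ℝ) (k : ℤ) (η θ : ℝ) :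
    shear σ (chL k η θ) = chL k (η - σ * freq k) θ := by
  refine Lp.ext ?_
  have h1 := Lp.coeFn_compMeasurePreserving (chL k η θ) (shear_measurePreserving σ)
  have h2 := (shear_measurePreserving σ).quasiMeasurePreserving.ae_eq_comp (coeFn_chL k η θ)
  refine h1.trans (h2.trans ?_)
  refine EventuallyEq.trans (ae_of_all _ fun p => ?_) (coeFn_chL _ _ _).symm
  obtain ⟨x, v⟩ := p
  obtain ⟨y, rfl⟩ := exists_coe x
  simp only [Function.comp, ← AddCircle.coe_sub, ch_coe]
  congr 1; ring

lemma inner_ou_left (t : ℝ≥0) (f g : L2) : inner ℝ (ou t f) g = inner ℝ f (ou t g) :=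
  avg_symm _ (ouRefl_invol t) f g

lemma inner_heat_left (c : ℝ) (f g : L2) : inner ℝ (heat c f) g = inner ℝ f (heat c g) :=
  avg_symm _ (heatRefl_invol c) f g

lemma shear_shear_neg (σ : ℝ) (f : L2) : shear σ (shear (-σ) f) = f := by
  have : (shear σ).toContinuousLinearMap.comp (shear (-σ)).toContinuousLinearMap =
      ContinuousLinearMap.id ℝ L2 := by
    refine clm_ext_chL fun k η θ => ?_
    simp [shear_chL]
  exact DFunLike.congr_fun this f

lemma inner_shear_left (σ : ℝ) (f g : L2) :
    inner ℝ (shear σ f) g = inner ℝ f (shear (-σ) g) := by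
  conv_lhs => rw [← shear_shear_neg σ g]
  exact LinearIsometry.inner_map_map _ _ _

lemma ou_heat (t : ℝ≥0) (c : ℝ) (f : L2) : ou t (heat c f) = heat c (ou t f) := by
  have : (ou t).comp (heat c) = (heat c).comp (ou t) := by
    refine clm_ext_chL fun k η θ => ?_
    simp [heat_chL, ou_chL, smul_smul, mul_comm]
  exact DFunLike.congr_fun this f

lemma norm_ou_le (t : ℝ≥0) : ‖ou t‖ ≤ 1 := norm_avg_le _ _
lemma norm_ouD_le (t : ℝ≥0) : ‖ouD t‖ ≤ 1 := norm_avg_le _ _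
lemma norm_heat_le (c : ℝ) : ‖heat c‖ ≤ 1 := norm_avg_le _ _
lemma norm_heatD_le (c : ℝ) : ‖heatD c‖ ≤ 1 := norm_avg_le _ _

lemma norm_apply_le_of_norm_le_one {A : L2 →L[ℝ] L2} (h : ‖A‖ ≤ 1) (f : L2) : ‖A f‖ ≤ ‖f‖ :=
  (A.le_of_opNorm_le h f).trans (by rw [one_mul])

/-- The shear parameter `tanh (t / 2)`. -/
def tanhHalf (t : ℝ≥0) : ℝ := (1 - dec t) / (1 + dec t)

/-- The heat time `t - 2 tanh (t / 2)`. -/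
def heatTime (t : ℝ≥0) : ℝ := t - 2 * tanhHalf t

lemma tanhHalf_nonneg (t : ℝ≥0) : 0 ≤ tanhHalf t :=
  div_nonneg (by linarith [dec_le_one t]) (by linarith [dec_pos t])

lemma tanhHalf_le_one (t : ℝ≥0) : tanhHalf t ≤ 1 := by
  rw [tanhHalf, div_le_one (by linarith [dec_pos t])]
  linarith [dec_pos t]

/-- The derivative of the heat time is `tanh² (t / 2)`. -/
lemma hasDerivAt_heatTime (t : ℝ) :
    HasDerivAt (fun t : ℝ => t - 2 * ((1 - Real.exp (-t)) / (1 + Real.exp (-t))))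
      (((1 - Real.exp (-t)) / (1 + Real.exp (-t))) ^ 2) t := by
  have he : HasDerivAt (fun t : ℝ => Real.exp (-t)) (-Real.exp (-t)) t := by
    simpa using (hasDerivAt_neg t).exp
  have hp : 1 + Real.exp (-t) ≠ 0 := by positivity
  have h := (hasDerivAt_id t).sub ((((he.const_sub 1).div (he.const_add 1) hp)).const_mul 2)
  convert! h using 1
  field_simp
  ring

lemma heatTime_nonneg (t : ℝ≥0) : 0 ≤ heatTime t := by
  have hm : Monotone (fun t : ℝ => t - 2 * ((1 - Real.exp (-t)) / (1 + Real.exp (-t)))) :=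
    monotone_of_hasDerivAt_nonneg (fun t => hasDerivAt_heatTime t) (fun t => sq_nonneg _)
  have := hm t.2
  simpa [heatTime, tanhHalf, dec] using this

lemma tanhHalf_le_half (t : ℝ≥0) : tanhHalf t ≤ t / 2 := by
  have := heatTime_nonneg t
  unfold heatTime at this
  linarith

lemma sub_two_le_heatTime (t : ℝ≥0) : t - 2 ≤ heatTime t := by
  have := tanhHalf_le_one t
  unfold heatTime
  linarith

/-- The heat time vanishes only to third order at `t = 0`. -/
lemma cube_le_heatTime {t : ℝ≥0} (ht : t ≤ 1) : (t : ℝ) ^ 3 / 48 ≤ heatTime t := by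
  have hm : MonotoneOn (fun t : ℝ => t - 2 * ((1 - Real.exp (-t)) / (1 + Real.exp (-t)))
      - t ^ 3 / 48) (Set.Icc 0 1) := by
    have hd : ∀ t : ℝ, HasDerivAt (fun t : ℝ => t - 2 * ((1 - Real.exp (-t)) / (1 + Real.exp (-t)))
      - t ^ 3 / 48) (((1 - Real.exp (-t)) / (1 + Real.exp (-t))) ^ 2 - t ^ 2 / 16) t := by
      intro t
      convert! (hasDerivAt_heatTime t).sub ((hasDerivAt_pow 3 t).div_const 48) using 1
      ring
    refine monotoneOn_of_hasDerivWithinAt_nonneg (convex_Icc 0 1)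
      (fun t _ => (hd t).continuousAt.continuousWithinAt) (fun t _ => (hd t).hasDerivWithinAt) ?_
    intro t ht
    rw [interior_Icc] at ht
    have h1 : Real.exp (-t) ≤ 1 - t / 2 := by
      have : Real.exp (-t) * (1 + t) ≤ 1 := by
        rw [Real.exp_neg, inv_mul_le_one₀ (Real.exp_pos _)]
        linarith [Real.add_one_le_exp t]
      nlinarith [ht.1, ht.2, Real.exp_pos (-t)]
    have h2 : t / 4 ≤ (1 - Real.exp (-t)) / (1 + Real.exp (-t)) := by
      rw [le_div_iff₀ (by positivity)]
      nlinarith [ht.1, ht.2, Real.exp_pos (-t)]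
    have h3 : 0 ≤ t / 4 := by linarith [ht.1]
    nlinarith
  have := hm (Set.left_mem_Icc.2 zero_le_one)
    (⟨t.2, by exact_mod_cast ht⟩ : (t : ℝ) ∈ Set.Icc 0 1) t.2
  simp only [neg_zero, Real.exp_zero] at this
  simp only [heatTime, tanhHalf, dec]
  norm_num at this
  linarith

/-! ### The Fokker–Planck semigroup -/

instance : IsProbabilityMeasure (volume : Measure Torus) := ⟨UnitAddCircle.measure_univ⟩

lemma freq_zero : freq 0 = 0 := by simp [freq]

lemma one_le_freq_sq {k : ℤ} (hk : k ≠ 0) : 1 ≤ freq k ^ 2 := by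
  have h1 : (1 : ℝ) ≤ (k : ℝ) ^ 2 := by exact_mod_cast Int.one_le_abs hk |>.trans (by
    rw [← sq_abs]; nlinarith [Int.one_le_abs hk])
  have h2 := Real.pi_gt_three
  have h3 : 1 ≤ (2 * Real.pi) ^ 2 := by nlinarith
  rw [freq, mul_pow]
  exact one_le_mul_of_one_le_of_one_le h3 h1

/-- The velocity frequency of the image of a character under `e^{-tP}`; here and below `ε = 1`
corresponds to `P` and `ε = -1` to its adjoint. -/
def move (ε : ℝ) (t : ℝ≥0) (ξ η : ℝ) : ℝ := dec t * η - (1 - dec t) * ε * ξ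

/-- The damping exponent of a character under `e^{-tP}`. -/
def damp (ε : ℝ) (t : ℝ≥0) (ξ η : ℝ) : ℝ :=
  η ^ 2 * (1 - dec t ^ 2) / 2 - ε * η * ξ * (1 - dec t) ^ 2
    + ξ ^ 2 * (t - (1 - dec t) * (3 - dec t) / 2)

/-- The semigroup generated by `-(ε v ∂_x + (-∂_v + v) ∂_v)`, `ε = ±1`, as the composition of a
shear, the heat flow in `x`, the Ornstein–Uhlenbeck flow in `v` and the same shear. -/
def semi (ε : ℝ) (t : ℝ≥0) : L2 →L[ℝ] L2 :=
  (shear (ε * tanhHalf t)).toContinuousLinearMap.comp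
    ((heat (Real.sqrt (2 * heatTime t))).comp
      ((ou t).comp (shear (ε * tanhHalf t)).toContinuousLinearMap))

lemma semi_apply (ε : ℝ) (t : ℝ≥0) (f : L2) :
    semi ε t f = shear (ε * tanhHalf t) (heat (Real.sqrt (2 * heatTime t))
      (ou t (shear (ε * tanhHalf t) f))) := rfl

lemma sq_sqrt_heatTime (t : ℝ≥0) : Real.sqrt (2 * heatTime t) ^ 2 = 2 * heatTime t :=
  Real.sq_sqrt (by linarith [heatTime_nonneg t])

lemma tanhHalf_mul (t : ℝ≥0) : tanhHalf t * (1 + dec t) = 1 - dec t :=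
  div_mul_cancel₀ _ (by linarith [dec_pos t])

lemma move_eq (ε : ℝ) (t : ℝ≥0) (ξ η : ℝ) :
    dec t * (η - ε * tanhHalf t * ξ) - ε * tanhHalf t * ξ = move ε t ξ η := by
  unfold move
  linear_combination (-ε * ξ) * tanhHalf_mul t

lemma damp_eq {ε : ℝ} (hε : ε ^ 2 = 1) (t : ℝ≥0) (ξ η : ℝ) :
    -(spr t * (η - ε * tanhHalf t * ξ)) ^ 2 / 2
      + -(Real.sqrt (2 * heatTime t) * ξ) ^ 2 / 2 = -damp ε t ξ η := by
  rw [mul_pow, mul_pow, spr_sq, sq_sqrt_heatTime]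
  unfold damp heatTime
  have h := tanhHalf_mul t
  have hp : 1 + dec t ≠ 0 := by linarith [dec_pos t]
  have e : tanhHalf t = (1 - dec t) / (1 + dec t) := rfl
  rw [e]
  have e2 : (η - ε * ((1 - dec t) / (1 + dec t)) * ξ) ^ 2 =
      η ^ 2 - 2 * ε * η * ξ * ((1 - dec t) / (1 + dec t)) +
        ((1 - dec t) / (1 + dec t)) ^ 2 * ξ ^ 2 := by
    linear_combination ((1 - dec t) / (1 + dec t)) ^ 2 * ξ ^ 2 * hε
  rw [e2]
  field_simp
  ring

lemma semi_chL {ε : ℝ} (hε : ε ^ 2 = 1) (t : ℝ≥0) (k : ℤ) (η θ : ℝ) :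
    semi ε t (chL k η θ) =
      Real.exp (-damp ε t (freq k) η) • chL k (move ε t (freq k) η) θ := by
  rw [semi_apply, shear_chL, ou_chL, map_smul, heat_chL, map_smul, map_smul, shear_chL, smul_smul,
    ← Real.exp_add, damp_eq hε, move_eq]

lemma norm_semi_le (ε : ℝ) (t : ℝ≥0) (f : L2) : ‖semi ε t f‖ ≤ ‖f‖ := by
  rw [semi_apply, LinearIsometry.norm_map]
  refine (norm_apply_le_of_norm_le_one (norm_heat_le _) _).trans ?_
  refine (norm_apply_le_of_norm_le_one (norm_ou_le _) _).trans ?_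
  rw [LinearIsometry.norm_map]

/-- Reversing the sign of the transport term gives the adjoint semigroup. -/
lemma inner_semi_left (ε : ℝ) (t : ℝ≥0) (f g : L2) :
    inner ℝ (semi ε t f) g = inner ℝ f (semi (-ε) t g) := by
  rw [semi_apply, semi_apply, inner_shear_left, inner_heat_left, inner_ou_left, inner_shear_left,
    ou_heat, neg_mul]

lemma move_add (ε : ℝ) (s t : ℝ≥0) (ξ η : ℝ) :
    move ε (s + t) ξ η = move ε s ξ (move ε t ξ η) := by
  unfold move
  rw [dec_add]
  ring

/-- The cocycle identity behind the semigroup law. -/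
lemma damp_add {ε : ℝ} (hε : ε ^ 2 = 1) (s t : ℝ≥0) (ξ η : ℝ) :
    damp ε (s + t) ξ η = damp ε t ξ η + damp ε s ξ (move ε t ξ η) := by
  unfold damp move
  rw [dec_add, NNReal.coe_add]
  generalize dec s = a
  generalize dec t = b
  rcases sq_eq_one_iff.1 hε with rfl | rfl <;> ring

lemma semi_add {ε : ℝ} (hε : ε ^ 2 = 1) (s t : ℝ≥0) :
    semi ε (s + t) = (semi ε s).comp (semi ε t) := by
  refine clm_ext_chL fun k η θ => ?_
  rw [ContinuousLinearMap.comp_apply, semi_chL hε, semi_chL hε, map_smul, semi_chL hε, smul_smul,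
    ← Real.exp_add, move_add, damp_add hε, neg_add]

lemma semi_zero {ε : ℝ} (hε : ε ^ 2 = 1) : semi ε 0 = ContinuousLinearMap.id ℝ L2 := by
  refine clm_ext_chL fun k η θ => ?_
  rw [semi_chL hε]
  simp [damp, move, dec_zero]

/-! ### Strong continuity -/

lemma memLp_snd : MemLp (fun p : Torus × ℝ => p.2) 2 phaseMeasure :=
  memLp_id_gaussV.comp_measurePreserving measurePreserving_snd

/-- The velocity coordinate as an element of `L²(dμ dν)`. -/
def sndL : L2 := memLp_snd.toLp _

lemma norm_sndL : ‖sndL‖ = 1 := by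
  have : ‖sndL‖ ^ 2 = 1 := by
    rw [← real_inner_self_eq_norm_sq, inner_eq_integral]
    have e : ∫ p, sndL p * sndL p ∂phaseMeasure =
        ∫ p : Torus × ℝ, (fun _ => (1 : ℝ)) p.1 * (fun w => w ^ 2) p.2 ∂phaseMeasure := by
      refine integral_congr_ae ?_
      filter_upwards [memLp_snd.coeFn_toLp] with p hp
      rw [sndL, hp]; ring
    rw [e, integral_prod_mul (fun _ => (1 : ℝ)) (fun w => w ^ 2), integral_sq_gaussV]
    simp
  exact (pow_eq_one_iff_of_nonneg (norm_nonneg _) two_ne_zero).1 this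

lemma norm_chL_sub_le (k : ℤ) (η η' θ : ℝ) : ‖chL k η θ - chL k η' θ‖ ≤ |η - η'| := by
  have := Lp.norm_le_mul_norm_of_ae_le_mul (c := |η - η'|) (f := chL k η θ - chL k η' θ)
    (g := sndL) ?_
  · rwa [norm_sndL, mul_one] at this
  filter_upwards [Lp.coeFn_sub (chL k η θ) (chL k η' θ), coeFn_chL k η θ, coeFn_chL k η' θ,
    memLp_snd.coeFn_toLp] with p h1 h2 h3 h4
  rw [h1, Pi.sub_apply, h2, h3, sndL, h4]
  obtain ⟨x, v⟩ := p
  obtain ⟨y, rfl⟩ := exists_coe x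
  rw [ch_coe, ch_coe, Real.norm_eq_abs, Real.norm_eq_abs, ← abs_mul]
  refine (Real.abs_cos_sub_cos_le _ _).trans (le_of_eq ?_)
  congr 1; ring

lemma continuous_chL (k : ℤ) (θ : ℝ) : Continuous fun η => chL k η θ := by
  refine (LipschitzWith.of_dist_le_mul (K := 1) fun η η' => ?_).continuous
  rw [dist_eq_norm, NNReal.coe_one, one_mul, Real.dist_eq]
  exact norm_chL_sub_le k η η' θ

lemma norm_chL_le (k : ℤ) (η θ : ℝ) : ‖chL k η θ‖ ≤ 1 := by
  have h : ‖chL k η θ‖ ≤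
      ‖(memLp_const (1 : ℝ) : MemLp (fun _ => (1 : ℝ)) 2 phaseMeasure).toLp _‖ := by
    refine Lp.norm_le_norm_of_ae_le ?_
    filter_upwards [coeFn_chL k η θ, (memLp_const (1 : ℝ) :
      MemLp (fun _ => (1 : ℝ)) 2 phaseMeasure).coeFn_toLp] with p h1 h2
    rw [h1, h2, norm_one]
    exact abs_ch_le _ _ _ _
  refine h.trans ?_
  rw [Lp.norm_toLp, eLpNorm_const _ (by norm_num) (NeZero.ne _)]
  simp

lemma continuous_dec : Continuous dec := by unfold dec; fun_prop

/-- Strong continuity of a uniformly bounded family follows from that on characters. -/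
lemma continuous_apply_of_chL {X : Type*} [TopologicalSpace X] {A : X → L2 →L[ℝ] L2}
    (hA : ∀ t f, ‖A t f‖ ≤ ‖f‖) (hc : ∀ k η θ, Continuous fun t => A t (chL k η θ)) (f : L2) :
    Continuous fun t => A t f := by
  have hspan : ∀ g ∈ trigSpan, Continuous fun t => A t g := by
    intro g hg
    refine Submodule.span_induction (p := fun g _ => Continuous fun t => A t g) ?_ ?_ ?_ ?_ hg
    · rintro _ ⟨i, rfl⟩; exact hc _ _ _
    · simpa using continuous_const
    · intro g₁ g₂ _ _ h₁ h₂; simp only [map_add]; exact h₁.add h₂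
    · intro c g _ h; simp only [map_smul]; exact h.const_smul c
  refine continuous_of_uniform_approx_of_continuous fun u hu => ?_
  obtain ⟨δ, hδ, hsub⟩ := Metric.mem_uniformity_dist.1 hu
  obtain ⟨g, hg, hfg⟩ := Metric.dense_iff.1 dense_trigSpan f δ hδ
  refine ⟨fun t => A t g, hspan g hfg, fun t => hsub ?_⟩
  rw [dist_eq_norm, ← map_sub]
  refine (hA t _).trans_lt ?_
  rw [← dist_eq_norm, dist_comm]
  exact hg

lemma continuous_semi {ε : ℝ} (hε : ε ^ 2 = 1) (f : L2) : Continuous fun t => semi ε t f := by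
  refine continuous_apply_of_chL (norm_semi_le ε) (fun k η θ => ?_) f
  simp_rw [semi_chL hε]
  have hd := continuous_dec
  have h1 : Continuous fun t => damp ε t (freq k) η := by unfold damp; fun_prop
  have h2 : Continuous fun t => move ε t (freq k) η := by unfold move; fun_prop
  exact (Real.continuous_exp.comp h1.neg).smul ((continuous_chL k θ).comp h2)

lemma isC0Semigroup_semi {ε : ℝ} (hε : ε ^ 2 = 1) : IsC0Semigroup (semi ε) :=
  ⟨semi_zero hε, semi_add hε, continuous_semi hε⟩

/-! ### Exponential decay on mean-zero functions -/

/-- The constant function `1`. -/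
abbrev oneL : L2 := chL 0 0 0

lemma inner_oneL (f : L2) : inner ℝ f oneL = ∫ p, f p ∂phaseMeasure := by
  rw [inner_chL]
  simp [ch_zero]

/-- The commuting product of the heat and the Ornstein–Uhlenbeck semigroups, which is a symmetric
semigroup on `L²(dμ dν)`. -/
def heatOU (t : ℝ≥0) : L2 →L[ℝ] L2 := (heat (Real.sqrt (2 * t))).comp (ou t)

lemma heatOU_chL (t : ℝ≥0) (k : ℤ) (η θ : ℝ) :
    heatOU t (chL k η θ) =
      Real.exp (-(1 - dec t ^ 2) * η ^ 2 / 2 - t * freq k ^ 2) • chL k (dec t * η) θ := by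
  rw [heatOU, ContinuousLinearMap.comp_apply, ou_chL, map_smul, heat_chL, smul_smul,
    ← Real.exp_add, mul_pow, mul_pow, spr_sq, Real.sq_sqrt (by positivity)]
  congr 2; ring

lemma heatOU_add (s t : ℝ≥0) : heatOU (s + t) = (heatOU s).comp (heatOU t) := by
  refine clm_ext_chL fun k η θ => ?_
  rw [ContinuousLinearMap.comp_apply, heatOU_chL, heatOU_chL, map_smul, heatOU_chL, smul_smul,
    ← Real.exp_add, dec_add, NNReal.coe_add]
  congr 2
  · ring
  · ring

lemma inner_heatOU_left (t : ℝ≥0) (f g : L2) :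
    inner ℝ (heatOU t f) g = inner ℝ f (heatOU t g) := by
  simp only [heatOU, ContinuousLinearMap.comp_apply]
  rw [inner_heat_left, inner_ou_left, ou_heat]

lemma heatOU_oneL (t : ℝ≥0) : heatOU t oneL = oneL := by
  rw [oneL, heatOU_chL]; simp [freq_zero]

/-- The projection onto functions of zero mean. -/
def meanFree : L2 →L[ℝ] L2 :=
  ContinuousLinearMap.id ℝ L2 - (innerSL ℝ oneL).smulRight oneL

lemma meanFree_apply (f : L2) : meanFree f = f - inner ℝ oneL f • oneL := rfl

lemma heatOU_meanFree (t : ℝ≥0) (f : L2) : heatOU t (meanFree f) = meanFree (heatOU t f) := by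
  rw [meanFree_apply, meanFree_apply, map_sub, map_smul, heatOU_oneL]
  congr 2
  rw [real_inner_comm, real_inner_comm (heatOU t f), inner_heatOU_left, heatOU_oneL]

lemma meanFree_chL_zero (θ : ℝ) : meanFree (chL 0 0 θ) = 0 := by
  have h : chL 0 0 θ = Real.cos θ • oneL := by
    refine Lp.ext ?_
    filter_upwards [coeFn_chL 0 0 θ, coeFn_chL 0 0 0, Lp.coeFn_smul (Real.cos θ) oneL]
      with p h1 h2 h3
    rw [h1, h3, Pi.smul_apply, h2, ch_zero, ch_zero]
    simp
  have h1 : inner ℝ oneL oneL = (1 : ℝ) := by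
    rw [inner_oneL, integral_congr_ae (coeFn_chL 0 0 0)]
    simp [ch_zero]
  rw [h, map_smul, meanFree_apply, h1, one_smul, sub_self, smul_zero]

lemma exists_norm_heatOU_meanFree_chL_le (k : ℤ) (η θ : ℝ) :
    ∃ C : ℝ, ∀ t : ℝ≥0, ‖heatOU t (meanFree (chL k η θ))‖ ≤ C * dec t := by
  refine ⟨‖meanFree‖ * (1 + |η|), fun t => ?_⟩
  rw [heatOU_meanFree, heatOU_chL, map_smul, norm_smul, Real.norm_eq_abs, Real.abs_exp]
  have hd := dec_pos t
  have hdl := dec_le_one t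
  have h0 : 0 ≤ (1 - dec t ^ 2) * η ^ 2 := mul_nonneg (by nlinarith) (sq_nonneg _)
  -- for `k = 0` the frequency in `v` tends to zero, towards a constant function;
  -- for `k ≠ 0` the heat flow damps the character
  by_cases hk : k = 0
  · subst hk
    have h1 : Real.exp (-(1 - dec t ^ 2) * η ^ 2 / 2 - t * freq 0 ^ 2) ≤ 1 := by
      rw [Real.exp_le_one_iff, freq_zero]; nlinarith
    have h2 : ‖meanFree (chL 0 (dec t * η) θ)‖ ≤ ‖meanFree‖ * (dec t * |η|) := by
      rw [← sub_zero (meanFree _), ← meanFree_chL_zero θ, ← map_sub]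
      refine meanFree.le_opNorm_of_le ((norm_chL_sub_le _ _ _ _).trans ?_)
      rw [sub_zero, abs_mul, abs_of_pos hd]
    calc _ ≤ 1 * (‖meanFree‖ * (dec t * |η|)) :=
          mul_le_mul h1 h2 (norm_nonneg _) zero_le_one
      _ ≤ _ := by nlinarith [norm_nonneg meanFree, abs_nonneg η,
        mul_nonneg (norm_nonneg meanFree) hd.le]
  · have h1 : Real.exp (-(1 - dec t ^ 2) * η ^ 2 / 2 - t * freq k ^ 2) ≤ dec t := by
      refine Real.exp_le_exp.2 ?_
      nlinarith [one_le_freq_sq hk, t.2]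
    have h2 : ‖meanFree (chL k (dec t * η) θ)‖ ≤ ‖meanFree‖ * 1 :=
      meanFree.le_opNorm_of_le (norm_chL_le _ _ _)
    calc _ ≤ dec t * (‖meanFree‖ * 1) := mul_le_mul h1 h2 (norm_nonneg _) hd.le
      _ ≤ _ := by nlinarith [norm_nonneg meanFree, abs_nonneg η,
        mul_nonneg (mul_nonneg (norm_nonneg meanFree) hd.le) (abs_nonneg η)]

lemma exists_norm_heatOU_meanFree_le {g : L2} (hg : g ∈ trigSpan) :
    ∃ C : ℝ, ∀ t : ℝ≥0, ‖heatOU t (meanFree g)‖ ≤ C * dec t := by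
  refine Submodule.span_induction
    (p := fun g _ => ∃ C : ℝ, ∀ t : ℝ≥0, ‖heatOU t (meanFree g)‖ ≤ C * dec t) ?_ ?_ ?_ ?_ hg
  · rintro _ ⟨i, rfl⟩; exact exists_norm_heatOU_meanFree_chL_le _ _ _
  · exact ⟨0, by simp⟩
  · rintro g₁ g₂ _ _ ⟨C₁, h₁⟩ ⟨C₂, h₂⟩
    refine ⟨C₁ + C₂, fun t => ?_⟩
    rw [map_add, map_add, add_mul]
    exact (norm_add_le _ _).trans (add_le_add (h₁ t) (h₂ t))
  · rintro c g _ ⟨C, h⟩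
    refine ⟨|c| * C, fun t => ?_⟩
    rw [map_smul, map_smul, norm_smul, mul_assoc]
    exact mul_le_mul_of_nonneg_left (h t) (abs_nonneg c)

/-- Log-convexity of `t ↦ ‖heatOU t u‖` along dyadic multiples. -/
lemma norm_heatOU_pow_le (t : ℝ≥0) (u : L2) (n : ℕ) :
    ‖heatOU t u‖ ^ 2 ^ n ≤ ‖u‖ ^ (2 ^ n - 1) * ‖heatOU (2 ^ n * t) u‖ := by
  induction n with
  | zero => simp
  | succ n ih =>
    have h1 : ‖heatOU (2 ^ n * t) u‖ ^ 2 ≤ ‖u‖ * ‖heatOU (2 ^ (n + 1) * t) u‖ := by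
      rw [← real_inner_self_eq_norm_sq, inner_heatOU_left, pow_succ, mul_two, add_mul, heatOU_add]
      exact real_inner_le_norm _ _
    have h2 : 2 ^ (n + 1) - 1 = (2 ^ n - 1) * 2 + 1 := by
      have := Nat.one_le_two_pow (n := n); omega
    calc ‖heatOU t u‖ ^ 2 ^ (n + 1) = (‖heatOU t u‖ ^ 2 ^ n) ^ 2 := by
          rw [← pow_mul, pow_succ]
      _ ≤ (‖u‖ ^ (2 ^ n - 1) * ‖heatOU (2 ^ n * t) u‖) ^ 2 := by gcongr
      _ = ‖u‖ ^ ((2 ^ n - 1) * 2) * ‖heatOU (2 ^ n * t) u‖ ^ 2 := by rw [mul_pow, pow_mul]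
      _ ≤ ‖u‖ ^ ((2 ^ n - 1) * 2) * (‖u‖ * ‖heatOU (2 ^ (n + 1) * t) u‖) := by gcongr
      _ = _ := by rw [h2, pow_succ]; ring

/-- Powers `a ^ 2 ^ n` bounded by a constant force `a ≤ 1`. -/
lemma le_one_of_pow_two_pow_le {a C : ℝ} (h : ∀ n : ℕ, a ^ 2 ^ n ≤ C) : a ≤ 1 := by
  by_contra! ha
  have h1 : Tendsto (fun n : ℕ => a ^ 2 ^ n) atTop atTop :=
    (tendsto_pow_atTop_atTop_of_one_lt ha).comp (tendsto_pow_atTop_atTop_of_one_lt one_lt_two)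
  obtain ⟨n, hn⟩ := (h1.eventually_gt_atTop C).exists
  exact absurd (h n) (not_le.2 hn)

lemma norm_heatOU_meanFree_le_of_mem {g : L2} (hg : g ∈ trigSpan) (t : ℝ≥0) :
    ‖heatOU t (meanFree g)‖ ≤ dec t * ‖meanFree g‖ := by
  obtain ⟨C, hC⟩ := exists_norm_heatOU_meanFree_le hg
  generalize meanFree g = u at *
  rcases eq_or_ne u 0 with rfl | hu
  · simp
  have hu' : 0 < ‖u‖ := norm_pos_iff.2 hu
  have hd := dec_pos t
  have key : ‖heatOU t u‖ / (dec t * ‖u‖) ≤ 1 := by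
    refine le_one_of_pow_two_pow_le (C := C / ‖u‖) fun n => ?_
    have h1 := norm_heatOU_pow_le t u n
    have h2 := hC (2 ^ n * t)
    have h3 : dec (2 ^ n * t) = dec t ^ 2 ^ n := by
      simp only [dec, ← Real.exp_nat_mul]
      push_cast; congr 1; ring
    rw [h3] at h2
    have h4 : ‖u‖ ^ 2 ^ n = ‖u‖ ^ (2 ^ n - 1) * ‖u‖ := by
      rw [← pow_succ, Nat.sub_add_cancel Nat.one_le_two_pow]
    rw [div_pow, mul_pow, div_le_div_iff₀ (by positivity) hu', h4]
    have h5 : 0 < ‖u‖ ^ (2 ^ n - 1) := by positivity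
    calc ‖heatOU t u‖ ^ 2 ^ n * ‖u‖ ≤ (‖u‖ ^ (2 ^ n - 1) * (C * dec t ^ 2 ^ n)) * ‖u‖ := by
          refine mul_le_mul_of_nonneg_right (h1.trans ?_) hu'.le
          exact mul_le_mul_of_nonneg_left h2 h5.le
      _ = _ := by ring
  rwa [div_le_one (by positivity)] at key

lemma norm_heatOU_meanFree_le (g : L2) (t : ℝ≥0) :
    ‖heatOU t (meanFree g)‖ ≤ dec t * ‖meanFree g‖ := by
  have hcl : IsClosed {g : L2 | ‖heatOU t (meanFree g)‖ ≤ dec t * ‖meanFree g‖} :=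
    isClosed_le (by fun_prop) (by fun_prop)
  exact hcl.closure_subset_iff.2 (fun g hg => norm_heatOU_meanFree_le_of_mem hg t)
    (dense_trigSpan g)

lemma norm_heatOU_le_of_mean_zero {g : L2} (hg : inner ℝ g oneL = 0) (t : ℝ≥0) :
    ‖heatOU t g‖ ≤ dec t * ‖g‖ := by
  have h : meanFree g = g := by rw [meanFree_apply, real_inner_comm, hg, zero_smul, sub_zero]
  have := norm_heatOU_meanFree_le g t
  rwa [h] at this

/-- Hypocoercive decay: for mean-zero data the semigroup decays at rate one. The heat time
`t - 2 tanh (t/2) ≥ t - 2` bounds the time during which both diffusions act. -/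
lemma norm_semi_le_of_mean_zero {ε : ℝ} {g : L2} (hg : inner ℝ g oneL = 0)
    (t : ℝ≥0) : ‖semi ε t g‖ ≤ Real.exp 2 * Real.exp (-t) * ‖g‖ := by
  set r : ℝ≥0 := ⟨heatTime t, heatTime_nonneg t⟩ with hr
  have hrt : r ≤ t := by
    rw [← NNReal.coe_le_coe]
    change heatTime t ≤ t
    have := tanhHalf_nonneg t
    unfold heatTime; linarith
  have hsplit : ∀ u : L2, heat (Real.sqrt (2 * heatTime t)) (ou t u) = heatOU r (ou (t - r) u) := by
    intro u
    have : (heat (Real.sqrt (2 * heatTime t))).comp (ou t) = (heatOU r).comp (ou (t - r)) := by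
      refine clm_ext_chL fun k η θ => ?_
      have hd : dec t = dec r * dec (t - r) := by rw [← dec_add, add_tsub_cancel_of_le hrt]
      simp only [ContinuousLinearMap.comp_apply, ou_chL, map_smul, heat_chL, heatOU_chL, smul_smul,
        ← Real.exp_add]
      rw [mul_pow, mul_pow, mul_pow, spr_sq, spr_sq, sq_sqrt_heatTime, hd]
      have : (r : ℝ) = heatTime t := rfl
      rw [this]
      congr 2
      · ring
      · ring
    exact DFunLike.congr_fun this u
  have hou : ∀ s, ou s oneL = oneL := fun s => by rw [oneL, ou_chL]; simp
  have hsh : ∀ s, shear s oneL = oneL := fun s => by rw [oneL, shear_chL]; simp [freq_zero]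
  rw [semi_apply, LinearIsometry.norm_map, hsplit]
  have hmean : inner ℝ (ou (t - r) (shear (ε * tanhHalf t) g)) oneL = 0 := by
    rw [inner_ou_left, hou, inner_shear_left, hsh, hg]
  refine (norm_heatOU_le_of_mean_zero hmean r).trans ?_
  have h1 : ‖ou (t - r) (shear (ε * tanhHalf t) g)‖ ≤ ‖g‖ :=
    (norm_apply_le_of_norm_le_one (norm_ou_le _) _).trans_eq (LinearIsometry.norm_map _ _)
  have h2 : dec r ≤ Real.exp 2 * Real.exp (-t) := by
    rw [← Real.exp_add]
    refine Real.exp_le_exp.2 ?_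
    have := sub_two_le_heatTime t
    have : (r : ℝ) = heatTime t := rfl
    linarith
  exact mul_le_mul h2 h1 (norm_nonneg _) (by positivity)

/-! ### The regularizing operators -/

/-- The operator `∂_v e^{-tP^*}`, `t > 0`, where `P^*` is the adjoint of `P`. As `∂_v` commutes with
the shear up to a multiple of `∂_x`, it is a combination of `∂_v` applied to the
Ornstein–Uhlenbeck factor and `∂_x` applied to the heat factor. At `t = 0` both quotients are
divisions by zero and the value is irrelevant. -/
def dvSemi (t : ℝ≥0) : L2 →L[ℝ] L2 :=
  (shear (-tanhHalf t)).toContinuousLinearMap.comp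
    (((dec t / spr t) • (ouD t).comp (heat (Real.sqrt (2 * heatTime t))) +
      (tanhHalf t / Real.sqrt (2 * heatTime t)) •
        (heatD (Real.sqrt (2 * heatTime t))).comp (ou t)).comp
      (shear (-tanhHalf t)).toContinuousLinearMap)

/-- The operator `e^{-tP} (-∂_v + v)`, `t > 0`, as the adjoint of `∂_v e^{-tP^*}`. -/
def semiDvStar (t : ℝ≥0) : L2 →L[ℝ] L2 := ContinuousLinearMap.adjoint (dvSemi t)

lemma inner_semiDvStar_left (t : ℝ≥0) (f g : L2) :
    inner ℝ (semiDvStar t f) g = inner ℝ f (dvSemi t g) :=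
  ContinuousLinearMap.adjoint_inner_left _ _ _

lemma spr_pos {t : ℝ≥0} (ht : 0 < t) : 0 < spr t := by
  refine Real.sqrt_pos.2 ?_
  have h : dec t < 1 := (by rw [dec, Real.exp_lt_one_iff]; simpa using ht)
  nlinarith [dec_pos t]

lemma heatTime_pos {t : ℝ≥0} (ht : 0 < t) : 0 < heatTime t := by
  rcases le_total t 1 with h | h
  · exact lt_of_lt_of_le (by positivity) (cube_le_heatTime h)
  · have hm : Monotone (fun t : ℝ => t - 2 * ((1 - Real.exp (-t)) / (1 + Real.exp (-t)))) :=
      monotone_of_hasDerivAt_nonneg (fun t => hasDerivAt_heatTime t) (fun t => sq_nonneg _)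
    have h1 := hm (show ((1 : ℝ≥0) : ℝ) ≤ t by exact_mod_cast h)
    have h2 : heatTime 1 ≤ heatTime t := h1
    have h3 := cube_le_heatTime le_rfl
    norm_num at h3
    linarith

lemma dvSemi_chL {t : ℝ≥0} (ht : 0 < t) (k : ℤ) (η θ : ℝ) :
    dvSemi t (chL k η θ) =
      (move (-1) t (freq k) η * Real.exp (-damp (-1) t (freq k) η)) •
        chL k (move (-1) t (freq k) η) (θ + Real.pi / 2) := by
  have hs := (spr_pos ht).ne'
  have hh : Real.sqrt (2 * heatTime t) ≠ 0 :=
    (Real.sqrt_pos.2 (by linarith [heatTime_pos ht])).ne'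
  have e1 := move_eq (-1) t (freq k) η
  have e2 := damp_eq (by norm_num : (-1 : ℝ) ^ 2 = 1) t (freq k) η
  simp only [neg_mul, one_mul] at e1 e2
  simp only [dvSemi, ContinuousLinearMap.comp_apply, add_apply,
    smul_apply, LinearIsometry.coe_toContinuousLinearMap, shear_chL, heat_chL,
    ou_chL, map_smul, ouD_chL, heatD_chL, map_add, smul_smul, neg_mul, e1]
  rw [← add_smul, ← e1, ← e2, Real.exp_add]
  congr 1
  field_simp
  ring

lemma norm_semiDvStar_le (t : ℝ≥0) :
    ‖semiDvStar t‖ ≤ dec t / spr t + tanhHalf t / Real.sqrt (2 * heatTime t) := by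
  have hs : 0 ≤ dec t / spr t := div_nonneg (dec_pos t).le (Real.sqrt_nonneg _)
  have hh : 0 ≤ tanhHalf t / Real.sqrt (2 * heatTime t) :=
    div_nonneg (tanhHalf_nonneg t) (Real.sqrt_nonneg _)
  rw [semiDvStar, LinearIsometryEquiv.norm_map]
  refine ContinuousLinearMap.opNorm_le_bound _ (add_nonneg hs hh) fun f => ?_
  simp only [dvSemi, ContinuousLinearMap.comp_apply, add_apply,
    smul_apply, LinearIsometry.coe_toContinuousLinearMap,
    LinearIsometry.norm_map]
  set u := shear (-tanhHalf t) f with hu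
  have hun : ‖u‖ = ‖f‖ := LinearIsometry.norm_map _ _
  refine (norm_add_le _ _).trans ?_
  rw [add_mul, norm_smul, norm_smul, Real.norm_of_nonneg hs, Real.norm_of_nonneg hh, ← hun]
  refine add_le_add (mul_le_mul_of_nonneg_left ?_ hs) (mul_le_mul_of_nonneg_left ?_ hh)
  · exact (norm_apply_le_of_norm_le_one (norm_ouD_le _) _).trans
      (norm_apply_le_of_norm_le_one (norm_heat_le _) _)
  · exact (norm_apply_le_of_norm_le_one (norm_heatD_le _) _).trans
      (norm_apply_le_of_norm_le_one (norm_ou_le _) _)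

lemma norm_semiDvStar_le_of_le_one {t : ℝ≥0} (ht : 0 < t) (ht1 : t ≤ 1) :
    ‖semiDvStar t‖ ≤ 4 * (Real.sqrt t)⁻¹ := by
  refine (norm_semiDvStar_le t).trans ?_
  have ht' : (0 : ℝ) < t := by exact_mod_cast ht
  have hsq := Real.sqrt_pos.2 ht'
  have h1 : dec t / spr t ≤ (Real.sqrt t)⁻¹ := by
    rw [div_le_iff₀ (spr_pos ht), inv_mul_eq_div, le_div_iff₀ hsq]
    refine le_of_sq_le_sq ?_ (Real.sqrt_nonneg _)
    rw [mul_pow, spr_sq, Real.sq_sqrt ht'.le]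
    have h : dec t * (1 + t) ≤ 1 := by
      rw [dec, Real.exp_neg, inv_mul_le_one₀ (Real.exp_pos _)]
      linarith [Real.add_one_le_exp (t : ℝ)]
    nlinarith [dec_pos t]
  have h2 : tanhHalf t / Real.sqrt (2 * heatTime t) ≤ 3 * (Real.sqrt t)⁻¹ := by
    have hp : 0 < Real.sqrt (2 * heatTime t) := Real.sqrt_pos.2 (by linarith [heatTime_pos ht])
    rw [div_le_iff₀ hp, mul_assoc, inv_mul_eq_div, ← mul_div_assoc, le_div_iff₀ hsq]
    refine le_of_sq_le_sq ?_ (by positivity)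
    rw [mul_pow, mul_pow, sq_sqrt_heatTime, Real.sq_sqrt ht'.le]
    have a1 := tanhHalf_le_half t
    have a2 := tanhHalf_nonneg t
    have a3 := cube_le_heatTime ht1
    have a4 : tanhHalf t ^ 2 ≤ (t / 2) ^ 2 := pow_le_pow_left₀ a2 a1 2
    nlinarith
  linarith

lemma semiDvStar_add (s : ℝ≥0) {t : ℝ≥0} (ht : 0 < t) :
    semiDvStar (s + t) = (semi 1 s).comp (semiDvStar t) := by
  have hm : (-1 : ℝ) ^ 2 = 1 := by norm_num
  have h : dvSemi (s + t) = (dvSemi t).comp (semi (-1) s) := by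
    refine clm_ext_chL fun k η θ => ?_
    rw [ContinuousLinearMap.comp_apply, dvSemi_chL (by positivity), semi_chL hm, map_smul,
      dvSemi_chL ht, smul_smul, add_comm s t, move_add, damp_add hm, neg_add, Real.exp_add]
    congr 1; ring
  ext1 f
  refine ext_inner_right ℝ fun g => ?_
  rw [inner_semiDvStar_left, ContinuousLinearMap.comp_apply, inner_semi_left,
    inner_semiDvStar_left, h, ContinuousLinearMap.comp_apply]

lemma inner_semiDvStar_oneL {t : ℝ≥0} (ht : 0 < t) (f : L2) :
    inner ℝ (semiDvStar t f) oneL = 0 := by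
  rw [inner_semiDvStar_left, dvSemi_chL ht]
  simp [move, freq_zero]

/-- The constant in the smoothing estimate. -/
def smoothConst : ℝ := 4 * Real.exp 3

lemma smoothConst_pos : 0 < smoothConst := by unfold smoothConst; positivity

/-- The smoothing estimate `‖e^{-tP} (-∂_v + v)‖ ≤ C t^{-1/2} e^{-t/2}`. -/
lemma norm_semiDvStar_le_exp {t : ℝ≥0} (ht : 0 < t) :
    ‖semiDvStar t‖ ≤ smoothConst * ((Real.sqrt t)⁻¹ * Real.exp (-t / 2)) := by
  have ht' : (0 : ℝ) < t := by exact_mod_cast ht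
  have hsq := Real.sqrt_pos.2 ht'
  unfold smoothConst
  rcases le_total t 1 with h | h
  · refine (norm_semiDvStar_le_of_le_one ht h).trans ?_
    have h' : (t : ℝ) ≤ 1 := by exact_mod_cast h
    have : 1 ≤ Real.exp 3 * Real.exp (-t / 2) := by
      rw [← Real.exp_add]; exact Real.one_le_exp (by linarith)
    have hi : 0 ≤ (Real.sqrt t)⁻¹ := by positivity
    nlinarith
  · have h' : (1 : ℝ) ≤ t := by exact_mod_cast h
    have hB : ‖semiDvStar 1‖ ≤ 4 := by
      simpa using norm_semiDvStar_le_of_le_one one_pos le_rfl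
    -- split off the last unit of time: the range of `semiDvStar 1` is mean-free
    have h1 : ‖semiDvStar t‖ ≤ Real.exp 2 * Real.exp (-(t - 1 : ℝ)) * 4 := by
      refine ContinuousLinearMap.opNorm_le_bound _ (by positivity) fun f => ?_
      have e : t = (t - 1) + 1 := (tsub_add_cancel_of_le h).symm
      rw [e, semiDvStar_add _ one_pos, ContinuousLinearMap.comp_apply, ← e]
      refine (norm_semi_le_of_mean_zero (inner_semiDvStar_oneL one_pos f) _).trans ?_
      rw [NNReal.coe_sub h, NNReal.coe_one, mul_assoc _ 4]
      refine mul_le_mul_of_nonneg_left ?_ (by positivity)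
      exact (semiDvStar 1).le_of_opNorm_le hB f
    refine h1.trans ?_
    have h2 : Real.exp 2 * Real.exp (-(t - 1 : ℝ)) =
        Real.exp 3 * (Real.exp (-t / 2) * Real.exp (-t / 2)) := by
      rw [← Real.exp_add, ← Real.exp_add, ← Real.exp_add]; congr 1; ring
    have h3 : Real.exp (-t / 2) ≤ (Real.sqrt t)⁻¹ := by
      rw [neg_div, Real.exp_neg]
      refine inv_anti₀ hsq (Real.sqrt_le_iff.2 ⟨(Real.exp_pos _).le, ?_⟩)
      rw [← Real.exp_nat_mul]
      have := Real.add_one_le_exp (t : ℝ)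
      have e : ((2 : ℕ) : ℝ) * ((t : ℝ) / 2) = t := by push_cast; ring
      rw [e]; linarith
    rw [h2]
    have h4 : Real.exp (-t / 2) * Real.exp (-t / 2) ≤ (Real.sqrt t)⁻¹ * Real.exp (-t / 2) :=
      mul_le_mul_of_nonneg_right h3 (Real.exp_pos _).le
    nlinarith [Real.exp_pos 3]

/-! ### Calculus of test functions -/

lemma continuous_of_lift {φ : Torus × ℝ → ℝ}
    (h : Continuous fun q : ℝ × ℝ => φ ((q.1 : Torus), q.2)) : Continuous φ := by
  have hq : IsOpenQuotientMap (Prod.map (fun y : ℝ => (y : Torus)) (id : ℝ → ℝ)) :=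
    QuotientAddGroup.isOpenQuotientMap_mk.prodMap IsOpenQuotientMap.id
  exact hq.isQuotientMap.continuous_iff.2 h

namespace IsTestFunction

variable {φ : Torus × ℝ → ℝ}

protected lemma continuous (hφ : IsTestFunction φ) : Continuous φ :=
  continuous_of_lift hφ.1.continuous

lemma exists_bound (hφ : IsTestFunction φ) : ∃ C, ∀ p, |φ p| ≤ C :=
  hφ.continuous.bounded_above_of_compact_support hφ.2

lemma memLp (hφ : IsTestFunction φ) : MemLp φ 2 phaseMeasure := by
  obtain ⟨C, hC⟩ := hφ.exists_bound
  exact memLp_of_continuous_of_bounded hφ.continuous C hC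

lemma hasDerivAt_dv (hφ : IsTestFunction φ) (x : Torus) (v : ℝ) :
    HasDerivAt (fun w => φ (x, w)) (dv φ (x, v)) v := by
  obtain ⟨y, rfl⟩ := exists_coe x
  have h : Differentiable ℝ fun q : ℝ × ℝ => φ ((q.1 : Torus), q.2) :=
    hφ.1.differentiable (by simp)
  have : DifferentiableAt ℝ (fun w : ℝ => φ ((y : Torus), w)) v :=
    (h (y, v)).comp (f := fun w : ℝ => (y, w)) v (by fun_prop)
  exact this.hasDerivAt

lemma hasDerivAt_dx (hφ : IsTestFunction φ) (y v : ℝ) :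
    HasDerivAt (fun z : ℝ => φ ((z : Torus), v)) (dx φ ((y : Torus), v)) y := by
  have h : Differentiable ℝ fun q : ℝ × ℝ => φ ((q.1 : Torus), q.2) :=
    hφ.1.differentiable (by simp)
  have h1 : DifferentiableAt ℝ (fun z : ℝ => φ ((z : Torus), v)) y :=
    (h (y, v)).comp (f := fun z : ℝ => (z, v)) y (by fun_prop)
  have h2 : dx φ ((y : Torus), v) = deriv (fun z : ℝ => φ ((z : Torus), v)) y := by
    have := deriv_comp_const_add (fun z : ℝ => φ ((z : Torus), v)) y 0
    simp only [← AddCircle.coe_add, dx]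
    rw [this, add_zero]
  rw [h2]
  exact h1.hasDerivAt

lemma dv_lift (hφ : IsTestFunction φ) : (fun q : ℝ × ℝ => dv φ ((q.1 : Torus), q.2)) =
    fun q => fderiv ℝ (fun q : ℝ × ℝ => φ ((q.1 : Torus), q.2)) q (0, 1) := by
  ext q
  have h : Differentiable ℝ fun q : ℝ × ℝ => φ ((q.1 : Torus), q.2) :=
    hφ.1.differentiable (by simp)
  have h1 : HasDerivAt (fun w : ℝ => (q.1, w)) ((0 : ℝ), (1 : ℝ)) q.2 :=
    (hasDerivAt_const _ _).prodMk (hasDerivAt_id _)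
  have h2 := HasFDerivAt.comp_hasDerivAt (f := fun w : ℝ => (q.1, w)) q.2 (h q).hasFDerivAt h1
  exact (hφ.hasDerivAt_dv _ _).unique h2

lemma dx_lift (hφ : IsTestFunction φ) : (fun q : ℝ × ℝ => dx φ ((q.1 : Torus), q.2)) =
    fun q => fderiv ℝ (fun q : ℝ × ℝ => φ ((q.1 : Torus), q.2)) q (1, 0) := by
  ext q
  have h : Differentiable ℝ fun q : ℝ × ℝ => φ ((q.1 : Torus), q.2) :=
    hφ.1.differentiable (by simp)
  have h1 : HasDerivAt (fun z : ℝ => (z, q.2)) ((1 : ℝ), (0 : ℝ)) q.1 :=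
    (hasDerivAt_id _).prodMk (hasDerivAt_const _ _)
  have h2 := HasFDerivAt.comp_hasDerivAt (f := fun z : ℝ => (z, q.2)) q.1 (h q).hasFDerivAt h1
  exact (hφ.hasDerivAt_dx _ _).unique h2

protected lemma dv (hφ : IsTestFunction φ) : IsTestFunction (dv φ) := by
  constructor
  · rw [hφ.dv_lift]
    exact (hφ.1.fderiv_right (by simp)).clm_apply contDiff_const
  · refine HasCompactSupport.intro hφ.2 fun p hp => ?_
    have h1 : φ =ᶠ[𝓝 p] 0 := notMem_tsupport_iff_eventuallyEq.1 hp
    have h2 : Tendsto (fun w : ℝ => (p.1, w)) (𝓝 p.2) (𝓝 p) :=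
      (by fun_prop : Continuous fun w : ℝ => (p.1, w)).tendsto p.2
    have h3 : (fun w : ℝ => φ (p.1, w)) =ᶠ[𝓝 p.2] fun _ => 0 := h2.eventually h1
    rw [VPFP.dv, h3.deriv_eq, deriv_const]

protected lemma dx (hφ : IsTestFunction φ) : IsTestFunction (dx φ) := by
  constructor
  · rw [hφ.dx_lift]
    exact (hφ.1.fderiv_right (by simp)).clm_apply contDiff_const
  · refine HasCompactSupport.intro hφ.2 fun p hp => ?_
    have h1 : φ =ᶠ[𝓝 p] 0 := notMem_tsupport_iff_eventuallyEq.1 hp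
    have h2 : Tendsto (fun y : ℝ => (p.1 + (y : Torus), p.2)) (𝓝 0) (𝓝 p) := by
      have hc : Continuous fun y : ℝ => (p.1 + (y : Torus), p.2) :=
        (continuous_const.add (AddCircle.continuous_mk' 1)).prodMk continuous_const
      simpa using hc.tendsto 0
    have h3 : (fun y : ℝ => φ (p.1 + (y : Torus), p.2)) =ᶠ[𝓝 0] fun _ => 0 := h2.eventually h1
    rw [VPFP.dx, h3.deriv_eq, deriv_const]

lemma snd_mul (hφ : IsTestFunction φ) : IsTestFunction fun p => p.2 * φ p :=
  ⟨contDiff_snd.mul hφ.1, hφ.2.mul_left⟩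

protected lemma neg (hφ : IsTestFunction φ) : IsTestFunction fun p => -φ p :=
  ⟨hφ.1.neg, hφ.2.neg⟩

protected lemma add {ψ : Torus × ℝ → ℝ} (hφ : IsTestFunction φ) (hψ : IsTestFunction ψ) :
    IsTestFunction fun p => φ p + ψ p :=
  ⟨hφ.1.add hψ.1, hφ.2.add hψ.2⟩

protected lemma dvStar (hφ : IsTestFunction φ) : IsTestFunction (dvStar φ) :=
  hφ.dv.neg.add hφ.snd_mul

protected lemma fpAdjoint (hφ : IsTestFunction φ) : IsTestFunction (fpAdjoint φ) :=
  hφ.dx.snd_mul.neg.add hφ.dv.dvStar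

lemma dx_snd_mul (φ : Torus × ℝ → ℝ) : dx (fun p => p.2 * φ p) = fun p => p.2 * dx φ p := by
  ext p
  exact deriv_const_mul_field p.2

lemma integrable_mul_ch (hφ : IsTestFunction φ) (k : ℤ) (η θ : ℝ) :
    Integrable (fun p => φ p * ch k η θ p) phaseMeasure :=
  hφ.memLp.integrable_mul (memLp_ch k η θ)

end IsTestFunction

lemma ch_add_pi (k : ℤ) (η θ : ℝ) (p : Torus × ℝ) :
    ch k η (θ + Real.pi / 2 + Real.pi / 2) p = -ch k η θ p := by
  obtain ⟨x, v⟩ := p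
  obtain ⟨y, rfl⟩ := exists_coe x
  rw [ch_coe, ch_coe, ← Real.cos_add_pi]
  congr 1; ring

lemma hasDerivAt_ch_v (k : ℤ) (η θ : ℝ) (x : Torus) (v : ℝ) :
    HasDerivAt (fun w => ch k η θ (x, w)) (η * ch k η (θ + Real.pi / 2) (x, v)) v := by
  obtain ⟨y, rfl⟩ := exists_coe x
  simp only [ch_coe]
  have h := ((((hasDerivAt_id v).const_mul η).const_add (freq k * y)).add_const θ).cos
  convert! h using 1
  rw [← add_assoc, Real.cos_add_pi_div_two]
  simp only [id, mul_one]
  ring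

lemma hasDerivAt_ch_x (k : ℤ) (η θ : ℝ) (y v : ℝ) :
    HasDerivAt (fun z : ℝ => ch k η θ ((z : Torus), v))
      (freq k * ch k η (θ + Real.pi / 2) ((y : Torus), v)) y := by
  simp only [ch_coe]
  have h := ((((hasDerivAt_id y).const_mul (freq k)).add_const (η * v)).add_const θ).cos
  convert! h using 1
  rw [← add_assoc, Real.cos_add_pi_div_two]
  simp only [id, mul_one]
  ring

/-- `∂_v` and `-∂_v + v` are formally adjoint. -/
lemma integral_dvStar_mul_ch {φ : Torus × ℝ → ℝ} (hφ : IsTestFunction φ) (k : ℤ) (η θ : ℝ) :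
    ∫ p, dvStar φ p * ch k η θ p ∂phaseMeasure =
      η * ∫ p, φ p * ch k η (θ + Real.pi / 2) p ∂phaseMeasure := by
  rw [← integral_const_mul, ← sub_eq_zero, ← integral_sub (hφ.dvStar.integrable_mul_ch k η θ)
    ((hφ.integrable_mul_ch k η _).const_mul η)]
  have hi := (hφ.dvStar.integrable_mul_ch k η θ).sub
    ((hφ.integrable_mul_ch k η (θ + Real.pi / 2)).const_mul η)
  refine (integral_prod _ hi).trans ?_
  refine integral_eq_zero_of_ae (ae_of_all _ fun x => ?_)
  have hb : ∀ {g : Torus × ℝ → ℝ}, IsTestFunction g → ∀ θ',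
      Integrable (fun v => g (x, v) * ch k η θ' (x, v)) gaussV := by
    intro g hg θ'
    obtain ⟨C, hC⟩ := hg.exists_bound
    have hm : Continuous fun v : ℝ => g (x, v) * ch k η θ' (x, v) :=
      (hg.continuous.comp (by fun_prop)).mul ((continuous_ch k η θ').comp (by fun_prop))
    refine Integrable.of_bound hm.aestronglyMeasurable (C * 1) (ae_of_all _ fun v => ?_)
    rw [Real.norm_eq_abs, abs_mul]
    exact mul_le_mul (hC _) (abs_ch_le _ _ _ _) (abs_nonneg _) ((abs_nonneg _).trans (hC (x, v)))
  have hd : ∀ v, HasDerivAt (fun v => φ (x, v) * ch k η θ (x, v))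
      (dv φ (x, v) * ch k η θ (x, v) + η * (φ (x, v) * ch k η (θ + Real.pi / 2) (x, v))) v := by
    intro v
    convert! (hφ.hasDerivAt_dv x v).mul (hasDerivAt_ch_v k η θ x v) using 1
    ring
  have h2 : Integrable (fun v => v * (φ (x, v) * ch k η θ (x, v))) gaussV := by
    simpa only [mul_assoc] using hb hφ.snd_mul θ
  have h1 : Integrable (fun v => dv φ (x, v) * ch k η θ (x, v) +
      η * (φ (x, v) * ch k η (θ + Real.pi / 2) (x, v))) gaussV :=
    (hb hφ.dv θ).add ((hb hφ (θ + Real.pi / 2)).const_mul η)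
  have key := gaussian_integration_by_parts hd (hb hφ θ) h1 h2
  rw [← sub_eq_zero, ← integral_sub h1 h2] at key
  rw [Pi.zero_apply, ← neg_eq_zero, ← integral_neg, ← key]
  refine integral_congr_ae (ae_of_all _ fun v => ?_)
  simp only [dvStar, Pi.sub_apply]
  ring

lemma integral_dv_mul_ch {φ : Torus × ℝ → ℝ} (hφ : IsTestFunction φ) (k : ℤ) (η θ : ℝ) :
    ∫ p, dv φ p * ch k η θ p ∂phaseMeasure =
      ∫ p, (p.2 * φ p) * ch k η θ p ∂phaseMeasure
        - η * ∫ p, φ p * ch k η (θ + Real.pi / 2) p ∂phaseMeasure := by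
  rw [← integral_dvStar_mul_ch hφ, ← integral_sub (hφ.snd_mul.integrable_mul_ch k η θ)
    (hφ.dvStar.integrable_mul_ch k η θ)]
  refine integral_congr_ae (ae_of_all _ fun p => ?_)
  simp only [dvStar]
  ring

lemma integral_dx_mul_ch {φ : Torus × ℝ → ℝ} (hφ : IsTestFunction φ) (k : ℤ) (η θ : ℝ) :
    ∫ p, dx φ p * ch k η θ p ∂phaseMeasure =
      -(freq k * ∫ p, φ p * ch k η (θ + Real.pi / 2) p ∂phaseMeasure) := by
  rw [← integral_const_mul, eq_neg_iff_add_eq_zero,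
    ← integral_add (hφ.dx.integrable_mul_ch k η θ)
    ((hφ.integrable_mul_ch k η _).const_mul (freq k))]
  have hi := (hφ.dx.integrable_mul_ch k η θ).add
    ((hφ.integrable_mul_ch k η (θ + Real.pi / 2)).const_mul (freq k))
  refine (integral_prod_symm _ hi).trans ?_
  refine integral_eq_zero_of_ae (ae_of_all _ fun v => ?_)
  have hcont : ∀ {g : Torus × ℝ → ℝ}, IsTestFunction g → ∀ θ',
      Continuous fun y : ℝ => g ((y : Torus), v) * ch k η θ' ((y : Torus), v) := by
    intro g hg θ'
    have hc : Continuous fun y : ℝ => ((y : Torus), v) :=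
      (AddCircle.continuous_mk' 1).prodMk continuous_const
    exact (hg.continuous.comp hc).mul ((continuous_ch k η θ').comp hc)
  have hd : ∀ y : ℝ, HasDerivAt (fun y : ℝ => φ ((y : Torus), v) * ch k η θ ((y : Torus), v))
      (dx φ ((y : Torus), v) * ch k η θ ((y : Torus), v) +
        freq k * (φ ((y : Torus), v) * ch k η (θ + Real.pi / 2) ((y : Torus), v))) y := by
    intro y
    convert! (hφ.hasDerivAt_dx y v).mul (hasDerivAt_ch_x k η θ y v) using 1
    ring
  have h1 := intervalIntegral.integral_eq_sub_of_hasDerivAt (a := 0) (b := 0 + 1)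
    (fun y _ => hd y)
    (((hcont hφ.dx θ).add ((hcont hφ (θ + Real.pi / 2)).const_mul (freq k))).intervalIntegrable _ _)
  have h2 := UnitAddCircle.intervalIntegral_preimage 0 (fun x : Torus =>
    dx φ (x, v) * ch k η θ (x, v) + freq k * (φ (x, v) * ch k η (θ + Real.pi / 2) (x, v)))
  -- the boundary terms cancel by periodicity
  have h3 : (((0 + 1 : ℝ) : Torus)) = ((0 : ℝ) : Torus) := by
    rw [AddCircle.coe_add_period]
  rw [h1, h3, sub_self] at h2
  exact h2.symm

/-- The function `(ε v ∂_x + (-∂_v + v) ∂_v) ch`. -/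
def fpCh (ε : ℝ) (k : ℤ) (η θ : ℝ) (p : Torus × ℝ) : ℝ :=
  η ^ 2 * ch k η θ p + (η + ε * freq k) * (p.2 * ch k η (θ + Real.pi / 2) p)

/-- Integration by parts: the formal adjoint against characters. -/
lemma integral_fpAdjoint_mul_ch {φ : Torus × ℝ → ℝ} (hφ : IsTestFunction φ) (k : ℤ) (η θ : ℝ) :
    ∫ p, fpAdjoint φ p * ch k η θ p ∂phaseMeasure =
      ∫ p, φ p * fpCh 1 k η θ p ∂phaseMeasure := by
  have e1 : ∫ p, fpAdjoint φ p * ch k η θ p ∂phaseMeasure =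
      -(∫ p, dx (fun p => p.2 * φ p) p * ch k η θ p ∂phaseMeasure)
        + ∫ p, dvStar (dv φ) p * ch k η θ p ∂phaseMeasure := by
    rw [neg_add_eq_sub, ← integral_sub (hφ.dv.dvStar.integrable_mul_ch k η θ)
      (hφ.snd_mul.dx.integrable_mul_ch k η θ)]
    refine integral_congr_ae (ae_of_all _ fun p => ?_)
    simp only [fpAdjoint, IsTestFunction.dx_snd_mul]
    ring
  have e2 : ∫ p, φ p * fpCh 1 k η θ p ∂phaseMeasure =
      η ^ 2 * ∫ p, φ p * ch k η θ p ∂phaseMeasure +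
        (η + freq k) * ∫ p, (p.2 * φ p) * ch k η (θ + Real.pi / 2) p ∂phaseMeasure := by
    rw [← integral_const_mul, ← integral_const_mul, ← integral_add
      ((hφ.integrable_mul_ch k η θ).const_mul _)
      ((hφ.snd_mul.integrable_mul_ch k η (θ + Real.pi / 2)).const_mul _)]
    refine integral_congr_ae (ae_of_all _ fun p => ?_)
    simp only [fpCh]
    ring
  rw [e1, e2, integral_dx_mul_ch hφ.snd_mul, integral_dvStar_mul_ch hφ.dv, integral_dv_mul_ch hφ]
  simp only [ch_add_pi, mul_neg, integral_neg]
  ring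

/-! ### The generator of the semigroup -/

/-- The trajectory of a character under the semigroup solves the evolution equation pointwise. -/
lemma hasDerivAt_evolution {ε : ℝ} (hε : ε ^ 2 = 1) (k : ℤ) (η θ : ℝ) (p : Torus × ℝ) (t : ℝ) :
    HasDerivAt (fun t : ℝ =>
      Real.exp (-(η ^ 2 * (1 - Real.exp (-t) ^ 2) / 2
        - ε * η * freq k * (1 - Real.exp (-t)) ^ 2
        + freq k ^ 2 * (t - (1 - Real.exp (-t)) * (3 - Real.exp (-t)) / 2))) *
        ch k (Real.exp (-t) * η - (1 - Real.exp (-t)) * ε * freq k) θ p)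
      (-(Real.exp (-(η ^ 2 * (1 - Real.exp (-t) ^ 2) / 2
        - ε * η * freq k * (1 - Real.exp (-t)) ^ 2
        + freq k ^ 2 * (t - (1 - Real.exp (-t)) * (3 - Real.exp (-t)) / 2))) *
        fpCh ε k (Real.exp (-t) * η - (1 - Real.exp (-t)) * ε * freq k) θ p)) t := by
  obtain ⟨x, v⟩ := p
  obtain ⟨y, rfl⟩ := exists_coe x
  have hq : HasDerivAt (fun t : ℝ => Real.exp (-t)) (-Real.exp (-t)) t := by
    simpa using (hasDerivAt_neg t).exp
  have hm : HasDerivAt (fun t : ℝ => Real.exp (-t) * η - (1 - Real.exp (-t)) * ε * freq k)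
      (-(Real.exp (-t) * η) - Real.exp (-t) * ε * freq k) t := by
    convert! (hq.mul_const η).sub (((hq.const_sub 1).mul_const ε).mul_const (freq k)) using 1
    ring
  have hd : HasDerivAt (fun t : ℝ => -(η ^ 2 * (1 - Real.exp (-t) ^ 2) / 2
        - ε * η * freq k * (1 - Real.exp (-t)) ^ 2
        + freq k ^ 2 * (t - (1 - Real.exp (-t)) * (3 - Real.exp (-t)) / 2)))
      (-(Real.exp (-t) * η - (1 - Real.exp (-t)) * ε * freq k) ^ 2) t := by
    convert! ((((((hq.pow 2).const_sub 1).const_mul (η ^ 2)).div_const 2).sub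
      (((hq.const_sub 1).pow 2).const_mul (ε * η * freq k))).add
      (((hasDerivAt_id t).sub
        (((hq.const_sub 1).mul (hq.const_sub 3)).div_const 2)).const_mul (freq k ^ 2))).neg using 1
    generalize Real.exp (-t) = q
    push_cast
    linear_combination (-(1 - q) ^ 2 * freq k ^ 2) * hε
  have hc : HasDerivAt (fun t : ℝ =>
      ch k (Real.exp (-t) * η - (1 - Real.exp (-t)) * ε * freq k) θ ((y : Torus), v))
      ((-(Real.exp (-t) * η) - Real.exp (-t) * ε * freq k) *
        (v * ch k (Real.exp (-t) * η - (1 - Real.exp (-t)) * ε * freq k) (θ + Real.pi / 2)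
          ((y : Torus), v))) t := by
    simp only [ch_coe]
    convert! (((hm.mul_const v).const_add (freq k * y)).add_const θ).cos using 1
    rw [← add_assoc, Real.cos_add_pi_div_two]
    ring
  convert! hd.exp.mul hc using 1
  simp only [fpCh]
  ring

/-- If `(ε v ∂_x + (-∂_v + v) ∂_v) f = h` weakly against all characters, the orbit of `f` solves the
evolution equation weakly against all characters. -/
lemma hasDerivWithinAt_inner_semi {ε : ℝ} (hε : ε ^ 2 = 1) {f h : L2}
    (hf : ∀ k η θ, inner ℝ h (chL k η θ) = ∫ p, f p * fpCh (-ε) k η θ p ∂phaseMeasure)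
    (k : ℤ) (η θ : ℝ) {t : ℝ} (ht : 0 ≤ t) :
    HasDerivWithinAt (fun t : ℝ => inner ℝ (semi ε t.toNNReal f) (chL k η θ))
      (-inner ℝ (semi ε t.toNNReal h) (chL k η θ)) (Set.Ici 0) t := by
  have hε' : (-ε) ^ 2 = 1 := by rw [neg_sq, hε]
  set a : ℝ → ℝ := fun t => Real.exp (-(η ^ 2 * (1 - Real.exp (-t) ^ 2) / 2
        - (-ε) * η * freq k * (1 - Real.exp (-t)) ^ 2
        + freq k ^ 2 * (t - (1 - Real.exp (-t)) * (3 - Real.exp (-t)) / 2))) with ha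
  set m : ℝ → ℝ := fun t => Real.exp (-t) * η - (1 - Real.exp (-t)) * (-ε) * freq k with hm
  have hac : Continuous a := by rw [ha]; fun_prop
  have hmc : Continuous m := by rw [hm]; fun_prop
  have hsemi : ∀ (g : L2) {s : ℝ}, 0 ≤ s → inner ℝ (semi ε s.toNNReal g) (chL k η θ) =
      a s * inner ℝ g (chL k (m s) θ) := by
    intro g s hs
    rw [inner_semi_left, semi_chL hε', inner_smul_right, damp, move, dec, Real.coe_toNNReal _ hs]
  have hint : ∀ s, Integrable (fun p => f p * (a s * ch k (m s) θ p)) phaseMeasure := fun s =>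
    (Lp.memLp f).integrable_mul ((memLp_ch k (m s) θ).const_mul (a s))
  have hder : HasDerivAt (fun s => ∫ p, f p * (a s * ch k (m s) θ p) ∂phaseMeasure)
      (∫ p, f p * -(a t * fpCh (-ε) k (m t) θ p) ∂phaseMeasure) t := by
    obtain ⟨C₁, hC₁⟩ := (isCompact_closedBall t (1 : ℝ)).exists_bound_of_continuousOn
      (f := fun s => a s * m s ^ 2) (by fun_prop)
    obtain ⟨C₂, hC₂⟩ := (isCompact_closedBall t (1 : ℝ)).exists_bound_of_continuousOn
      (f := fun s => a s * (m s + -ε * freq k)) (by fun_prop)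
    refine (hasDerivAt_integral_of_dominated_loc_of_deriv_le (μ := phaseMeasure)
      (F := fun s p => f p * (a s * ch k (m s) θ p))
      (F' := fun s p => f p * -(a s * fpCh (-ε) k (m s) θ p))
      (bound := fun p => C₁ * |f p| + C₂ * |f p * p.2|)
      (Metric.ball_mem_nhds t one_pos) (Eventually.of_forall fun s => (hint s).aestronglyMeasurable)
      (hint t) ?_ (ae_of_all _ fun p s hs => ?_) ?_ (ae_of_all _ fun p s _ => ?_)).2
    · have hc : Continuous fun p => -(a t * fpCh (-ε) k (m t) θ p) := by
        have h1 := continuous_ch k (m t) θ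
        have h2 := continuous_ch k (m t) (θ + Real.pi / 2)
        unfold fpCh
        fun_prop
      exact (Lp.aestronglyMeasurable f).mul hc.aestronglyMeasurable
    · have h1 := hC₁ s (Metric.ball_subset_closedBall hs)
      have h2 := hC₂ s (Metric.ball_subset_closedBall hs)
      have e : f p * -(a s * fpCh (-ε) k (m s) θ p) =
          -((a s * m s ^ 2) * (f p * ch k (m s) θ p) +
            (a s * (m s + -ε * freq k)) * (f p * p.2 * ch k (m s) (θ + Real.pi / 2) p)) := by
        unfold fpCh; ring
      rw [e, norm_neg]
      refine (norm_add_le _ _).trans (add_le_add ?_ ?_)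
      · rw [norm_mul]
        refine mul_le_mul h1 ?_ (norm_nonneg _) ((norm_nonneg _).trans h1)
        rw [norm_mul]
        exact mul_le_of_le_one_right (abs_nonneg _) (abs_ch_le _ _ _ _)
      · rw [norm_mul]
        refine mul_le_mul h2 ?_ (norm_nonneg _) ((norm_nonneg _).trans h2)
        rw [norm_mul]
        exact mul_le_of_le_one_right (abs_nonneg _) (abs_ch_le _ _ _ _)
    · have h1 : Integrable f phaseMeasure := (Lp.memLp f).integrable (by norm_num)
      have h2 : Integrable (fun p => f p * p.2) phaseMeasure :=
        (Lp.memLp f).integrable_mul memLp_snd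
      exact (h1.abs.const_mul C₁).add (h2.abs.const_mul C₂)
    · exact (hasDerivAt_evolution hε' k η θ p s).const_mul (f p)
  have e1 : ∫ p, f p * -(a t * fpCh (-ε) k (m t) θ p) ∂phaseMeasure =
      -inner ℝ (semi ε t.toNNReal h) (chL k η θ) := by
    rw [hsemi h ht, hf, ← integral_const_mul, ← integral_neg]
    refine integral_congr_ae (ae_of_all _ fun p => ?_)
    simp only
    ring
  rw [← e1]
  have e2 : ∀ s, 0 ≤ s → inner ℝ (semi ε s.toNNReal f) (chL k η θ) =
      ∫ p, f p * (a s * ch k (m s) θ p) ∂phaseMeasure := by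
    intro s hs
    rw [hsemi f hs, inner_chL, ← integral_const_mul]
    refine integral_congr_ae (ae_of_all _ fun p => ?_)
    simp only
    ring
  exact hder.hasDerivWithinAt.congr (fun s hs => e2 s hs) (e2 t ht)

lemma continuous_semi_toNNReal {ε : ℝ} (hε : ε ^ 2 = 1) (f : L2) :
    Continuous fun s : ℝ => semi ε s.toNNReal f :=
  (continuous_semi hε f).comp continuous_real_toNNReal

lemma semi_sub_eq_integral {ε : ℝ} (hε : ε ^ 2 = 1) {f h : L2}
    (hf : ∀ k η θ, inner ℝ h (chL k η θ) = ∫ p, f p * fpCh (-ε) k η θ p ∂phaseMeasure)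
    {t : ℝ} (ht : 0 ≤ t) :
    semi ε t.toNNReal f - f = -∫ s in (0 : ℝ)..t, semi ε s.toNNReal h := by
  refine eq_of_inner_chL fun k η θ => ?_
  have hc := continuous_semi_toNNReal hε h
  have h1 : ∫ s in (0 : ℝ)..t, -inner ℝ (semi ε s.toNNReal h) (chL k η θ) =
      inner ℝ (semi ε t.toNNReal f) (chL k η θ) -
        inner ℝ (semi ε (0 : ℝ).toNNReal f) (chL k η θ) := by
    refine intervalIntegral.integral_eq_sub_of_hasDeriv_right_of_le ht
      (f := fun s : ℝ => inner ℝ (semi ε s.toNNReal f) (chL k η θ)) ?_ (fun s hs => ?_) ?_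
    · exact ((continuous_semi_toNNReal hε f).inner continuous_const).continuousOn
    · exact (hasDerivWithinAt_inner_semi hε hf k η θ hs.1.le).mono
        fun r hr => hs.1.le.trans (le_of_lt hr)
    · exact ((hc.inner continuous_const).neg).intervalIntegrable _ _
  have h2 : inner ℝ (∫ s in (0 : ℝ)..t, semi ε s.toNNReal h) (chL k η θ) =
      ∫ s in (0 : ℝ)..t, inner ℝ (semi ε s.toNNReal h) (chL k η θ) := by
    have := ((innerSL ℝ (chL k η θ)).intervalIntegral_comp_comm
      (hc.intervalIntegrable (μ := volume) 0 t)).symm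
    simpa only [innerSL_apply_apply, real_inner_comm] using this
  rw [intervalIntegral.integral_neg, Real.toNNReal_zero, semi_zero hε,
    ContinuousLinearMap.id_apply] at h1
  rw [inner_sub_left, inner_neg_left, h2, ← h1]

lemma tendsto_coe_nnreal_zero :
    Tendsto (fun t : ℝ≥0 => (t : ℝ)) (𝓝[>] 0) (𝓝[≠] 0) := by
  refine tendsto_nhdsWithin_iff.2 ⟨?_, ?_⟩
  · have h : Continuous fun t : ℝ≥0 => (t : ℝ) := NNReal.continuous_coe
    exact (by simpa using h.tendsto 0 : Tendsto (fun t : ℝ≥0 => (t : ℝ)) (𝓝 0) (𝓝 0)).mono_left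
      nhdsWithin_le_nhds
  · filter_upwards [self_mem_nhdsWithin] with t ht
    exact (NNReal.coe_pos.2 ht).ne'

/-- A function in the weak domain against characters is in the domain of the generator. -/
lemma hasGenerator_of_weak {ε : ℝ} (hε : ε ^ 2 = 1) {f h : L2}
    (hf : ∀ k η θ, inner ℝ h (chL k η θ) = ∫ p, f p * fpCh (-ε) k η θ p ∂phaseMeasure) :
    HasGenerator (semi ε) f (-h) := by
  have hc := continuous_semi_toNNReal hε h
  have hd : HasDerivAt (fun t : ℝ => -∫ s in (0 : ℝ)..t, semi ε s.toNNReal h)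
      (-semi ε (0 : ℝ).toNNReal h) 0 :=
    (intervalIntegral.integral_hasDerivAt_right (hc.intervalIntegrable _ _)
      (hc.stronglyMeasurableAtFilter _ _) hc.continuousAt).neg
  rw [Real.toNNReal_zero, semi_zero hε, ContinuousLinearMap.id_apply,
    hasDerivAt_iff_tendsto_slope_zero] at hd
  refine (hd.comp tendsto_coe_nnreal_zero).congr fun t => ?_
  have h1 := semi_sub_eq_integral hε hf t.2
  have h2 : Real.toNNReal t.1 = t := Real.toNNReal_coe
  rw [h2] at h1
  simp only [Function.comp, zero_add, intervalIntegral.integral_same, neg_zero, sub_zero]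
  rw [h1]
  rfl

lemma inner_toLp_left {g : Torus × ℝ → ℝ} (hg : MemLp g 2 phaseMeasure) (f : L2) :
    inner ℝ (hg.toLp g) f = ∫ p, f p * g p ∂phaseMeasure := by
  rw [inner_eq_integral]
  refine integral_congr_ae ?_
  filter_upwards [hg.coeFn_toLp] with p hp
  rw [hp, mul_comm]

/-- Test functions are in the domain of the adjoint semigroup. -/
lemma hasGenerator_testFunction {φ : Torus × ℝ → ℝ} (hφ : IsTestFunction φ) :
    HasGenerator (semi (-1)) (hφ.memLp.toLp φ) (-(hφ.fpAdjoint.memLp.toLp (fpAdjoint φ))) := by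
  refine hasGenerator_of_weak (by norm_num) fun k η θ => ?_
  rw [inner_chL, neg_neg]
  have h1 : ∫ p, (hφ.fpAdjoint.memLp.toLp (fpAdjoint φ)) p * ch k η θ p ∂phaseMeasure =
      ∫ p, fpAdjoint φ p * ch k η θ p ∂phaseMeasure := by
    refine integral_congr_ae ?_
    filter_upwards [hφ.fpAdjoint.memLp.coeFn_toLp] with p hp
    rw [hp]
  rw [h1, integral_fpAdjoint_mul_ch hφ]
  refine integral_congr_ae ?_
  filter_upwards [hφ.memLp.coeFn_toLp] with p hp
  rw [hp]

lemma hasFP_of_hasGenerator {f h : L2} (hf : HasGenerator (semi 1) f (-h)) : HasFP f h := by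
  intro φ hφ
  set φL := hφ.memLp.toLp φ
  set ψL := hφ.fpAdjoint.memLp.toLp (fpAdjoint φ)
  have h1 : Tendsto (fun t : ℝ≥0 => inner ℝ φL ((t : ℝ)⁻¹ • (semi 1 t f - f))) (𝓝[>] 0)
      (𝓝 (inner ℝ φL (-h))) := tendsto_const_nhds.inner hf
  have h2 : Tendsto (fun t : ℝ≥0 => inner ℝ ((t : ℝ)⁻¹ • (semi (-1) t φL - φL)) f) (𝓝[>] 0)
      (𝓝 (inner ℝ (-ψL) f)) := (hasGenerator_testFunction hφ).inner tendsto_const_nhds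
  have h3 : ∀ t : ℝ≥0, inner ℝ φL ((t : ℝ)⁻¹ • (semi 1 t f - f)) =
      inner ℝ ((t : ℝ)⁻¹ • (semi (-1) t φL - φL)) f := by
    intro t
    rw [inner_smul_right, inner_smul_left, inner_sub_left, inner_sub_right, inner_semi_left,
      neg_neg]
    rfl
  simp only [h3] at h1
  have h4 := tendsto_nhds_unique h1 h2
  rw [inner_neg_left, inner_neg_right, neg_inj, inner_toLp_left, inner_toLp_left] at h4
  exact h4

/-! ### Truncated characters -/

/-- The truncation `χ(mv) ch(x, v)` of a character, as a test function. -/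
lemma isTestFunction_cutoff {χ : ℝ → ℝ} (hχ : ContDiff ℝ ∞ χ) (hs : HasCompactSupport χ) {m : ℝ}
    (hm : 0 < m) (k : ℤ) (η θ : ℝ) : IsTestFunction fun p => χ (m * p.2) * ch k η θ p := by
  constructor
  · have h1 : ContDiff ℝ ∞ fun q : ℝ × ℝ => χ (m * q.2) := hχ.comp (by fun_prop)
    have h2 : ContDiff ℝ ∞ fun q : ℝ × ℝ => ch k η θ ((q.1 : Torus), q.2) := by
      simp only [ch_coe]
      fun_prop
    exact h1.mul h2
  · obtain ⟨R, hR⟩ := hs.isBounded.subset_closedBall 0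
    refine HasCompactSupport.intro (isCompact_univ.prod (isCompact_closedBall (0 : ℝ) (R / m)))
      fun p hp => ?_
    have h1 : m * p.2 ∉ tsupport χ := by
      intro h
      refine hp ⟨Set.mem_univ _, ?_⟩
      have := hR h
      rw [mem_closedBall_zero_iff, norm_mul, Real.norm_of_nonneg hm.le] at this
      rw [mem_closedBall_zero_iff, le_div_iff₀ hm, mul_comm]
      exact this
    simp only [image_eq_zero_of_notMem_tsupport h1, zero_mul]

lemma fpAdjoint_cutoff {χ χ₁ χ₂ : ℝ → ℝ} (h1 : ∀ u, HasDerivAt χ (χ₁ u) u)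
    (h2 : ∀ u, HasDerivAt χ₁ (χ₂ u) u) (m : ℝ) (k : ℤ) (η θ : ℝ) (p : Torus × ℝ) :
    fpAdjoint (fun p => χ (m * p.2) * ch k η θ p) p =
      χ (m * p.2) * fpCh (-1) k η θ p
        + (-(m ^ 2 * χ₂ (m * p.2)) + m * p.2 * χ₁ (m * p.2)) * ch k η θ p
        - 2 * m * χ₁ (m * p.2) * η * ch k η (θ + Real.pi / 2) p := by
  have hs1 : ∀ v, HasDerivAt (fun v => χ (m * v)) (m * χ₁ (m * v)) v := fun v => by
    have h := (h1 (m * v)).comp v ((hasDerivAt_id v).const_mul m)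
    simpa [mul_comm] using! h
  have hs2 : ∀ v, HasDerivAt (fun v => χ₁ (m * v)) (m * χ₂ (m * v)) v := fun v => by
    have h := (h2 (m * v)).comp v ((hasDerivAt_id v).const_mul m)
    simpa [mul_comm] using! h
  have e1 : dv (fun p => χ (m * p.2) * ch k η θ p) = fun p =>
      m * χ₁ (m * p.2) * ch k η θ p + χ (m * p.2) * (η * ch k η (θ + Real.pi / 2) p) := by
    ext p
    exact ((hs1 p.2).mul (hasDerivAt_ch_v k η θ p.1 p.2)).deriv
  have e2 : dv (dv (fun p => χ (m * p.2) * ch k η θ p)) p =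
      m ^ 2 * χ₂ (m * p.2) * ch k η θ p + 2 * m * χ₁ (m * p.2) * η * ch k η (θ + Real.pi / 2) p
        - η ^ 2 * (χ (m * p.2) * ch k η θ p) := by
    rw [e1]
    have hd := ((((hs2 p.2).const_mul m).mul (hasDerivAt_ch_v k η θ p.1 p.2)).add
      ((hs1 p.2).mul ((hasDerivAt_ch_v k η (θ + Real.pi / 2) p.1 p.2).const_mul η))).deriv
    rw [ch_add_pi] at hd
    refine Eq.trans hd ?_
    ring
  have e3 : dx (fun p => χ (m * p.2) * ch k η θ p) p =
      χ (m * p.2) * (freq k * ch k η (θ + Real.pi / 2) p) := by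
    obtain ⟨x, v⟩ := p
    obtain ⟨y, rfl⟩ := exists_coe x
    have hd := (hasDerivAt_ch_x k η θ y v).const_mul (χ (m * v))
    have h3 := deriv_comp_const_add
      (fun z : ℝ => χ (m * v) * ch k η θ ((z : Torus), v)) y 0
    rw [add_zero, hd.deriv] at h3
    simp only [dx, ← AddCircle.coe_add]
    exact h3
  rw [fpAdjoint, e3, dvStar, e2, e1, fpCh]
  ring

/-- The distributional identity extends from test functions to characters. -/
lemma HasFP.inner_chL {f h : L2} (hf : HasFP f h) (k : ℤ) (η θ : ℝ) :
    inner ℝ h (chL k η θ) = ∫ p, f p * fpCh (-1) k η θ p ∂phaseMeasure := by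
  let b : ContDiffBump (0 : ℝ) := default
  have hχ : ContDiff ℝ ∞ b := b.contDiff
  have hs : HasCompactSupport b := b.hasCompactSupport
  have hχ1 : ContDiff ℝ ∞ (deriv b) := hχ.deriv'
  have hχ2 : ContDiff ℝ ∞ (deriv (deriv b)) := hχ1.deriv'
  have hd1 : ∀ u, HasDerivAt b (deriv b u) u := fun u =>
    (hχ.differentiable (by simp) u).hasDerivAt
  have hd2 : ∀ u, HasDerivAt (deriv b) (deriv (deriv b) u) u := fun u =>
    (hχ1.differentiable (by simp) u).hasDerivAt
  obtain ⟨C0, hC0⟩ := hχ.continuous.bounded_above_of_compact_support hs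
  obtain ⟨C1, hC1⟩ := hχ1.continuous.bounded_above_of_compact_support hs.deriv
  obtain ⟨C2, hC2⟩ := hχ2.continuous.bounded_above_of_compact_support hs.deriv.deriv
  obtain ⟨C3, hC3⟩ := (continuous_id.mul hχ1.continuous).bounded_above_of_compact_support
    (hs.deriv.mul_left (f := id))
  have hb0 : b 0 = 1 := b.one_of_mem_closedBall (Metric.mem_closedBall_self b.rIn_pos.le)
  -- the cutoff `b (m v)` tends to `1` as `m → 0`; its commutator with the adjoint operator is
  -- bounded because `v` only appears in the combination `m v b'(m v)`
  let m : ℕ → ℝ := fun n => 1 / ((n : ℝ) + 1)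
  have hm0 : ∀ n, 0 < m n := fun n => by positivity
  have hm1 : ∀ n, m n ≤ 1 := fun n => by
    rw [div_le_one (by positivity)]; linarith [n.cast_nonneg (α := ℝ)]
  have hmlim : Tendsto m atTop (𝓝 0) := tendsto_one_div_add_atTop_nhds_zero_nat
  have hfi : Integrable f phaseMeasure := (Lp.memLp f).integrable (by norm_num)
  have hhi : Integrable h phaseMeasure := (Lp.memLp h).integrable (by norm_num)
  have hlim : ∀ (p : Torus × ℝ) {g : ℝ → ℝ}, Continuous g →
      Tendsto (fun n => g (m n * p.2)) atTop (𝓝 (g 0)) := by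
    intro p g hg
    have := hmlim.mul_const p.2
    rw [zero_mul] at this
    exact (hg.tendsto 0).comp this
  have hL : Tendsto (fun n => ∫ p, h p * (b (m n * p.2) * ch k η θ p) ∂phaseMeasure) atTop
      (𝓝 (∫ p, h p * ch k η θ p ∂phaseMeasure)) := by
    refine tendsto_integral_of_dominated_convergence (fun p => C0 * |h p|) (fun n => ?_)
      (hhi.abs.const_mul C0) (fun n => ae_of_all _ fun p => ?_) (ae_of_all _ fun p => ?_)
    · exact hhi.aestronglyMeasurable.mul
        (isTestFunction_cutoff hχ hs (hm0 n) k η θ).continuous.aestronglyMeasurable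
    · rw [norm_mul, norm_mul, mul_comm]
      refine mul_le_mul_of_nonneg_right ?_ (norm_nonneg _)
      have := mul_le_mul (hC0 (m n * p.2)) (abs_ch_le k η θ p) (abs_nonneg _)
        ((norm_nonneg _).trans (hC0 0))
      rwa [mul_one] at this
    · have := ((hlim p hχ.continuous).mul_const (ch k η θ p)).const_mul (h p)
      rwa [hb0, one_mul] at this
  have hR : Tendsto (fun n => ∫ p, f p * fpAdjoint (fun p => b (m n * p.2) * ch k η θ p) p
      ∂phaseMeasure) atTop (𝓝 (∫ p, f p * fpCh (-1) k η θ p ∂phaseMeasure)) := by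
    have hfv : Integrable (fun p => f p * p.2) phaseMeasure :=
      (Lp.memLp f).integrable_mul memLp_snd
    refine tendsto_integral_of_dominated_convergence
      (fun p => (C0 * η ^ 2 + C2 + C3 + 2 * C1 * |η|) * |f p| +
        (C0 * |η + -1 * freq k|) * |f p * p.2|) (fun n => ?_)
      ((hfi.abs.const_mul _).add (hfv.abs.const_mul _))
      (fun n => ae_of_all _ fun p => ?_) (ae_of_all _ fun p => ?_)
    · exact hfi.aestronglyMeasurable.mul
        (isTestFunction_cutoff hχ hs (hm0 n) k η θ).fpAdjoint.continuous.aestronglyMeasurable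
    · rw [fpAdjoint_cutoff hd1 hd2]
      have c1 := abs_ch_le k η θ p
      have c2 := abs_ch_le k η (θ + Real.pi / 2) p
      have b0 := hC0 (m n * p.2)
      have b1 := hC1 (m n * p.2)
      have b2 := hC2 (m n * p.2)
      have b3 := hC3 (m n * p.2)
      simp only [Real.norm_eq_abs, Pi.mul_apply, id] at b0 b1 b2 b3
      have p0 : 0 ≤ C0 := (abs_nonneg _).trans b0
      have p1 : 0 ≤ C1 := (abs_nonneg _).trans b1
      have a1 : |b (m n * p.2) * fpCh (-1) k η θ p| ≤
          C0 * (η ^ 2 + |η + -1 * freq k| * |p.2|) := by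
        rw [abs_mul]
        refine mul_le_mul b0 ((abs_add_le _ _).trans (add_le_add ?_ ?_)) (abs_nonneg _) p0
        · rw [abs_mul, abs_of_nonneg (sq_nonneg η)]
          exact mul_le_of_le_one_right (sq_nonneg η) c1
        · rw [abs_mul, abs_mul]
          exact mul_le_mul_of_nonneg_left (mul_le_of_le_one_right (abs_nonneg _) c2)
            (abs_nonneg _)
      have a2 : |(-(m n ^ 2 * deriv (deriv b) (m n * p.2)) + m n * p.2 * deriv b (m n * p.2)) *
          ch k η θ p| ≤ C2 + C3 := by
        rw [abs_mul]
        refine (mul_le_of_le_one_right (abs_nonneg _) c1).trans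
          ((abs_add_le _ _).trans (add_le_add ?_ b3))
        rw [abs_neg, abs_mul, abs_of_nonneg (sq_nonneg (m n))]
        exact (mul_le_of_le_one_left (abs_nonneg _)
          (pow_le_one₀ (hm0 n).le (hm1 n))).trans b2
      have a3 : |2 * m n * deriv b (m n * p.2) * η * ch k η (θ + Real.pi / 2) p| ≤
          2 * C1 * |η| := by
        rw [abs_mul, abs_mul, abs_mul, abs_mul, abs_of_pos (hm0 n), abs_two]
        refine (mul_le_of_le_one_right (by positivity) c2).trans
          (mul_le_mul_of_nonneg_right ?_ (abs_nonneg _))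
        rw [mul_assoc]
        refine mul_le_mul_of_nonneg_left ?_ zero_le_two
        exact (mul_le_of_le_one_left (abs_nonneg _) (hm1 n)).trans b1
      rw [norm_mul, Real.norm_eq_abs, Real.norm_eq_abs]
      refine (mul_le_mul_of_nonneg_left ((abs_sub _ _).trans (add_le_add
        ((abs_add_le _ _).trans (add_le_add a1 a2)) a3)) (abs_nonneg _)).trans (le_of_eq ?_)
      rw [abs_mul]
      ring
    · have l0 := hlim p hχ.continuous
      have l1 := hlim p hχ1.continuous
      have l2 := hlim p hχ2.continuous
      have l3 := hlim p continuous_id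
      rw [hb0] at l0
      simp only [id] at l3
      have := (((l0.mul_const (fpCh (-1) k η θ p)).add
        ((((hmlim.pow 2).mul l2).neg.add (l3.mul l1)).mul_const (ch k η θ p))).sub
        ((((hmlim.const_mul 2).mul l1).mul_const η).mul_const
          (ch k η (θ + Real.pi / 2) p))).const_mul (f p)
      convert! this using 2
      · rw [fpAdjoint_cutoff hd1 hd2]
      · ring
  rw [VPFP.inner_chL]
  refine tendsto_nhds_unique hL (hR.congr fun n => ?_)
  exact (hf _ (isTestFunction_cutoff hχ hs (hm0 n) k η θ)).symm

lemma isFPSemigroup_semi : IsFPSemigroup (semi 1) where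
  semigroup := isC0Semigroup_semi (by norm_num)
  generator f h := ⟨hasFP_of_hasGenerator, fun hf =>
    hasGenerator_of_weak (by norm_num) fun k η θ => hf.inner_chL k η θ⟩

lemma isFPDvStar_semiDvStar : IsFPDvStar (semi 1) semiDvStar := by
  intro t ht φ hφ g h hg hh
  refine eq_of_inner_chL fun k η θ => ?_
  have h1 : ∀ η θ, inner ℝ g (chL k η θ) = ∫ p, φ p * ch k η θ p ∂phaseMeasure := by
    intro η θ
    rw [inner_chL]
    refine integral_congr_ae ?_
    filter_upwards [hg] with p hp
    rw [hp]
  have h2 : ∀ η θ, inner ℝ h (chL k η θ) = ∫ p, dvStar φ p * ch k η θ p ∂phaseMeasure := by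
    intro η θ
    rw [inner_chL]
    refine integral_congr_ae ?_
    filter_upwards [hh] with p hp
    rw [hp]
  rw [inner_semiDvStar_left, dvSemi_chL ht, inner_semi_left, semi_chL (by norm_num),
    inner_smul_right, inner_smul_right, h1, h2, integral_dvStar_mul_ch hφ]
  ring

/-! ### Quadratic Duhamel equations with a weakly singular kernel -/

/-- The weakly singular kernel `τ^{-1/2} e^{-λτ}`. -/
def sker (lam τ : ℝ) : ℝ := (Real.sqrt τ)⁻¹ * Real.exp (-(lam * τ))

lemma sker_nonneg (lam τ : ℝ) : 0 ≤ sker lam τ := by unfold sker; positivity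

lemma sker_eq_rpow (lam : ℝ) {τ : ℝ} (hτ : 0 < τ) :
    sker lam τ = τ ^ ((1 / 2 : ℝ) - 1) * Real.exp (-(lam * τ)) := by
  rw [sker, Real.sqrt_eq_rpow, ← Real.rpow_neg hτ.le]
  norm_num

lemma integral_sker {lam : ℝ} (hl : 0 < lam) :
    ∫ τ in Set.Ioi 0, sker lam τ = Real.sqrt (Real.pi / lam) := by
  rw [setIntegral_congr_fun measurableSet_Ioi fun τ hτ => sker_eq_rpow lam hτ,
    Real.integral_rpow_mul_exp_neg_mul_Ioi (by norm_num) hl, Real.Gamma_one_half_eq,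
    ← Real.sqrt_eq_rpow, ← Real.sqrt_mul (by positivity)]
  congr 1; ring

lemma integrableOn_sker {lam : ℝ} (hl : 0 < lam) : IntegrableOn (sker lam) (Set.Ioi 0) := by
  by_contra h
  have h1 := integral_undef h
  rw [integral_sker hl] at h1
  have : 0 < Real.sqrt (Real.pi / lam) := Real.sqrt_pos.2 (by positivity)
  linarith

section Duhamel

variable {H : Type*} [NormedAddCommGroup H]

/-- A family of locally Lipschitz maps `n τ`, `τ > 0`, vanishing at `0` and of quadratic growth,
with Lipschitz constants bounded by the kernel `τ^{-1/2} e^{-τ/2}`. -/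
structure QuadraticKernel (A : ℝ) (n : ℝ≥0 → H → H) : Prop where
  nonneg : 0 ≤ A
  map_zero : ∀ τ, 0 < τ → n τ 0 = 0
  norm_sub_le : ∀ τ : ℝ≥0, 0 < τ → ∀ f g : H,
    ‖n τ f - n τ g‖ ≤ A * sker (1 / 2) τ * ((‖f‖ + ‖g‖) * ‖f - g‖)
  continuousOn : ContinuousOn (fun y : ℝ≥0 × H => n y.1 y.2) {y | 0 < y.1}

namespace QuadraticKernel

variable {A : ℝ} {n : ℝ≥0 → H → H}

/-- The Duhamel integrand at time `t`, as a function of the elapsed time `τ ∈ (0, ∞)`, extended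
by zero to `τ ≥ t`. -/
def integrand (n : ℝ≥0 → H → H) (f : ℝ≥0 → H) (t : ℝ≥0) : ℝ → H :=
  Set.indicator (Set.Iio (t : ℝ)) fun τ => n τ.toNNReal (f (t - τ.toNNReal))

lemma integrand_of_lt (n : ℝ≥0 → H → H) (f : ℝ≥0 → H) {t : ℝ≥0} {τ : ℝ} (h : τ < t) :
    integrand n f t τ = n τ.toNNReal (f (t - τ.toNNReal)) :=
  Set.indicator_of_mem (s := Set.Iio (t : ℝ)) h _

lemma integrand_of_le (n : ℝ≥0 → H → H) (f : ℝ≥0 → H) {t : ℝ≥0} {τ : ℝ} (h : t ≤ τ) :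
    integrand n f t τ = 0 :=
  Set.indicator_of_notMem (s := Set.Iio (t : ℝ)) (not_lt.2 h) _

lemma aestronglyMeasurable_integrand (hn : QuadraticKernel A n) {f : ℝ≥0 → H}
    (hf : Continuous f) (t : ℝ≥0) :
    AEStronglyMeasurable (integrand n f t) (volume.restrict (Set.Ioi 0)) := by
  refine (aestronglyMeasurable_indicator_iff measurableSet_Iio).2 ?_
  rw [Measure.restrict_restrict measurableSet_Iio]
  refine ContinuousOn.aestronglyMeasurable ?_ (measurableSet_Iio.inter measurableSet_Ioi)
  refine hn.continuousOn.comp (f := fun τ : ℝ => (τ.toNNReal, f (t - τ.toNNReal))) ?_ ?_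
  · have : Continuous fun τ : ℝ => (τ.toNNReal, f (t - τ.toNNReal)) :=
      continuous_real_toNNReal.prodMk
        (hf.comp (continuous_const.sub continuous_real_toNNReal))
    exact this.continuousOn
  · intro τ hτ
    exact Real.toNNReal_pos.2 hτ.2

lemma norm_integrand_sub_le (hn : QuadraticKernel A n) {f g : ℝ≥0 → H} {W μ : ℝ} {t : ℝ≥0}
    (hW : ∀ s ≤ t, (‖f s‖ + ‖g s‖) * ‖f s - g s‖ ≤ W * Real.exp (μ * s)) {τ : ℝ} (hτ : 0 < τ) :
    ‖integrand n f t τ - integrand n g t τ‖ ≤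
      A * W * Real.exp (μ * t) * sker (1 / 2 + μ) τ := by
  have hW0 : 0 ≤ W := by
    have h := hW t le_rfl
    have h0 : 0 ≤ (‖f t‖ + ‖g t‖) * ‖f t - g t‖ := by positivity
    exact nonneg_of_mul_nonneg_left (h0.trans h) (Real.exp_pos _)
  rcases lt_or_ge τ t with h | h
  · rw [integrand_of_lt n f h, integrand_of_lt n g h]
    refine (hn.norm_sub_le _ (Real.toNNReal_pos.2 hτ) _ _).trans ?_
    have hk : A * sker (1 / 2) (τ.toNNReal) ≥ 0 := mul_nonneg hn.nonneg (sker_nonneg _ _)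
    refine (mul_le_mul_of_nonneg_left (hW _ tsub_le_self) hk).trans (le_of_eq ?_)
    have hle : τ.toNNReal ≤ t := Real.toNNReal_le_iff_le_coe.2 h.le
    rw [NNReal.coe_sub hle, Real.coe_toNNReal _ hτ.le, sker, sker]
    have e : Real.exp (-(1 / 2 * τ)) * Real.exp (μ * (t - τ)) =
        Real.exp (μ * t) * Real.exp (-((1 / 2 + μ) * τ)) := by
      rw [← Real.exp_add, ← Real.exp_add]; congr 1; ring
    linear_combination (A * W * (Real.sqrt τ)⁻¹) * e
  · rw [integrand_of_le n f h, integrand_of_le n g h, sub_zero, norm_zero]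
    exact mul_nonneg (mul_nonneg (mul_nonneg hn.nonneg hW0) (Real.exp_pos _).le) (sker_nonneg _ _)

lemma norm_integrand_le (hn : QuadraticKernel A n) {f : ℝ≥0 → H} {W μ : ℝ} {t : ℝ≥0}
    (hW : ∀ s ≤ t, ‖f s‖ ^ 2 ≤ W * Real.exp (μ * s)) {τ : ℝ} (hτ : 0 < τ) :
    ‖integrand n f t τ‖ ≤ A * W * Real.exp (μ * t) * sker (1 / 2 + μ) τ := by
  have h := hn.norm_integrand_sub_le (f := f) (g := 0) (W := W) (μ := μ) (t := t)
    (fun s hs => by simpa [sq] using hW s hs) hτ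
  have h0 : integrand n (0 : ℝ≥0 → H) t τ = 0 := by
    rcases lt_or_ge τ t with h | h
    · rw [integrand_of_lt n _ h, Pi.zero_apply, hn.map_zero _ (Real.toNNReal_pos.2 hτ)]
    · exact integrand_of_le n _ h
  rwa [h0, sub_zero] at h

lemma exists_bound_of_continuous {f : ℝ≥0 → H} (hf : Continuous f) (T : ℝ≥0) :
    ∃ R, 0 ≤ R ∧ ∀ s ≤ T, ‖f s‖ ≤ R := by
  obtain ⟨R, hR⟩ := (isCompact_Icc (a := (0 : ℝ≥0)) (b := T)).exists_bound_of_continuousOn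
    hf.continuousOn
  exact ⟨R, (norm_nonneg _).trans (hR 0 ⟨le_rfl, zero_le⟩), fun s hs => hR s ⟨zero_le, hs⟩⟩

lemma integrable_integrand (hn : QuadraticKernel A n) {f : ℝ≥0 → H} (hf : Continuous f) (t : ℝ≥0) :
    Integrable (integrand n f t) (volume.restrict (Set.Ioi 0)) := by
  obtain ⟨R, hR0, hR⟩ := exists_bound_of_continuous hf t
  refine Integrable.mono' ((integrableOn_sker (by norm_num : (0 : ℝ) < 1 / 2 + 0)).const_mul
    (A * R ^ 2 * Real.exp (0 * t))) (hn.aestronglyMeasurable_integrand hf t) ?_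
  filter_upwards [ae_restrict_mem measurableSet_Ioi] with τ hτ
  refine hn.norm_integrand_le (fun s hs => ?_) hτ
  rw [zero_mul, Real.exp_zero, mul_one]
  exact pow_le_pow_left₀ (norm_nonneg _) (hR s hs) 2

lemma integrand_sub_eqOn (n : ℝ≥0 → H → H) (f : ℝ≥0 → H) (t : ℝ≥0) {s : ℝ}
    (hs : s ∈ Set.Ioc 0 (t : ℝ)) :
    integrand n f t (t - s) = n (t - s.toNNReal) (f s.toNNReal) := by
  rw [integrand_of_lt n f (by linarith [hs.1])]
  have h1 : (t - s : ℝ).toNNReal = t - s.toNNReal := by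
    rw [NNReal.sub_def, Real.coe_toNNReal _ hs.1.le]
  have h2 : s.toNNReal ≤ t := Real.toNNReal_le_iff_le_coe.2 hs.2
  rw [h1, tsub_tsub_cancel_of_le h2]

lemma intervalIntegrable (hn : QuadraticKernel A n) {f : ℝ≥0 → H} (hf : Continuous f) (t : ℝ≥0) :
    IntervalIntegrable (fun s : ℝ => n (t - s.toNNReal) (f s.toNNReal)) volume 0 t := by
  have h1 : IntervalIntegrable (integrand n f t) volume 0 t := by
    rw [intervalIntegrable_iff_integrableOn_Ioc_of_le t.coe_nonneg]
    exact IntegrableOn.mono_set (hn.integrable_integrand hf t) fun τ hτ => hτ.1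
  have h2 := (h1.comp_sub_left (t : ℝ)).symm
  rw [sub_self, sub_zero] at h2
  refine h2.congr ?_
  intro s hs
  rw [Set.uIoc_of_le t.coe_nonneg] at hs
  exact integrand_sub_eqOn n f t hs

variable [NormedSpace ℝ H]

/-- The Duhamel integral at time `t`, in terms of the elapsed time. -/
def duhamel (n : ℝ≥0 → H → H) (f : ℝ≥0 → H) (t : ℝ≥0) : H :=
  ∫ τ in Set.Ioi 0, integrand n f t τ

lemma norm_duhamel_sub_le (hn : QuadraticKernel A n)
    {f g : ℝ≥0 → H} (hf : Continuous f) (hg : Continuous g) {W μ : ℝ}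
    (hμ : 0 < 1 / 2 + μ) {t : ℝ≥0}
    (hW : ∀ s ≤ t, (‖f s‖ + ‖g s‖) * ‖f s - g s‖ ≤ W * Real.exp (μ * s)) :
    ‖duhamel n f t - duhamel n g t‖ ≤
      A * W * Real.exp (μ * t) * Real.sqrt (Real.pi / (1 / 2 + μ)) := by
  rw [duhamel, duhamel, ← integral_sub (hn.integrable_integrand hf t)
    (hn.integrable_integrand hg t), ← integral_sker hμ, ← integral_const_mul]
  refine norm_integral_le_of_norm_le ((integrableOn_sker hμ).const_mul _) ?_
  filter_upwards [ae_restrict_mem measurableSet_Ioi] with τ hτ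
  exact hn.norm_integrand_sub_le hW hτ

lemma norm_duhamel_le (hn : QuadraticKernel A n) {f : ℝ≥0 → H} {W μ : ℝ}
    (hμ : 0 < 1 / 2 + μ) {t : ℝ≥0} (hW : ∀ s ≤ t, ‖f s‖ ^ 2 ≤ W * Real.exp (μ * s)) :
    ‖duhamel n f t‖ ≤ A * W * Real.exp (μ * t) * Real.sqrt (Real.pi / (1 / 2 + μ)) := by
  rw [duhamel, ← integral_sker hμ, ← integral_const_mul]
  refine norm_integral_le_of_norm_le ((integrableOn_sker hμ).const_mul _) ?_
  filter_upwards [ae_restrict_mem measurableSet_Ioi] with τ hτ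
  exact hn.norm_integrand_le hW hτ

lemma continuous_duhamel (hn : QuadraticKernel A n)
    {f : ℝ≥0 → H} (hf : Continuous f) : Continuous (duhamel n f) := by
  refine continuous_iff_continuousAt.2 fun t₀ => ?_
  obtain ⟨R, hR0, hR⟩ := exists_bound_of_continuous hf (t₀ + 1)
  have hev : ∀ᶠ t in 𝓝 t₀, t < t₀ + 1 := Iio_mem_nhds (by simp)
  refine continuousAt_of_dominated
    (bound := fun τ => A * R ^ 2 * Real.exp (0 * (t₀ : ℝ)) * sker (1 / 2 + 0) τ)
    (Eventually.of_forall fun t => hn.aestronglyMeasurable_integrand hf t) ?_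
    ((integrableOn_sker (by norm_num)).const_mul _) ?_
  · filter_upwards [hev] with t ht
    filter_upwards [ae_restrict_mem measurableSet_Ioi] with τ hτ
    have h := hn.norm_integrand_le (f := f) (W := R ^ 2) (μ := 0) (t := t) (fun s hs => ?_) hτ
    · simpa using h
    · rw [zero_mul, Real.exp_zero, mul_one]
      exact pow_le_pow_left₀ (norm_nonneg _) (hR s (hs.trans ht.le)) 2
  -- for fixed `τ` the integrand is continuous in `t` except at `t = τ`
  · have hne : ∀ᵐ τ : ℝ ∂(volume.restrict (Set.Ioi (0 : ℝ))), τ ≠ (t₀ : ℝ) :=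
      ae_restrict_of_ae (Measure.ae_ne volume (t₀ : ℝ))
    filter_upwards [ae_restrict_mem measurableSet_Ioi, hne] with τ hτ hτt
    rcases lt_or_gt_of_ne hτt with h | h
    · have h1 : ∀ᶠ t : ℝ≥0 in 𝓝 t₀, τ < t :=
        NNReal.continuous_coe.continuousAt.eventually (lt_mem_nhds h)
      have h2 : ContinuousAt (fun t : ℝ≥0 => n τ.toNNReal (f (t - τ.toNNReal))) t₀ := by
        have h3 : ContinuousAt (fun y : ℝ≥0 × H => n y.1 y.2)
            (τ.toNNReal, f (t₀ - τ.toNNReal)) :=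
          hn.continuousOn.continuousAt ((isOpen_lt continuous_const continuous_fst).mem_nhds
            (Real.toNNReal_pos.2 hτ))
        have h4 : Continuous fun t : ℝ≥0 => (τ.toNNReal, f (t - τ.toNNReal)) :=
          continuous_const.prodMk (hf.comp (continuous_id.sub continuous_const))
        exact ContinuousAt.comp (f := fun t : ℝ≥0 => (τ.toNNReal, f (t - τ.toNNReal))) h3
          h4.continuousAt
      refine h2.congr ?_
      filter_upwards [h1] with t ht
      exact (integrand_of_lt n f ht).symm
    · have h1 : ∀ᶠ t : ℝ≥0 in 𝓝 t₀, (t : ℝ) < τ :=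
        NNReal.continuous_coe.continuousAt.eventually (gt_mem_nhds h)
      refine (continuousAt_const (y := (0 : H))).congr ?_
      filter_upwards [h1] with t ht
      exact (integrand_of_le n f ht.le).symm

/-- The Duhamel integral in terms of the starting time. -/
lemma duhamel_eq (n : ℝ≥0 → H → H) (f : ℝ≥0 → H) (t : ℝ≥0) :
    duhamel n f t = ∫ s in (0 : ℝ)..t, n (t - s.toNNReal) (f s.toNNReal) := by
  have h1 : duhamel n f t = ∫ τ in (0 : ℝ)..t, integrand n f t τ := by
    rw [duhamel, intervalIntegral.integral_of_le t.coe_nonneg]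
    refine setIntegral_eq_of_subset_of_forall_sdiff_eq_zero measurableSet_Ioi
      (fun τ hτ => hτ.1) (fun τ hτ => ?_)
    refine integrand_of_le n f (le_of_lt ?_)
    by_contra! h
    exact hτ.2 ⟨hτ.1, h⟩
  have h2 := intervalIntegral.integral_comp_sub_left (a := 0) (b := (t : ℝ))
    (integrand n f t) (t : ℝ)
  rw [sub_self, sub_zero] at h2
  rw [h1, ← h2]
  refine intervalIntegral.integral_congr_ae (ae_of_all _ fun s hs => ?_)
  rw [Set.uIoc_of_le t.coe_nonneg] at hs
  exact integrand_sub_eqOn n f t hs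

/-- Uniqueness of continuous solutions, from a Gronwall argument in the weighted supremum norm
`sup e^{-λs} ‖·‖` with `λ` large. -/
theorem unique (hn : QuadraticKernel A n) {U f g : ℝ≥0 → H} (hf : Continuous f)
    (hg : Continuous g) (hfe : ∀ t, f t = U t + duhamel n f t)
    (hge : ∀ t, g t = U t + duhamel n g t) : f = g := by
  ext T
  obtain ⟨R₁, h10, h1⟩ := exists_bound_of_continuous hf T
  obtain ⟨R₂, h20, h2⟩ := exists_bound_of_continuous hg T
  set a : ℝ := A * (R₁ + R₂) with ha
  have ha0 : 0 ≤ a := mul_nonneg hn.nonneg (add_nonneg h10 h20)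
  -- the choice of `lam` makes the Duhamel map a strict contraction in the weighted norm
  set lam : ℝ := Real.pi * (2 * a + 1) ^ 2 with hlam
  have hlam0 : 0 < lam := by positivity
  have hsmall : a * Real.sqrt (Real.pi / (1 / 2 + lam)) ≤ 1 / 2 := by
    have hs : Real.sqrt (Real.pi / (1 / 2 + lam)) ≤ 1 / (2 * a + 1) := by
      refine Real.sqrt_le_iff.2 ⟨by positivity, ?_⟩
      rw [div_pow, one_pow, div_le_div_iff₀ (by positivity) (by positivity)]
      linarith
    calc _ ≤ a * (1 / (2 * a + 1)) := mul_le_mul_of_nonneg_left hs ha0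
      _ ≤ 1 / 2 := by
        rw [mul_one_div, div_le_div_iff₀ (by positivity) two_pos]; linarith
  have hcont : Continuous fun s : ℝ≥0 => Real.exp (-(lam * s)) * ‖f s - g s‖ := by fun_prop
  obtain ⟨t, ht, hmax⟩ := (isCompact_Icc (a := (0 : ℝ≥0)) (b := T)).exists_isMaxOn
    ⟨T, zero_le, le_rfl⟩ hcont.continuousOn
  set D : ℝ := Real.exp (-(lam * t)) * ‖f t - g t‖ with hD
  have hDs : ∀ s ≤ T, ‖f s - g s‖ ≤ D * Real.exp (lam * s) := by
    intro s hs
    have h := hmax (show s ∈ Set.Icc 0 T from ⟨zero_le, hs⟩)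
    have h' : Real.exp (-(lam * s)) * ‖f s - g s‖ ≤ D := h
    rw [Real.exp_neg, inv_mul_le_iff₀ (Real.exp_pos _)] at h'
    linarith
  have hD0 : 0 ≤ D := by positivity
  have key := hn.norm_duhamel_sub_le hf hg (W := (R₁ + R₂) * D) (μ := lam) (t := t)
    (by positivity) (fun s hs => by
      rw [mul_assoc]
      exact mul_le_mul (add_le_add (h1 s (hs.trans ht.2)) (h2 s (hs.trans ht.2)))
        (hDs s (hs.trans ht.2)) (norm_nonneg _) (add_nonneg h10 h20))
  have hft : duhamel n f t - duhamel n g t = f t - g t := by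
    rw [hfe t, hge t, add_sub_add_left_eq_sub]
  rw [hft] at key
  have hDle : D ≤ 1 / 2 * D := by
    rw [hD, Real.exp_neg, inv_mul_le_iff₀ (Real.exp_pos _), ← Real.exp_neg, ← hD]
    calc ‖f t - g t‖ ≤ Real.exp (lam * t) * ((a * Real.sqrt (Real.pi / (1 / 2 + lam))) * D) := by
          refine key.trans (le_of_eq ?_)
          rw [ha]; ring
      _ ≤ _ := by gcongr
  have hD1 : D = 0 := by linarith
  have := hDs T le_rfl
  rw [hD1, zero_mul] at this
  exact sub_eq_zero.1 (norm_le_zero_iff.1 this)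

/-- Existence of a decaying solution for small data, by the contraction principle in the space of
functions `e^{-t/4} F(t)` with `F` bounded and continuous. -/
theorem exists_solution [CompleteSpace H] (hn : QuadraticKernel A n) {U : ℝ≥0 → H}
    (hU : Continuous U) {r : ℝ} (hr : 0 ≤ r)
    (hrA : 2 * r * (A * Real.sqrt (4 * Real.pi)) ≤ 1 / 2)
    (hUr : ∀ t : ℝ≥0, ‖U t‖ ≤ r / 2 * Real.exp (-(1 / 4) * t)) :
    ∃ f : C(ℝ≥0, H), (∀ t, f t = U t + duhamel n f t) ∧
      ∀ t : ℝ≥0, ‖f t‖ ≤ r * Real.exp (-(1 / 4) * t) := by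
  have hJ : Real.pi / (1 / 2 + -(1 / 4)) = 4 * Real.pi := by ring
  have hμ : (0 : ℝ) < 1 / 2 + -(1 / 4) := by norm_num
  have hexp : ∀ s : ℝ≥0, Real.exp (-(1 / 4) * s) * Real.exp (-(1 / 4) * s) ≤
      Real.exp (-(1 / 4) * s) := fun s =>
    mul_le_of_le_one_right (Real.exp_pos _).le (Real.exp_le_one_iff.2 (by nlinarith [s.coe_nonneg]))
  have hcancel : ∀ t : ℝ≥0, Real.exp (1 / 4 * t) * Real.exp (-(1 / 4) * t) = 1 := fun t => by
    rw [← Real.exp_add]; simp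
  -- the unweighted function
  let w : BoundedContinuousFunction ℝ≥0 H → ℝ≥0 → H := fun F s => Real.exp (-(1 / 4) * s) • F s
  have hw : ∀ F, Continuous (w F) := fun F =>
    (by fun_prop : Continuous fun s : ℝ≥0 => Real.exp (-(1 / 4) * s)).smul F.continuous
  have hwn : ∀ F s, ‖w F s‖ = Real.exp (-(1 / 4) * s) * ‖F s‖ := fun F s => by
    rw [norm_smul, Real.norm_eq_abs, Real.abs_exp]
  have hquad : ∀ F s, ‖w F s‖ ^ 2 ≤ ‖F‖ ^ 2 * Real.exp (-(1 / 4) * s) := fun F s => by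
    rw [hwn, mul_pow, mul_comm, sq (Real.exp _)]
    exact mul_le_mul (pow_le_pow_left₀ (norm_nonneg _) (F.norm_coe_le_norm s) 2) (hexp s)
      (by positivity) (by positivity)
  have hDn : ∀ F t, ‖duhamel n (w F) t‖ ≤
      A * ‖F‖ ^ 2 * Real.exp (-(1 / 4) * t) * Real.sqrt (4 * Real.pi) := fun F t => by
    have := hn.norm_duhamel_le hμ (t := t) (fun s _ => hquad F s)
    rwa [hJ] at this
  let Tfun : BoundedContinuousFunction ℝ≥0 H → ℝ≥0 → H := fun F t =>
    Real.exp (1 / 4 * t) • (U t + duhamel n (w F) t)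
  have hTn : ∀ F t, ‖Tfun F t‖ ≤ r / 2 + A * ‖F‖ ^ 2 * Real.sqrt (4 * Real.pi) := fun F t => by
    rw [norm_smul, Real.norm_eq_abs, Real.abs_exp]
    calc _ ≤ Real.exp (1 / 4 * t) * (r / 2 * Real.exp (-(1 / 4) * t) +
          A * ‖F‖ ^ 2 * Real.exp (-(1 / 4) * t) * Real.sqrt (4 * Real.pi)) := by
          refine mul_le_mul_of_nonneg_left ((norm_add_le _ _).trans ?_) (Real.exp_pos _).le
          exact add_le_add (hUr t) (hDn F t)
      _ = (Real.exp (1 / 4 * t) * Real.exp (-(1 / 4) * t)) *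
          (r / 2 + A * ‖F‖ ^ 2 * Real.sqrt (4 * Real.pi)) := by ring
      _ = _ := by rw [hcancel, one_mul]
  have hTc : ∀ F, Continuous (Tfun F) := fun F =>
    (by fun_prop : Continuous fun s : ℝ≥0 => Real.exp (1 / 4 * s)).smul
      (hU.add (hn.continuous_duhamel (hw F)))
  let T : BoundedContinuousFunction ℝ≥0 H → BoundedContinuousFunction ℝ≥0 H := fun F =>
    BoundedContinuousFunction.ofNormedAddCommGroup (Tfun F) (hTc F) _ (hTn F)
  have hTapp : ∀ F t, T F t = Tfun F t := fun F t => rfl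
  have hAJ : 0 ≤ A * Real.sqrt (4 * Real.pi) := mul_nonneg hn.nonneg (Real.sqrt_nonneg _)
  have hmaps : Set.MapsTo T (Metric.closedBall 0 r) (Metric.closedBall 0 r) := by
    intro F hF
    rw [mem_closedBall_zero_iff] at hF ⊢
    refine (BoundedContinuousFunction.norm_le hr).2 fun t => (hTn F t).trans ?_
    have h1 : ‖F‖ ^ 2 ≤ r ^ 2 := pow_le_pow_left₀ (norm_nonneg _) hF 2
    nlinarith
  have hlip : ∀ F ∈ Metric.closedBall (0 : BoundedContinuousFunction ℝ≥0 H) r,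
      ∀ G ∈ Metric.closedBall (0 : BoundedContinuousFunction ℝ≥0 H) r,
      dist (T F) (T G) ≤ 1 / 2 * dist F G := by
    intro F hF G hG
    rw [mem_closedBall_zero_iff] at hF hG
    refine (BoundedContinuousFunction.dist_le (by positivity)).2 fun t => ?_
    rw [hTapp, hTapp, dist_eq_norm, ← smul_sub, add_sub_add_left_eq_sub, norm_smul,
      Real.norm_eq_abs, Real.abs_exp]
    have hd : ∀ s ≤ t, (‖w F s‖ + ‖w G s‖) * ‖w F s - w G s‖ ≤
        (2 * r * dist F G) * Real.exp (-(1 / 4) * s) := by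
      intro s _
      have e1 : ‖w F s‖ + ‖w G s‖ ≤ Real.exp (-(1 / 4) * s) * (2 * r) := by
        rw [hwn, hwn, ← mul_add]
        refine mul_le_mul_of_nonneg_left ?_ (Real.exp_pos _).le
        linarith [F.norm_coe_le_norm s, G.norm_coe_le_norm s]
      have e2 : ‖w F s - w G s‖ ≤ Real.exp (-(1 / 4) * s) * dist F G := by
        rw [← smul_sub, norm_smul, Real.norm_eq_abs, Real.abs_exp, ← dist_eq_norm]
        exact mul_le_mul_of_nonneg_left (BoundedContinuousFunction.dist_coe_le_dist s)
          (Real.exp_pos _).le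
      calc _ ≤ (Real.exp (-(1 / 4) * s) * (2 * r)) * (Real.exp (-(1 / 4) * s) * dist F G) :=
            mul_le_mul e1 e2 (norm_nonneg _) (by positivity)
        _ = (2 * r * dist F G) * (Real.exp (-(1 / 4) * s) * Real.exp (-(1 / 4) * s)) := by ring
        _ ≤ _ := mul_le_mul_of_nonneg_left (hexp s) (by positivity)
    have h := hn.norm_duhamel_sub_le (hw F) (hw G) hμ hd
    rw [hJ] at h
    calc _ ≤ Real.exp (1 / 4 * t) * (A * (2 * r * dist F G) * Real.exp (-(1 / 4) * t) *
          Real.sqrt (4 * Real.pi)) := mul_le_mul_of_nonneg_left h (Real.exp_pos _).le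
      _ = (Real.exp (1 / 4 * t) * Real.exp (-(1 / 4) * t)) *
          ((2 * r * (A * Real.sqrt (4 * Real.pi))) * dist F G) := by ring
      _ ≤ _ := by
        rw [hcancel, one_mul]
        exact mul_le_mul_of_nonneg_right hrA dist_nonneg
  have hcontr : ContractingWith (1 / 2) (hmaps.restrict T _ _) := by
    refine ⟨by norm_num, LipschitzWith.of_dist_le_mul fun F G => ?_⟩
    have := hlip F F.2 G G.2
    simpa using! this
  obtain ⟨F, hF, hfix, -⟩ := hcontr.exists_fixedPoint'
    (Metric.isClosed_closedBall.isComplete) hmaps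
    (Metric.mem_closedBall_self hr) (edist_ne_top _ _)
  have hFe : ∀ t, w F t = U t + duhamel n (w F) t := by
    intro t
    have h1 : Tfun F t = F t := by rw [← hTapp, hfix]
    change Real.exp (-(1 / 4) * t) • F t = _
    rw [← h1, smul_smul, mul_comm, hcancel, one_smul]
  refine ⟨⟨w F, hw F⟩, hFe, fun t => ?_⟩
  change ‖w F t‖ ≤ _
  rw [mem_closedBall_zero_iff] at hF
  rw [hwn, mul_comm]
  exact mul_le_mul_of_nonneg_right ((F.norm_coe_le_norm t).trans hF) (Real.exp_pos _).le

end QuadraticKernel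

end Duhamel

/-! ### The field and the Duhamel integrands -/

/-- Multiplication by a bounded field, as a bounded bilinear map. -/
def fieldMulL : LInf →L[ℝ] L2 →L[ℝ] L2 :=
  LinearMap.mkContinuous₂ (LinearMap.mk₂ ℝ fieldMul
    (fun E E' f => by simp only [fieldMul, map_add]; exact Lp.smul_add _ _ _)
    (fun c E f => by
      have : Lp.compMeasurePreserving (Prod.fst : Torus × ℝ → Torus)
          (measurePreserving_fst (μ := (volume : Measure Torus)) (ν := gaussV)) (c • E) =
          c • Lp.compMeasurePreserving (Prod.fst : Torus × ℝ → Torus)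
          (measurePreserving_fst (μ := (volume : Measure Torus)) (ν := gaussV)) E :=
        (Lp.compMeasurePreservingₗ ℝ _ measurePreserving_fst).map_smul c E
      simp only [fieldMul, this]
      exact Lp.smul_assoc _ _ _)
    (fun E f f' => by simp only [fieldMul]; exact Lp.add_smul _ _ _)
    (fun c E f => by simp only [fieldMul]; exact (Lp.smul_comm _ _ _).symm)) 1 (fun E f => by
      rw [one_mul]
      refine (Lp.norm_smul_le _ _).trans ?_
      rw [Lp.norm_compMeasurePreserving])

lemma norm_fieldMulL_le (E : LInf) (f : L2) : ‖fieldMulL E f‖ ≤ ‖E‖ * ‖f‖ := by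
  refine (Lp.norm_smul_le _ _).trans ?_
  rw [Lp.norm_compMeasurePreserving]

lemma continuous_semi_uncurry {ε : ℝ} (hε : ε ^ 2 = 1) :
    Continuous fun y : ℝ≥0 × L2 => semi ε y.1 y.2 := by
  refine continuous_prod_of_continuous_lipschitzWith' _ 1 (fun t => ?_) (continuous_semi hε)
  refine LipschitzWith.of_dist_le_mul fun f g => ?_
  rw [dist_eq_norm, dist_eq_norm, ← map_sub, NNReal.coe_one, one_mul]
  exact norm_semi_le _ _ _

lemma continuousOn_semiDvStar :
    ContinuousOn (fun y : ℝ≥0 × L2 => semiDvStar y.1 y.2) {y | 0 < y.1} := by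
  intro y₀ hy₀
  have ht : 0 < y₀.1 := hy₀
  have hδ : 0 < y₀.1 / 2 := half_pos ht
  have hc : Continuous fun y : ℝ≥0 × L2 =>
      semi 1 (y.1 - y₀.1 / 2) (semiDvStar (y₀.1 / 2) y.2) :=
    (continuous_semi_uncurry (ε := 1) (one_pow 2)).comp
      (f := fun y : ℝ≥0 × L2 => (y.1 - y₀.1 / 2, semiDvStar (y₀.1 / 2) y.2))
      ((continuous_fst.sub continuous_const).prodMk
        ((semiDvStar (y₀.1 / 2)).continuous.comp continuous_snd))
  have h1 : ∀ᶠ y : ℝ≥0 × L2 in 𝓝 y₀, y₀.1 / 2 < y.1 :=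
    continuous_fst.continuousAt.eventually (lt_mem_nhds (NNReal.half_lt_self ht.ne'))
  have h2 : (fun y : ℝ≥0 × L2 => semi 1 (y.1 - y₀.1 / 2) (semiDvStar (y₀.1 / 2) y.2)) =ᶠ[𝓝 y₀]
      fun y => semiDvStar y.1 y.2 := by
    filter_upwards [h1] with y hy
    have h := semiDvStar_add (y.1 - y₀.1 / 2) hδ
    rw [tsub_add_cancel_of_le hy.le] at h
    rw [h, ContinuousLinearMap.comp_apply]
  exact (hc.continuousAt.congr h2).continuousWithinAt

/-- Both Duhamel integrands, as operators bilinear in the field and the perturbation. -/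
lemma exists_bilinear_integrand {N : ℝ≥0 → LInf → L2 → L2}
    (hN : N = fieldInside semiDvStar ∨ N = fieldOutside semiDvStar) :
    ∃ L : ℝ≥0 → LInf →L[ℝ] L2 →L[ℝ] L2, (∀ τ E f, N τ E f = L τ E f) ∧
      (∀ τ, 0 < τ → ∀ E f, ‖L τ E f‖ ≤ smoothConst * sker (1 / 2) τ * (‖E‖ * ‖f‖)) ∧
      ContinuousOn (fun y : ℝ≥0 × LInf × L2 => L y.1 y.2.1 y.2.2) {y | 0 < y.1} := by
  have hB : ∀ τ : ℝ≥0, 0 < τ → ‖semiDvStar τ‖ ≤ smoothConst * sker (1 / 2) τ := by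
    intro τ hτ
    have := norm_semiDvStar_le_exp hτ
    have e : -(τ : ℝ) / 2 = -(1 / 2 * τ) := by ring
    rwa [e] at this
  have hmul : Continuous fun y : LInf × L2 => fieldMulL y.1 y.2 := fieldMulL.continuous₂
  rcases hN with rfl | rfl
  · refine ⟨fun τ => ((ContinuousLinearMap.compL ℝ L2 L2 L2 (semiDvStar τ))).comp fieldMulL,
      fun τ E f => rfl, fun τ hτ E f => ?_, ?_⟩
    · exact (semiDvStar τ).le_of_opNorm_le_of_le (hB τ hτ) (norm_fieldMulL_le E f)
    · refine continuousOn_semiDvStar.comp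
        (f := fun y : ℝ≥0 × LInf × L2 => (y.1, fieldMulL y.2.1 y.2.2)) ?_ fun y hy => hy
      exact (continuous_fst.prodMk (hmul.comp continuous_snd)).continuousOn
  · refine ⟨fun τ => ((ContinuousLinearMap.compL ℝ L2 L2 L2).flip (semiDvStar τ)).comp fieldMulL,
      fun τ E f => rfl, fun τ hτ E f => ?_, ?_⟩
    · refine (norm_fieldMulL_le E (semiDvStar τ f)).trans ?_
      have := (semiDvStar τ).le_of_opNorm_le (hB τ hτ) f
      calc _ ≤ ‖E‖ * (smoothConst * sker (1 / 2) τ * ‖f‖) :=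
            mul_le_mul_of_nonneg_left this (norm_nonneg _)
        _ = _ := by ring
    · refine hmul.comp_continuousOn
        (f := fun y : ℝ≥0 × LInf × L2 => (y.2.1, semiDvStar y.1 y.2.2)) ?_
      refine (by fun_prop : Continuous fun y : ℝ≥0 × LInf × L2 => y.2.1).continuousOn.prodMk ?_
      exact continuousOn_semiDvStar.comp (f := fun y : ℝ≥0 × LInf × L2 => (y.1, y.2.2))
        (by fun_prop) fun y hy => hy

section Field

variable {K : Torus → ℝ} {M : ℝ}

/-- The function `x ↦ ∬ K(x - y) f(y, v) dμ(y) dν(v)`. -/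
def convField (K : Torus → ℝ) (f : L2) (x : Torus) : ℝ := ∫ p, f p * K (x - p.1) ∂phaseMeasure

lemma memLp_translate (hK : Continuous K) (hM : ∀ x, |K x| ≤ M) (x : Torus) :
    MemLp (fun p : Torus × ℝ => K (x - p.1)) 2 phaseMeasure :=
  memLp_of_continuous_of_bounded (by fun_prop) M fun p => hM _

lemma norm_translate_le (hK : Continuous K) (hM : ∀ x, |K x| ≤ M) (x : Torus) :
    ‖(memLp_translate hK hM x).toLp‖ ≤ M := by
  have hM0 : 0 ≤ M := (abs_nonneg _).trans (hM 0)
  have h : ∀ᵐ p ∂phaseMeasure, ‖(memLp_translate hK hM x).toLp _ p‖ ≤ M := by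
    filter_upwards [(memLp_translate hK hM x).coeFn_toLp] with p hp
    rw [hp]
    exact hM _
  have h1 := Lp.norm_le_of_ae_bound hM0 h
  have h2 : measureUnivNNReal phaseMeasure = 1 := by simp [measureUnivNNReal]
  rwa [h2, NNReal.coe_one, Real.one_rpow, one_mul] at h1

lemma integrable_convField (hK : Continuous K) (hM : ∀ x, |K x| ≤ M) (f : L2) (x : Torus) :
    Integrable (fun p => f p * K (x - p.1)) phaseMeasure :=
  (Lp.memLp f).integrable_mul (memLp_translate hK hM x)

lemma abs_convField_le (hK : Continuous K) (hM : ∀ x, |K x| ≤ M) (f : L2) (x : Torus) :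
    |convField K f x| ≤ M * ‖f‖ := by
  rw [convField, ← inner_toLp_left (memLp_translate hK hM x)]
  exact (abs_real_inner_le_norm _ _).trans
    (mul_le_mul_of_nonneg_right (norm_translate_le hK hM x) (norm_nonneg _))

lemma continuous_convField (hK : Continuous K) (hM : ∀ x, |K x| ≤ M) (f : L2) :
    Continuous (convField K f) := by
  have hf : Integrable f phaseMeasure := (Lp.memLp f).integrable (by norm_num)
  refine continuous_of_dominated (bound := fun p => M * |f p|)
    (fun x => (integrable_convField hK hM f x).aestronglyMeasurable)
    (fun x => ae_of_all _ fun p => ?_) (hf.abs.const_mul M) (ae_of_all _ fun p => by fun_prop)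
  rw [norm_mul, mul_comm]
  exact mul_le_mul_of_nonneg_right (hM _) (norm_nonneg _)

lemma convField_eq_convolution (hK : Continuous K) (hM : ∀ x, |K x| ≤ M) (f : L2) (x : Torus) :
    (K ⋆[ContinuousLinearMap.lsmul ℝ ℝ, (volume : Measure Torus)] density f) x =
      convField K f x := by
  rw [convolution_eq_swap, convField, integral_prod _ (integrable_convField hK hM f x)]
  refine integral_congr_ae (ae_of_all _ fun y => ?_)
  simp only [ContinuousLinearMap.lsmul_apply, density, smul_eq_mul]
  rw [integral_mul_const, mul_comm]

lemma memLp_convField (hK : Continuous K) (hM : ∀ x, |K x| ≤ M) (f : L2) :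
    MemLp (convField K f) ∞ (volume : Measure Torus) :=
  memLp_top_of_bound (continuous_convField hK hM f).aestronglyMeasurable (M * ‖f‖)
    (ae_of_all _ (abs_convField_le hK hM f))

/-- The bounded operator `f ↦ K * ∫ f dν` from `L²(dμ dν)` to `L^∞(dx)`. -/
def fieldOp (hK : Continuous K) (hM : ∀ x, |K x| ≤ M) : L2 →L[ℝ] LInf :=
  LinearMap.mkContinuous
    { toFun := fun f => (memLp_convField hK hM f).toLp _
      map_add' := fun f g => by
        rw [← MemLp.toLp_add]
        refine MemLp.toLp_congr _ _ (ae_of_all _ fun x => ?_)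
        rw [Pi.add_apply, convField, convField, convField,
          ← integral_add (integrable_convField hK hM f x) (integrable_convField hK hM g x)]
        refine integral_congr_ae ?_
        filter_upwards [Lp.coeFn_add f g] with p hp
        rw [hp, Pi.add_apply, add_mul]
      map_smul' := fun c f => by
        rw [RingHom.id_apply, ← MemLp.toLp_const_smul]
        refine MemLp.toLp_congr _ _ (ae_of_all _ fun x => ?_)
        rw [Pi.smul_apply, convField, convField, smul_eq_mul, ← integral_const_mul]
        refine integral_congr_ae ?_
        filter_upwards [Lp.coeFn_smul c f] with p hp
        rw [hp, Pi.smul_apply, smul_eq_mul, mul_assoc] } M fun f => by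
      have hM0 : 0 ≤ M := (abs_nonneg _).trans (hM 0)
      have h : ∀ᵐ x ∂(volume : Measure Torus), ‖(memLp_convField hK hM f).toLp _ x‖ ≤ M * ‖f‖ := by
        filter_upwards [(memLp_convField hK hM f).coeFn_toLp] with x hx
        rw [hx]
        exact abs_convField_le hK hM f x
      simpa using Lp.norm_le_of_ae_bound (by positivity) h

lemma norm_fieldOp_le (hK : Continuous K) (hM : ∀ x, |K x| ≤ M) : ‖fieldOp hK hM‖ ≤ M :=
  LinearMap.mkContinuous_norm_le _ ((abs_nonneg _).trans (hM 0)) _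

lemma coeFn_fieldOp (hK : Continuous K) (hM : ∀ x, |K x| ≤ M) (f : L2) :
    fieldOp hK hM f =ᵐ[volume] convField K f := MemLp.coeFn_toLp (memLp_convField hK hM f)

/-- The field equation `±E = K * ∫ f dν` determines `E`. -/
lemma field_equation_iff (hK : Continuous K) (hM : ∀ x, |K x| ≤ M) {σ : ℝ} (hσ : σ * σ = 1)
    (f : L2) (E : LInf) :
    (∀ᵐ x ∂(volume : Measure Torus), σ * E x =
      (K ⋆[ContinuousLinearMap.lsmul ℝ ℝ, (volume : Measure Torus)] density f) x) ↔
    E = σ • fieldOp hK hM f := by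
  simp only [convField_eq_convolution hK hM]
  constructor
  · intro h
    refine Lp.ext ?_
    filter_upwards [h, coeFn_fieldOp hK hM f, Lp.coeFn_smul σ (fieldOp hK hM f)] with x h1 h2 h3
    rw [h3, Pi.smul_apply, h2, ← h1, smul_eq_mul, ← mul_assoc, hσ, one_mul]
  · rintro rfl
    filter_upwards [coeFn_fieldOp hK hM f, Lp.coeFn_smul σ (fieldOp hK hM f)] with x h2 h3
    rw [h3, Pi.smul_apply, h2, smul_eq_mul, ← mul_assoc, hσ, one_mul]

lemma norm_smul_fieldOp_le (hK : Continuous K) (hM : ∀ x, |K x| ≤ M) {σ : ℝ}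
    (hσ : σ = 1 ∨ σ = -1) (f : L2) : ‖σ • fieldOp hK hM f‖ ≤ M * ‖f‖ := by
  have h : ‖σ‖ = 1 := by rcases hσ with rfl | rfl <;> simp
  rw [norm_smul, h, one_mul]
  exact (fieldOp hK hM).le_of_opNorm_le (norm_fieldOp_le hK hM) f

/-- Eliminating the field yields a quadratic Duhamel kernel. -/
lemma quadraticKernel_field (hK : Continuous K) (hM : ∀ x, |K x| ≤ M) {σ : ℝ}
    (hσ : σ = 1 ∨ σ = -1) {N : ℝ≥0 → LInf → L2 → L2}
    (hN : N = fieldInside semiDvStar ∨ N = fieldOutside semiDvStar) :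
    QuadraticKernel (smoothConst * M) fun τ f => N τ (σ • fieldOp hK hM f) f := by
  obtain ⟨L, hL, hb, hc⟩ := exists_bilinear_integrand hN
  have hM0 : 0 ≤ M := (abs_nonneg _).trans (hM 0)
  simp only [hL]
  refine ⟨mul_nonneg smoothConst_pos.le hM0, fun τ _ => by simp, fun τ hτ f g => ?_, ?_⟩
  · have e : L τ (σ • fieldOp hK hM f) f - L τ (σ • fieldOp hK hM g) g =
        L τ (σ • fieldOp hK hM f) (f - g) + L τ (σ • fieldOp hK hM (f - g)) g := by
      simp only [map_sub, smul_sub, sub_apply]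
      abel
    have hk : 0 ≤ smoothConst * sker (1 / 2) τ := mul_nonneg smoothConst_pos.le (sker_nonneg _ _)
    have h1 := norm_smul_fieldOp_le hK hM hσ f
    have h2 := norm_smul_fieldOp_le hK hM hσ (f - g)
    rw [e]
    calc _ ≤ smoothConst * sker (1 / 2) τ * (‖σ • fieldOp hK hM f‖ * ‖f - g‖) +
          smoothConst * sker (1 / 2) τ * (‖σ • fieldOp hK hM (f - g)‖ * ‖g‖) :=
          (norm_add_le _ _).trans (add_le_add (hb τ hτ _ _) (hb τ hτ _ _))
      _ ≤ smoothConst * sker (1 / 2) τ * ((M * ‖f‖) * ‖f - g‖) +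
          smoothConst * sker (1 / 2) τ * ((M * ‖f - g‖) * ‖g‖) := by gcongr
      _ = _ := by ring
  · refine hc.comp (f := fun y : ℝ≥0 × L2 => (y.1, σ • fieldOp hK hM y.2, y.2)) ?_
      fun y hy => hy
    have h1 : Continuous fun y : ℝ≥0 × L2 => σ • fieldOp hK hM y.2 :=
      ((fieldOp hK hM).continuous.comp continuous_snd).const_smul σ
    exact (continuous_fst.prodMk (h1.prodMk continuous_snd)).continuousOn

/-- Mild solutions are the solutions of the quadratic Duhamel equation for `f` alone. -/
lemma isMildSolution_iff (hK : Continuous K) (hM : ∀ x, |K x| ≤ M) {σ : ℝ}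
    (hσ : σ = 1 ∨ σ = -1) {N : ℝ≥0 → LInf → L2 → L2}
    (hN : N = fieldInside semiDvStar ∨ N = fieldOutside semiDvStar) (f₀ : L2)
    (f : C(ℝ≥0, L2)) (E : C(ℝ≥0, LInf)) :
    IsMildSolution (semi 1) N K σ f₀ f E ↔
      (∀ t, f t = semi 1 t f₀ +
        QuadraticKernel.duhamel (fun τ f => N τ (σ • fieldOp hK hM f) f) f t) ∧
      ∀ t, E t = σ • fieldOp hK hM (f t) := by
  have hσσ : σ * σ = 1 := by rcases hσ with rfl | rfl <;> norm_num
  simp only [QuadraticKernel.duhamel_eq]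
  constructor
  · rintro ⟨-, h2, h3⟩
    have hE : ∀ t, E t = σ • fieldOp hK hM (f t) := fun t =>
      (field_equation_iff hK hM hσσ _ _).1 (h3 t)
    refine ⟨fun t => ?_, hE⟩
    rw [h2 t]
    simp only [hE]
  · rintro ⟨h2, hE⟩
    refine ⟨fun t => ?_, fun t => ?_, fun t => (field_equation_iff hK hM hσσ _ _).2 (hE t)⟩
    · simp only [hE]
      exact (quadraticKernel_field hK hM hσ hN).intervalIntegrable f.continuous t
    · simp only [hE]
      exact h2 t

end Field

end VPFP

end

theorem theorem4p3 :
    -- the semigroup `e^{-tP}` and the operators `e^{-tP} (-∂_v + v)`, `t > 0`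
    ∃ S B : ℝ≥0 → VPFP.L2 →L[ℝ] VPFP.L2, VPFP.IsFPSemigroup S ∧ VPFP.IsFPDvStar S B ∧
      ∀ M : ℝ, ∃ ε₀ C₀ κ₀ : ℝ, 0 < ε₀ ∧ 0 < C₀ ∧ 0 < κ₀ ∧
        ∀ K : VPFP.Torus → ℝ, ContDiff ℝ ∞ (fun y : ℝ => K (y : VPFP.Torus)) →
        (∀ x, |K x| ≤ M) →
        ∀ σ : ℝ, (σ = 1 ∨ σ = -1) →
        ∀ N : ℝ≥0 → VPFP.LInf → VPFP.L2 → VPFP.L2,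
          (N = VPFP.fieldInside B ∨ N = VPFP.fieldOutside B) →
        ∀ f₀ : VPFP.L2, ∫ p, f₀ p ∂VPFP.phaseMeasure = 0 → ‖f₀‖ ≤ ε₀ →
          (∃! p : C(ℝ≥0, VPFP.L2) × C(ℝ≥0, VPFP.LInf),
            VPFP.IsMildSolution S N K σ f₀ p.1 p.2) ∧
          ∀ (f : C(ℝ≥0, VPFP.L2)) (E : C(ℝ≥0, VPFP.LInf)),
            VPFP.IsMildSolution S N K σ f₀ f E →
            ∀ t : ℝ≥0, ‖f t‖ ≤ C₀ * Real.exp (-κ₀ * t) ∧ ‖E t‖ ≤ C₀ * Real.exp (-κ₀ * t) := by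
  refine ⟨VPFP.semi 1, VPFP.semiDvStar, VPFP.isFPSemigroup_semi, VPFP.isFPDvStar_semiDvStar,
    fun M => ?_⟩
  -- `a` is the strength of the nonlinearity; the fixed point lives in a ball of radius `r`
  set a : ℝ := VPFP.smoothConst * |M| * Real.sqrt (4 * Real.pi) with ha
  have ha0 : 0 ≤ a := mul_nonneg (mul_nonneg VPFP.smoothConst_pos.le (abs_nonneg _))
    (Real.sqrt_nonneg _)
  set r : ℝ := 1 / (4 * (a + 1)) with hr
  have hr0 : 0 < r := by positivity
  have hra : 2 * r * a ≤ 1 / 2 := by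
    rw [hr, mul_one_div, div_mul_eq_mul_div, div_le_div_iff₀ (by positivity) two_pos]
    linarith
  refine ⟨r / 2 * Real.exp (-2), (1 + |M|) * r, 1 / 4, by positivity, by positivity, by norm_num,
    fun K hKs hM σ hσ N hN f₀ hmean hf₀ => ?_⟩
  have hM0 : |M| = M := abs_of_nonneg ((abs_nonneg _).trans (hM 0))
  have hK : Continuous K :=
    QuotientAddGroup.isOpenQuotientMap_mk.isQuotientMap.continuous_iff.2 hKs.continuous
  have hn := VPFP.quadraticKernel_field hK hM hσ hN
  rw [← VPFP.inner_oneL] at hmean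
  have hU : ∀ t : ℝ≥0, ‖VPFP.semi 1 t f₀‖ ≤ r / 2 * Real.exp (-(1 / 4) * t) := by
    intro t
    refine (VPFP.norm_semi_le_of_mean_zero hmean t).trans ?_
    have h1 : Real.exp (-(t : ℝ)) ≤ Real.exp (-(1 / 4) * t) :=
      Real.exp_le_exp.2 (by linarith [t.coe_nonneg])
    calc _ ≤ Real.exp 2 * Real.exp (-(1 / 4) * t) * (r / 2 * Real.exp (-2)) := by gcongr
      _ = (Real.exp 2 * Real.exp (-2)) * (r / 2 * Real.exp (-(1 / 4) * t)) := by ring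
      _ = _ := by rw [← Real.exp_add]; simp
  obtain ⟨f, hfe, hfb⟩ := hn.exists_solution (VPFP.continuous_semi (by norm_num) f₀) hr0.le
    (by rw [← hM0]; exact hra) hU
  have huniq : ∀ (g : C(ℝ≥0, VPFP.L2)) (E : C(ℝ≥0, VPFP.LInf)),
      VPFP.IsMildSolution (VPFP.semi 1) N K σ f₀ g E →
        g = f ∧ ∀ t, E t = σ • VPFP.fieldOp hK hM (f t) := by
    intro g E hg
    obtain ⟨h1, h2⟩ := (VPFP.isMildSolution_iff hK hM hσ hN f₀ g E).1 hg
    have h3 : g = f := DFunLike.coe_injective (hn.unique g.continuous f.continuous h1 hfe)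
    exact ⟨h3, h3 ▸ h2⟩
  let E : C(ℝ≥0, VPFP.LInf) := ⟨fun t => σ • VPFP.fieldOp hK hM (f t),
    ((VPFP.fieldOp hK hM).continuous.comp f.continuous).const_smul σ⟩
  refine ⟨⟨(f, E), (VPFP.isMildSolution_iff hK hM hσ hN f₀ f E).2 ⟨hfe, fun t => rfl⟩, ?_⟩, ?_⟩
  · rintro ⟨g, E'⟩ hg
    obtain ⟨h1, h2⟩ := huniq g E' hg
    exact Prod.ext h1 (ContinuousMap.ext h2)
  · intro g E' hg t
    obtain ⟨rfl, h2⟩ := huniq g E' hg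
    have hb := hfb t
    have hexp := Real.exp_pos (-(1 / 4) * (t : ℝ))
    have hre : 0 ≤ r * Real.exp (-(1 / 4) * t) := by positivity
    have hMe : 0 ≤ |M| * (r * Real.exp (-(1 / 4) * t)) := by positivity
    constructor
    · linarith
    · rw [h2 t]
      have h3 := VPFP.norm_smul_fieldOp_le hK hM hσ (g t)
      have h4 := h3.trans (mul_le_mul (le_abs_self M) hb (norm_nonneg _) (abs_nonneg M))
      linarith
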